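/- For a word $w$ of length $n$, let $A_N(w)$ be the minimum number of states of a nondeterministic finite automaton $M$ with a single initial state and no $\varepsilon$-transitions that \emph{uniquely accepts} $w$, i.e. that accepts $w$ and has only one accepting path of length $n$ (a path being a sequence of labelled transitions). Let $D(w)=\lfloor n/2\rfloor+1-A_N(w)$, and let DEFICIENCY be the decision problem: given a binary word $w$ and an integer $d\ge 0$ (written in binary), is $D(w)>d$? Then: (1) DEFICIENCY is in NP. (2) DEFICIENCY is in $\mathrm{E}=\mathrm{DTIME}(2^{O(n)})$, where $n$ is the length of the input. (3) Let $M$ uniquely accept a word $w$ of length $n$ by the path $q_0,\dots,q_n$. Let $P'=(e_0,\dots,e_t)$ be the sequence of edges obtained from the edge $e_0$ that enters $q_0$, with no source, followed by the edges $q_0\to q_1,\dots,q_{n-1}\to q_n$, by deleting each edge that occurred earlier. Put $a_0=\varepsilon$ and $a_i=0$ for $i\ge1$. Define strings $E(i,m)$ over the four symbols $0,[,],+$ by $E(i,m)=\varepsilon$ for $i>m$ and, for $i\le m$, according to the edges of $P'$ that enter and leave the target $v$ of $e_i$: (a) in $\{e_i\}$, out $\{e_{i+1}\}$: $E(i,m)=a_i\,E(i+1,m)$;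 (b) in $\{e_i,e_j\}$ with $j>i$, out $\{e_{i+1}\}$: $E(i,m)=a_i\,[\,E(i+1,j-1)\,]\,E(j+1,m)$; (c) in $\{e_i\}$, out $\{e_{i+1},e_j\}$ with $j>i+1$: $E(i,m)=a_i\,{+}\,E(i+1,m)$; (d) in $\{e_i,e_j\}$ with $j>i$, out $\{e_{i+1},e_{j+1}\}$: $E(i,m)=a_i\,[\,{+}\,E(i+1,j-1)\,]\,E(j+1,m)$; (e) $i=t$, in $\{e_t\}$, out $\emptyset$: $E(i,m)=a_i\,E(i+1,m)$. Then this recursion defines exactly one string $E(0,t)$, its length is at most $2(n+1)$, and $E(0,t)$ determines $P'$ up to renaming of the states: if two uniquely accepting automata (for possibly different words and alphabets) have the same string $E(0,t)$, then a map that is injective on the states visited carries the sequence $P'$ of the first to that of the second. -/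

import Mathlib

/-! ## Deterministic time classes and NP over multi-stack Turing machines -/

namespace Complexity

/-- `DTIME f` is the class of languages `L` over the alphabet `Γ` that are decided by a Turing
machine (Mathlib's finite multi-stack model, which simulates and is simulated by multi-tape
machines step by step with constant overhead), in time `O(f n)` on inputs of length `n`. The machine
receives the word on its input stack and outputs the bit `decide (x ∈ L)`. -/
def DTIME {Γ : Type} (f : ℕ → ℕ) : Set (Language Γ) :=
  {L | ∃ M : Turing.TM2ComputableInTime (id : List Γ → List Γ) (fun b : Bool => [b])
        (fun x : List Γ => @decide (x ∈ L) (Classical.propDecidable _)),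
      (fun n : ℕ => (M.time n : ℝ)) =O[Filter.atTop] (fun n : ℕ => (f n : ℝ))}

/-- Polynomial time. -/
def P {Γ : Type} : Set (Language Γ) := ⋃ k : ℕ, DTIME (fun n => n ^ k)

/-- `E = DTIME(2^{O(n)})`. -/
def E {Γ : Type} : Set (Language Γ) := ⋃ c : ℕ, DTIME (fun n => 2 ^ (c * n))

/-- The pair of a word `x` and a binary certificate `y`, as the single word `x # y`. -/
def pairWord {Γ : Type} (x : List Γ) (y : List Bool) : List (Option (Γ ⊕ Bool)) :=
  x.map (fun a => some (Sum.inl a)) ++ none :: y.map (fun b => some (Sum.inr b))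

/-- `NP`: membership is witnessed by a certificate of polynomially bounded length that can be
verified in polynomial time. -/
def NP {Γ : Type} : Set (Language Γ) :=
  {L | ∃ V : Language (Option (Γ ⊕ Bool)), V ∈ (P : Set (Language (Option (Γ ⊕ Bool)))) ∧
      ∃ r : Polynomial ℕ, ∀ x : List Γ,
        x ∈ L ↔ ∃ y : List Bool, y.length ≤ r.eval x.length ∧ pairWord x y ∈ V}

end Complexity

/-! ## Nondeterministic automatic complexity -/

namespace AutomaticComplexity

/-- The states `p 0, …, p n` and the letters `x 0, …, x (n-1)` form an accepting path of length `n`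
in the automaton `M`. (Mathlib's `NFA` has no `ε`-transitions.) -/
def IsAcceptingPath {α σ : Type} (M : NFA α σ) {n : ℕ} (p : Fin (n + 1) → σ) (x : Fin n → α) :
    Prop :=
  p 0 ∈ M.start ∧ p (Fin.last n) ∈ M.accept ∧
    ∀ i : Fin n, p i.succ ∈ M.step (p i.castSucc) (x i)

/-- `M` has a single initial state, it accepts `w`, and it has only one accepting path of length
`|w|` (a path being a sequence of labelled transitions). -/
def UniquelyAccepts {α σ : Type} (M : NFA α σ) (w : List α) : Prop :=
  (∃ q₀, M.start = {q₀}) ∧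
    ∃ p : Fin (w.length + 1) → σ, IsAcceptingPath M p w.get ∧
      ∀ (p' : Fin (w.length + 1) → σ) (x' : Fin w.length → α),
        IsAcceptingPath M p' x' → p' = p ∧ x' = w.get

/-- The nondeterministic automatic complexity `A_N(w)`. -/
noncomputable def complexityN {α : Type} (w : List α) : ℕ :=
  sInf {q : ℕ | ∃ M : NFA α (Fin q), UniquelyAccepts M w}

/-- The complexity deficiency `D(w) = ⌊|w| / 2⌋ + 1 - A_N(w)`. -/
noncomputable def deficiency {α : Type} (w : List α) : ℤ :=
  ((w.length / 2 + 1 : ℕ) : ℤ) - (complexityN w : ℤ)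

/-- The instance `(w, d)` as the word `w # d` over the alphabet `{0, 1, #}`, with `d` in binary. -/
def encodeInstance (w : List Bool) (d : ℕ) : List (Option Bool) :=
  w.map some ++ none :: d.bits.map some

/-- The decision problem: given a binary word `w` and an integer `d ≥ 0`, is `D(w) > d`? -/
def DEFICIENCY : Language (Option Bool) :=
  {s | ∃ (w : List Bool) (d : ℕ), s = encodeInstance w d ∧ deficiency w > (d : ℤ)}

/-! ## Bracket codes -/

/-- The path with states `p 0, …, p n` as a sequence of `n + 1` edges `(source, target)` of the
transition diagram. The first edge, which has no source, is the edge that enters the initial state.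
Letters are dropped; this does not identify different transitions of an accepting path that is
unique, since such a path cannot traverse two parallel edges. -/
def pathEdges {σ : Type} {n : ℕ} (p : Fin (n + 1) → σ) : List (Option σ × σ) :=
  (none, p 0) :: List.ofFn (fun i : Fin n => (some (p i.castSucc), p i.succ))

/-- The abbreviated path `P'`: every edge is kept only where it is traversed for the first time. -/
def abbreviatedPath {σ : Type} [DecidableEq σ] {n : ℕ} (p : Fin (n + 1) → σ) :
    List (Option σ × σ) :=
  (pathEdges p).eraseDups

/-- The four symbols `0`, `[`, `]`, `+`. -/
inductive Symbol
  | zero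
  | lbr
  | rbr
  | plus

/-- The label `a_i` of an edge: empty for the edge that enters the initial state, else `0`. -/
def edgeLabel {σ : Type} : Option σ × σ → List Symbol
  | (none, _) => []
  | (some _, _) => [Symbol.zero]

/-- The indices of the edges of `P` that enter `v`. -/
def inEdges {σ : Type} (P : List (Option σ × σ)) (v : σ) : Set ℕ :=
  {k | ∃ u : Option σ, P[k]? = some (u, v)}

/-- The indices of the edges of `P` that leave `v`. -/
def outEdges {σ : Type} (P : List (Option σ × σ)) (v : σ) : Set ℕ :=
  {k | ∃ u : σ, P[k]? = some (some v, u)}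

/-- For `P = (e_0, …, e_t)`, `IsCode P i m c` says that `c` is the string `E(i, m)`, which is
defined by recursion according to the type of the vertex `v` that the edge `e_i` enters. -/
inductive IsCode {σ : Type} (P : List (Option σ × σ)) : ℕ → ℕ → List Symbol → Prop
  | empty {i m : ℕ} : m < i → IsCode P i m []
  | type1 {i m : ℕ} {e : Option σ × σ} {c : List Symbol} :
      i ≤ m → P[i]? = some e →
      inEdges P e.2 = {i} → outEdges P e.2 = {i + 1} →
      IsCode P (i + 1) m c →
      IsCode P i m (edgeLabel e ++ c)
  | type2 {i j m : ℕ} {e : Option σ × σ} {c c' : List Symbol} :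
      i ≤ m → P[i]? = some e → i < j →
      inEdges P e.2 = {i, j} → outEdges P e.2 = {i + 1} →
      IsCode P (i + 1) (j - 1) c → IsCode P (j + 1) m c' →
      IsCode P i m (edgeLabel e ++ [Symbol.lbr] ++ c ++ [Symbol.rbr] ++ c')
  | type3 {i j m : ℕ} {e : Option σ × σ} {c : List Symbol} :
      i ≤ m → P[i]? = some e → i + 1 < j →
      inEdges P e.2 = {i} → outEdges P e.2 = {i + 1, j} →
      IsCode P (i + 1) m c →
      IsCode P i m (edgeLabel e ++ [Symbol.plus] ++ c)
  | type4 {i j m : ℕ} {e : Option σ × σ} {c c' : List Symbol} :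
      i ≤ m → P[i]? = some e → i < j →
      inEdges P e.2 = {i, j} → outEdges P e.2 = {i + 1, j + 1} →
      IsCode P (i + 1) (j - 1) c → IsCode P (j + 1) m c' →
      IsCode P i m (edgeLabel e ++ [Symbol.lbr, Symbol.plus] ++ c ++ [Symbol.rbr] ++ c')
  | type5 {i m : ℕ} {e : Option σ × σ} {c : List Symbol} :
      i ≤ m → P[i]? = some e → i + 1 = P.length →
      inEdges P e.2 = {i} → outEdges P e.2 = ∅ →
      IsCode P (i + 1) m c →
      IsCode P i m (edgeLabel e ++ c)

/-- `c` is the bracket code `E(0, t)` of the path with states `p 0, …, p n`, where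
`(e_0, …, e_t)` is the abbreviated path. -/
def IsBracketCode {σ : Type} [DecidableEq σ] {n : ℕ} (p : Fin (n + 1) → σ) (c : List Symbol) :
    Prop :=
  IsCode (abbreviatedPath p) 0 ((abbreviatedPath p).length - 1) c

end AutomaticComplexity

/-! Combinatorics. Suppose that a walk is the only one of its length and end points that uses only
its own edges. If two segments of it, one after the other, join the same pair of vertices, then
interchanging them gives a walk of the same length with the same edges, so the interchange has no
effect (`UniquePath.swap`). Hence all visits of a vertex but the last are left by the same edge, and
all visits but the first are entered by the same edge. Call the first traversal of an edge a back
edge if it leads to a vertex seen before. A vertex is entered by at most one back edge, at its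
second visit, and the loops closed by back edges are properly nested
(`UniquePath.backEdge_laminar`). After a back edge the walk repeats the loop up to the next new
edge, which leaves the first vertex of the loop that has two outgoing edges
(`UniquePath.next_source`).

Bracket code. These facts are collected in `IsNested` as properties of the list of new edges.
Nesting makes the recursion for the code meaningful, and each edge accounts for at most two symbols
(`IsNested.exists_codeShape`). Conversely the string can be parsed in only one way. The parse tells
which edges return to which earlier vertex and which vertices have a second exit
(`CodeShape.sameRole`). This fixes all targets up to renaming. It also fixes the sources: after a
first entrance the next edge leaves the vertex just entered, and after a return it leaves the first
vertex of the loop with a second exit (`IsNested.exists_renaming`).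

Certificates. The inequality `D(w) > d` means `2 * (A_N(w) + d) ≤ n`. A certificate spends four bits
on each letter: whether the next state is new, one bit for a stack, the letter, and whether a
counter for `d` is increased. By nesting, the target of a back edge is on top of a stack of states
that are still to be returned to, and an old edge is forced by the current state. So no state is
ever named, and the certificate has linear length, where explicit names would cost a logarithmic
factor. Uniqueness of the decoded run is tested by going backwards through the states from which a
run can deviate and still arrive at the same end (`uniqueRun_iff`). Together this gives
`mem_DEFICIENCY_iff`: NP follows directly, and E by trying all certificates.

Machines. Structured programs with loops are compiled to multi-stack machines (`Exec.steps`). All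
data are binary trees in prefix notation on one stack. The functions in `PolyTime` are closed under
composition, pairing, case distinction, and folds whose intermediate results stay polynomially
bounded, which suffices for the verifier (`polyTime_verify`). The search for E runs one fold with
exponentially large intermediate results (`mem_E_of_polyTime`). -/

namespace AutomaticComplexity

/-! ## Walks that are determined by their length, end points and set of edges -/

section UniquePath

variable {σ : Type*} {p : ℕ → σ} {n : ℕ}

/-- The walk `p 0, …, p n` is the only walk of length `n` with the same end points that uses only
edges of `p`. -/
def UniquePath (p : ℕ → σ) (n : ℕ) : Prop :=
  ∀ q : ℕ → σ, q 0 = p 0 → q n = p n →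
    (∀ i < n, ∃ k < n, q i = p k ∧ q (i + 1) = p (k + 1)) → ∀ i ≤ n, q i = p i

/-- Two segments of a walk with the same end points can be interchanged. -/
theorem UniquePath.swap (hU : UniquePath p n) {a b c d : ℕ} (hab : a ≤ b) (hbc : b ≤ c)
    (hcd : c ≤ d) (hd : d ≤ n) (hac : p a = p c) (hbd : p b = p d) :
    (∀ s ≤ d - c, p (a + s) = p (c + s)) ∧ (∀ s ≤ b - a, p (d - s) = p (b - s)) := by
  -- The rearranged walk traverses `[0, a]`, `[c, d]`, `[b, c]`, `[a, b]`, `[d, n]` in this order.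
  -- The facts `v1` to `v5` evaluate it on the closed segments; at the common end points the
  -- formulas agree because of `hac` and `hbd`.
  let f : ℕ → ℕ := fun i =>
    if i < a then i else if i < a + (d - c) then c + (i - a)
    else if i < a + (d - b) then b + (i - (a + (d - c)))
    else if i < d then a + (i - (a + (d - b))) else i
  have v5 : ∀ i, d ≤ i → f i = i := fun i hi => by
    simp only [f]; split_ifs <;> omega
  have v4 : ∀ i, a + (d - b) ≤ i → i ≤ d → p (f i) = p (a + (i - (a + (d - b)))) := fun i h1 h2 => by
    rcases h2.eq_or_lt with rfl | h2
    · rw [v5 i le_rfl, ← hbd]; congr 1; omega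
    · congr 1; simp only [f]; split_ifs <;> omega
  have v3 : ∀ i, a + (d - c) ≤ i → i ≤ a + (d - b) → p (f i) = p (b + (i - (a + (d - c)))) :=
    fun i h1 h2 => by
    rcases h2.eq_or_lt with rfl | h2
    · rw [v4 _ le_rfl (by omega), Nat.sub_self, add_zero, hac]; congr 1; omega
    · congr 1; simp only [f]; split_ifs <;> omega
  have v2 : ∀ i, a ≤ i → i ≤ a + (d - c) → p (f i) = p (c + (i - a)) := fun i h1 h2 => by
    rcases h2.eq_or_lt with rfl | h2
    · rw [v3 _ le_rfl (by omega), Nat.sub_self, add_zero, hbd]; congr 1; omega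
    · congr 1; simp only [f]; split_ifs <;> omega
  have v1 : ∀ i ≤ a, p (f i) = p i := fun i h2 => by
    rcases h2.eq_or_lt with rfl | h2
    · rw [v2 _ le_rfl (by omega), Nat.sub_self, add_zero, hac]
    · congr 1; simp only [f]; split_ifs <;> omega
  have key : ∀ i ≤ n, p (f i) = p i := by
    apply hU (fun i => p (f i)) (v1 0 (by omega)) (by rw [v5 n hd])
    intro i hi
    rcases lt_or_ge i a with h | h
    · exact ⟨i, hi, v1 i h.le, v1 _ h⟩
    rcases lt_or_ge i (a + (d - c)) with h' | h'
    · exact ⟨c + (i - a), by omega, v2 i h h'.le, by rw [v2 _ (by omega) h']; congr 1; omega⟩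
    rcases lt_or_ge i (a + (d - b)) with h'' | h''
    · exact ⟨b + (i - (a + (d - c))), by omega, v3 i h' h''.le,
        by rw [v3 _ (by omega) h'']; congr 1; omega⟩
    rcases lt_or_ge i d with h3 | h3
    · exact ⟨a + (i - (a + (d - b))), by omega, v4 i h'' h3.le,
        by rw [v4 _ (by omega) h3]; congr 1; omega⟩
    · exact ⟨i, hi, by simp only [v5 i h3], by simp only [v5 (i + 1) (by omega)]⟩
  constructor
  · intro s hs
    rw [← key (a + s) (by omega), v2 _ (by omega) (by omega), Nat.add_sub_cancel_left]
  · intro s hs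
    rw [← key (d - s) (by omega), v4 _ (by omega) (by omega)]
    congr 1; omega

/-- All visits of a vertex but the last one have the same successor. -/
theorem UniquePath.succ_eq (hU : UniquePath p n) {a b c d : ℕ} (hac : a < c) (hbd : b < d)
    (hc : c ≤ n) (hd : d ≤ n) (hab : p a = p b) (h1 : p a = p c) (h2 : p a = p d) :
    p (a + 1) = p (b + 1) := by
  -- The loops `[a, b]` and `[b, c]` at the same vertex are interchanged; the middle segment is
  -- empty.
  have main : ∀ a b c, a < b → b < c → c ≤ n → p a = p b → p b = p c → p (a + 1) = p (b + 1) :=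
    fun a b c h h' h'' e e' =>
      (hU.swap h.le le_rfl h'.le h'' e e').1 1 (by omega)
  rcases lt_trichotomy a b with h | h | h
  · exact main a b d h hbd hd hab (hab.symm.trans h2)
  · rw [h]
  · exact (main b a c h hac hc hab.symm h1).symm

/-- All visits of a vertex but the first one have the same predecessor. -/
theorem UniquePath.pred_eq (hU : UniquePath p n) {a b c : ℕ} (hab : a < b) (hbc : b < c)
    (hc : c ≤ n) (h1 : p a = p b) (h2 : p b = p c) : p (c - 1) = p (b - 1) :=
  (hU.swap hab.le le_rfl hbc.le hc h1 h2).2 1 (by omega)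

/-- The edge by which the walk enters its `i`-th vertex. -/
def edgeAt (p : ℕ → σ) (i : ℕ) : Option σ × σ :=
  (if i = 0 then none else some (p (i - 1)), p i)

@[simp] theorem edgeAt_zero : edgeAt p 0 = (none, p 0) := rfl

@[simp] theorem edgeAt_succ (i : ℕ) : edgeAt p (i + 1) = (some (p i), p (i + 1)) := by
  simp [edgeAt]

theorem edgeAt_snd (i : ℕ) : (edgeAt p i).2 = p i := rfl

/-- The edge at position `i` occurs there for the first time. -/
def NewEdge (p : ℕ → σ) (i : ℕ) : Prop := ∀ k < i, edgeAt p k ≠ edgeAt p i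

/-- The vertex at position `i` occurs there for the first time. -/
def NewVertex (p : ℕ → σ) (i : ℕ) : Prop := ∀ k < i, p k ≠ p i

/-- At position `i` a new edge leads back to an old vertex. -/
def BackEdge (p : ℕ → σ) (i : ℕ) : Prop := NewEdge p i ∧ ¬ NewVertex p i

theorem NewVertex.newEdge {i : ℕ} (h : NewVertex p i) : NewEdge p i := fun k hk e =>
  h k hk (congrArg Prod.snd e)

theorem newEdge_of_newVertex {i : ℕ} (h : NewVertex p i) : NewEdge p (i + 1) := by
  intro k hk e
  cases k with
  | zero => simp at e
  | succ k =>
    simp only [edgeAt_succ, Prod.mk.injEq, Option.some.injEq] at e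
    exact h k (by omega) e.1

theorem exists_newVertex (p : ℕ → σ) (i : ℕ) : ∃ b ≤ i, p b = p i ∧ NewVertex p b := by
  induction i using Nat.strong_induction_on with
  | _ i ih =>
    by_cases h : NewVertex p i
    · exact ⟨i, le_rfl, rfl, h⟩
    · simp only [NewVertex, not_forall, not_not] at h
      obtain ⟨k, hk, e⟩ := h
      obtain ⟨b, hb, hbk, hn⟩ := ih k hk
      exact ⟨b, by omega, hbk.trans e, hn⟩

theorem NewVertex.unique {a b : ℕ} (ha : NewVertex p a) (hb : NewVertex p b) (h : p a = p b) :
    a = b := by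
  rcases lt_trichotomy a b with h' | h' | h'
  · exact absurd h (hb a h')
  · exact h'
  · exact absurd h.symm (ha b h')

theorem NewVertex.le {a b : ℕ} (ha : NewVertex p a) (h : p b = p a) : a ≤ b := by
  by_contra hlt
  exact ha b (by omega) h

theorem BackEdge.exists_newVertex {d : ℕ} (h : BackEdge p d) :
    ∃ b < d, p b = p d ∧ NewVertex p b := by
  obtain ⟨b, hb, e, hn⟩ := AutomaticComplexity.exists_newVertex p d
  refine ⟨b, lt_of_le_of_ne hb ?_, e, hn⟩
  rintro rfl
  exact h.2 hn

/-- A back edge enters a vertex at its second visit. -/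
theorem UniquePath.backEdge_second (hU : UniquePath p n) {a b d : ℕ} (h : BackEdge p d)
    (hd : d ≤ n) (hab : a < b) (hbd : b < d) (h1 : p a = p b) : p b ≠ p d := by
  intro h2
  apply h.1 b hbd
  -- At a third visit the entering edge would be the one used at the second visit, hence not new.
  have := hU.pred_eq hab hbd hd h1 h2
  simp only [edgeAt, h2, this]
  simp [show b ≠ 0 by omega, show d ≠ 0 by omega]

theorem UniquePath.backEdge_unique (hU : UniquePath p n) {d d' : ℕ} (h : BackEdge p d)
    (h' : BackEdge p d') (hd : d ≤ n) (hd' : d' ≤ n) (e : p d = p d') : d = d' := by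
  have main : ∀ d d', BackEdge p d → BackEdge p d' → d' ≤ n → p d = p d' → ¬ d < d' := by
    intro d d' h h' hd' e hlt
    obtain ⟨b, hb, e', -⟩ := h.exists_newVertex
    exact hU.backEdge_second h' hd' hb hlt e' e
  have := main d d' h h' hd' e
  have := main d' d h' h hd e.symm
  omega

/-- The loop closed by a back edge contains only vertices that do not occur before the loop. -/
theorem UniquePath.backEdge_laminar (hU : UniquePath p n) {a b c d : ℕ} (h : BackEdge p d)
    (hd : d ≤ n) (hbd : p b = p d) (hab : a < b) (hbc : b ≤ c) (hcd : c < d) : p a ≠ p c := by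
  intro hac
  -- Otherwise `[a, b]` and `[c, d]` join the same vertices. Interchanging them shows that the edge
  -- at `d` was already traversed at `b`.
  have := (hU.swap hab.le hbc hcd.le hd hac hbd).2 1 (by omega)
  apply h.1 b (by omega)
  simp only [edgeAt, hbd, this]
  simp [show b ≠ 0 by omega, show d ≠ 0 by omega]

/-- If the edge after an old visit of a vertex is old, then it is the one that was taken after any
earlier visit of that vertex. -/
theorem UniquePath.succ_of_not_newEdge (hU : UniquePath p n) {i k : ℕ} (h : ¬ NewEdge p (i + 1))
    (hi : i + 1 ≤ n) (hk : k < i) (e : p k = p i) : p (i + 1) = p (k + 1) := by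
  simp only [NewEdge, not_forall, not_not] at h
  obtain ⟨l, hl, e'⟩ := h
  cases l with
  | zero => simp at e'
  | succ l =>
    simp only [edgeAt_succ, Prod.mk.injEq, Option.some.injEq] at e'
    rw [← e'.2]
    -- Neither `l` nor `k` is the last visit of this vertex, because `i` comes later.
    exact hU.succ_eq (c := i) (d := i) (by omega) hk (by omega) (by omega) (e'.1.trans e.symm)
      e'.1 e'.1

/-- If a new edge is taken after an old visit of a vertex, then this is the last visit. -/
theorem UniquePath.last_of_newEdge (hU : UniquePath p n) {a b c : ℕ} (h : NewEdge p (b + 1))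
    (hab : a < b) (hbc : b < c) (hc : c ≤ n) (e : p a = p b) : p b ≠ p c := by
  intro e'
  have := hU.succ_eq (hab.trans hbc) hbc hc hc e (e.trans e') (e.trans e')
  apply h (a + 1) (by omega)
  simp [e, this]

/-- After a back edge, the walk repeats the loop until it takes the next new edge. -/
theorem UniquePath.repeat_loop (hU : UniquePath p n) {b d g : ℕ} (hbd : p b = p d)
    (hlt : b < d) (hg : g < n) (hold : ∀ i, d < i → i ≤ g → ¬ NewEdge p i) {s : ℕ}
    (hs : d + s ≤ g) : p (d + s) = p (b + s) := by
  induction s with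
  | zero => exact hbd.symm
  | succ s ih =>
    exact hU.succ_of_not_newEdge (i := d + s) (k := b + s) (hold (d + s + 1) (by omega) (by omega))
      (by omega) (by omega)
      (ih (by omega)).symm

/-- Let `d` be the position of a back edge to the vertex first visited at `b`, and `g + 1` the
position of the next new edge. Then `p g` was visited first at some `c` in `[b, d)`, and between
`b` and `c` no vertex has two outgoing edges. -/
theorem UniquePath.next_source (hU : UniquePath p n) {b d g : ℕ} (h : BackEdge p d)
    (hb : NewVertex p b) (hbd : p b = p d) (hdg : d ≤ g) (hg : g < n)
    (hnew : NewEdge p (g + 1)) (hold : ∀ i, d < i → i ≤ g → ¬ NewEdge p i) :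
    ∃ c, b ≤ c ∧ c < d ∧ p c = p g ∧ NewVertex p c ∧
      ∀ k, b ≤ k → k < c → NewVertex p k → ∀ h, k ≤ h → h < n → p h = p k → p (h + 1) = p (k + 1) := by
  have hlt : b < d := by
    obtain ⟨b', h1, h2, h3⟩ := h.exists_newVertex
    rwa [hb.unique h3 (hbd.trans h2.symm)]
  obtain ⟨s₀, rfl⟩ := Nat.exists_eq_add_of_le hdg
  have hrep : ∀ s ≤ s₀, p (d + s) = p (b + s) := fun s hs =>
    hU.repeat_loop hbd hlt hg hold (by omega)
  -- The repetition may go round the loop several times; a witness that would reach `d` is replaced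
  -- by `b`.
  have hin : ∀ s ≤ s₀, ∃ c, b ≤ c ∧ c < d ∧ p c = p (d + s) := by
    intro s
    induction s with
    | zero => exact fun _ => ⟨b, le_rfl, hlt, hbd⟩
    | succ s ih =>
      intro hs
      obtain ⟨c, h1, h2, h3⟩ := ih (by omega)
      have := hU.succ_of_not_newEdge (hold (d + s + 1) (by omega) (by omega)) (by omega)
        (by omega) h3
      by_cases hc : c + 1 < d
      · exact ⟨c + 1, by omega, hc, by rw [← this]; rfl⟩
      · refine ⟨b, le_rfl, hlt, ?_⟩
        rw [← add_assoc, this, hbd]; congr 1; omega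
  obtain ⟨c', h1, h2, h3⟩ := hin s₀ le_rfl
  obtain ⟨c, hc, e, hcn⟩ := exists_newVertex p c'
  have hbc : b ≤ c := by
    by_contra hlt'
    exact hU.backEdge_laminar h (by omega) hbd (by omega) h1 h2 e
  have hcs : c ≤ b + s₀ := hcn.le (by rw [← hrep s₀ le_rfl, ← h3, e])
  refine ⟨c, hbc, by omega, e.trans h3, hcn, ?_⟩
  intro k hbk hkc hkn h hkh hhn hh
  -- A different exit from the vertex at `k` is taken only at its last visit `h`, by a new edge, and
  -- `h` turns out to lie after `d + s₀`. Interchanging the loops `[b + s, d + s]` and `[d + s, h]`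
  -- then shows that the edge at `d + s₀ + 1` was already traversed at `b + s₀ + 1`, so it is not
  -- new.
  by_contra hne
  obtain ⟨s, rfl⟩ := Nat.exists_eq_add_of_le hbk
  have hks := hrep s (by omega)
  rcases hkh.eq_or_lt with rfl | hkh
  · exact hne rfl
  -- `h` is the last visit of the vertex
  have hlast : ∀ i, h < i → i ≤ n → p i ≠ p h := by
    intro i hi hin' e'
    exact hne (hU.succ_eq hi (hkh.trans hi) hin' hin' hh e'.symm e'.symm)
  have hnewh : NewEdge p (h + 1) := by
    by_contra hold'
    exact hne (hU.succ_of_not_newEdge hold' (by omega) hkh hh.symm)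
  have hdh : d + s ≤ h := by
    by_contra hlt'
    exact hlast (d + s) (by omega) (by omega) (hks.trans hh.symm)
  have hgh : d + s₀ ≤ h := by
    by_contra hlt'
    exact hold (h + 1) (by omega) (by omega) hnewh
  rcases hgh.eq_or_lt with rfl | hgh
  · exact hcn (b + s) hkc (by rw [← hh, e, h3])
  have hsw := (hU.swap (a := b + s) (b := d + s) (c := d + s) (d := h) (by omega) le_rfl hdh
    (by omega) hks.symm (hks.trans hh.symm)).1
  have e1 := hsw (s₀ - s) (by omega)
  have e2 := hsw (s₀ - s + 1) (by omega)
  apply hnew (b + s + (s₀ - s) + 1) (by omega)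
  rw [edgeAt_succ, edgeAt_succ, e1, add_assoc _ (s₀ - s), e2, show d + s + (s₀ - s) = d + s₀ by omega,
    show d + s + (s₀ - s + 1) = d + s₀ + 1 by omega]

/-- A vertex entered by a back edge has no other new edge after it than the next new edge. -/
theorem UniquePath.old_of_return (hU : UniquePath p n) {b d g : ℕ} (hbd : p b = p d)
    (hlt : b < d) (hdg : d ≤ g) (hg : g ≤ n) (e : p d = p g) :
    ∀ i, d < i → i ≤ g → ¬ NewEdge p i := by
  intro i hi hig hnew
  -- Interchanging the loops `[b, d]` and `[d, g]` shows that an edge of the second loop was already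
  -- traversed at the same distance after `b`.
  have hsw := (hU.swap hlt.le le_rfl hdg hg hbd e).1
  have e1 := hsw (i - d) (by omega)
  have e2 := hsw (i - 1 - d) (by omega)
  apply hnew (b + (i - d)) (by omega)
  obtain ⟨s, rfl⟩ := Nat.exists_eq_add_of_lt hi
  simp only [show d + s + 1 - d = s + 1 by omega, show d + s + 1 - 1 - d = s by omega] at e1 e2
  rw [edgeAt_succ, show b + (d + s + 1 - d) = b + s + 1 by omega, edgeAt_succ, e2]
  congr 1

end UniquePath

end AutomaticComplexity

namespace AutomaticComplexity

/-! ## The list of new edges of a walk -/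

section NewEdges

variable {σ : Type} {p : ℕ → σ} {n : ℕ}

open Classical in
/-- The number of new edges before position `i`; this is the index of a new edge at position `i`. -/
noncomputable def newIndex (p : ℕ → σ) (i : ℕ) : ℕ := Nat.count (NewEdge p) i

theorem newIndex_succ_of_newEdge {i : ℕ} (h : NewEdge p i) :
    newIndex p (i + 1) = newIndex p i + 1 := by
  simp [newIndex, Nat.count_succ, h]

theorem newIndex_succ_of_newVertex {i : ℕ} (h : NewVertex p i) :
    newIndex p (i + 1) = newIndex p i + 1 := newIndex_succ_of_newEdge h.newEdge

theorem newIndex_succ_of_not {i : ℕ} (h : ¬ NewEdge p i) :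
    newIndex p (i + 1) = newIndex p i := by
  simp [newIndex, Nat.count_succ, h]

theorem newIndex_mono {i j : ℕ} (h : i ≤ j) : newIndex p i ≤ newIndex p j := by
  classical exact Nat.count_monotone _ h

theorem newIndex_lt {i j : ℕ} (hi : NewEdge p i) (h : i < j) : newIndex p i < newIndex p j := by
  classical exact Nat.count_strict_mono hi h

theorem newIndex_lt_iff {i j : ℕ} (hi : NewEdge p i) :
    newIndex p i < newIndex p j ↔ i < j := by
  refine ⟨fun h => ?_, newIndex_lt hi⟩
  by_contra hle
  exact absurd (newIndex_mono (p := p) (not_lt.1 hle)) (by omega)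

theorem newIndex_inj {i j : ℕ} (hi : NewEdge p i) (hj : NewEdge p j)
    (h : newIndex p i = newIndex p j) : i = j := by
  classical exact Nat.count_injective hi hj h

theorem newIndex_const {i j : ℕ} (h : i ≤ j) (hold : ∀ k, i ≤ k → k < j → ¬ NewEdge p k) :
    newIndex p j = newIndex p i := by
  induction j, h using Nat.le_induction with
  | base => rfl
  | succ j hj ih =>
    rw [newIndex_succ_of_not (hold j hj (by omega)), ih fun k h1 h2 => hold k h1 (by omega)]

variable [DecidableEq σ]

/-- The edges at the positions less than `m`, each at its first occurrence. -/
def newEdges (p : ℕ → σ) (m : ℕ) : List (Option σ × σ) :=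
  ((List.range m).map (edgeAt p)).eraseDups

theorem newEdges_succ (m : ℕ) [Decidable (NewEdge p m)] :
    newEdges p (m + 1) =
      if NewEdge p m then newEdges p m ++ [edgeAt p m] else newEdges p m := by
  have key : edgeAt p m ∈ (List.range m).map (edgeAt p) ↔ ¬ NewEdge p m := by
    simp [NewEdge]
  rw [newEdges, List.range_succ, List.map_append, List.eraseDups_append, List.map_singleton]
  split_ifs with h
  · have : edgeAt p m ∉ (List.range m).map (edgeAt p) := by rw [key]; simpa using h
    rw [List.removeAll, List.filter_singleton]
    simp only [List.elem_eq_mem, decide_eq_false this]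
    rfl
  · have := key.2 h
    rw [List.removeAll, List.filter_singleton]
    simp only [List.elem_eq_mem, decide_eq_true this]
    simp [newEdges]

theorem length_newEdges (m : ℕ) : (newEdges p m).length = newIndex p m := by
  classical
  induction m with
  | zero => simp [newEdges, newIndex]
  | succ m ih =>
    rw [newEdges_succ]
    by_cases h : NewEdge p m
    · simp [h, ih, newIndex_succ_of_newEdge]
    · simp [h, ih, newIndex_succ_of_not]

/-- The dictionary between indices in the list and positions of the walk. All statements on entering
and leaving edges are translated through it. -/
theorem getElem?_newEdges {m k : ℕ} {e : Option σ × σ} :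
    (newEdges p m)[k]? = some e ↔
      ∃ i < m, NewEdge p i ∧ newIndex p i = k ∧ edgeAt p i = e := by
  classical
  induction m with
  | zero => simp [newEdges]
  | succ m ih =>
    rw [newEdges_succ]
    by_cases h : NewEdge p m
    · rw [if_pos h, List.getElem?_append, length_newEdges]
      split_ifs with hk
      · rw [ih]
        constructor
        · rintro ⟨i, hi, h'⟩
          exact ⟨i, by omega, h'⟩
        · rintro ⟨i, hi, h1, h2, h3⟩
          refine ⟨i, ?_, h1, h2, h3⟩
          rcases (Nat.lt_succ_iff.1 hi).eq_or_lt with rfl | h'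
          · omega
          · exact h'
      · constructor
        · intro h'
          rw [List.getElem?_singleton] at h'
          split_ifs at h' with h0
          exact ⟨m, by omega, h, by omega, by simpa using h'⟩
        · rintro ⟨i, hi, h1, h2, h3⟩
          rcases (Nat.lt_succ_iff.1 hi).eq_or_lt with rfl | h'
          · simp [← h2, h3]
          · exact absurd (newIndex_lt h1 h') (by omega)
    · rw [if_neg h, ih]
      constructor
      · rintro ⟨i, hi, h'⟩
        exact ⟨i, by omega, h'⟩
      · rintro ⟨i, hi, h1, h'⟩
        refine ⟨i, ?_, h1, h'⟩
        rcases (Nat.lt_succ_iff.1 hi).eq_or_lt with rfl | h''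
        · exact absurd h1 h
        · exact h''

theorem mem_inEdges {m k : ℕ} {v : σ} :
    k ∈ inEdges (newEdges p m) v ↔ ∃ i < m, NewEdge p i ∧ newIndex p i = k ∧ p i = v := by
  simp only [inEdges, Set.mem_ofPred_eq, getElem?_newEdges]
  constructor
  · rintro ⟨u, i, h1, h2, h3, h4⟩
    exact ⟨i, h1, h2, h3, congrArg Prod.snd h4⟩
  · rintro ⟨i, h1, h2, h3, h4⟩
    exact ⟨(edgeAt p i).1, i, h1, h2, h3, by rw [← h4]; rfl⟩

theorem mem_outEdges {m k : ℕ} {v : σ} :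
    k ∈ outEdges (newEdges p (m + 1)) v ↔
      ∃ g < m, NewEdge p (g + 1) ∧ newIndex p (g + 1) = k ∧ p g = v := by
  simp only [outEdges, Set.mem_ofPred_eq, getElem?_newEdges]
  constructor
  · rintro ⟨u, i, h1, h2, h3, h4⟩
    cases i with
    | zero => simp at h4
    | succ g => exact ⟨g, by omega, h2, h3, by simpa using congrArg Prod.fst h4⟩
  · rintro ⟨g, h1, h2, h3, h4⟩
    exact ⟨p (g + 1), g + 1, by omega, h2, h3, by simp [h4]⟩

end NewEdges

/-! ## The shape of the list of new edges of a unique path -/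

section Shape

variable {σ : Type}

/-- The `k`-th edge is the first one that enters its target. -/
def FirstEdge (P : List (Option σ × σ)) (k : ℕ) : Prop :=
  ∃ e, P[k]? = some e ∧ ∀ l ∈ inEdges P e.2, k ≤ l

/-- The `k`-th edge is the only one that enters its target. -/
def SingleEdge (P : List (Option σ × σ)) (k : ℕ) : Prop :=
  ∃ e, P[k]? = some e ∧ inEdges P e.2 = {k}

/-- The target of the `i`-th edge is entered a second time by the `j`-th edge. -/
def ReturnEdge (P : List (Option σ × σ)) (i j : ℕ) : Prop :=
  i < j ∧ ∃ e, P[i]? = some e ∧ inEdges P e.2 = {i, j}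

/-- The target of the `k`-th edge has an outgoing edge other than the next edge. -/
def ExitEdge (P : List (Option σ × σ)) (k : ℕ) : Prop :=
  ∃ e, P[k]? = some e ∧ ∃ j ∈ outEdges P e.2, j ≠ k + 1

/-- The properties of the list of new edges of a unique path on which the bracket code depends. -/
structure IsNested (P : List (Option σ × σ)) : Prop where
  pos : 0 < P.length
  cases : ∀ k < P.length, SingleEdge P k ∨ (∃ j, ReturnEdge P k j) ∨ ∃ j, ReturnEdge P j k
  out_single : ∀ k e, P[k]? = some e → inEdges P e.2 = {k} →
    outEdges P e.2 = {k + 1} ∨ (∃ j > k + 1, outEdges P e.2 = {k + 1, j}) ∨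
      (k + 1 = P.length ∧ outEdges P e.2 = ∅)
  out_return : ∀ k j e, P[k]? = some e → k < j → inEdges P e.2 = {k, j} →
    outEdges P e.2 = {k + 1} ∨ outEdges P e.2 = {k + 1, j + 1}
  laminar : ∀ i j k l, ReturnEdge P i j → ReturnEdge P k l → i < k → k < j → l < j
  source_zero : ∀ k e, P[k]? = some e → (e.1 = none ↔ k = 0)
  source_first : ∀ k e e', P[k]? = some e → FirstEdge P k → P[k + 1]? = some e' → e'.1 = some e.2
  source_return : ∀ i j e', ReturnEdge P i j → P[j + 1]? = some e' →
    ∃ c e, i ≤ c ∧ c < j ∧ P[c]? = some e ∧ FirstEdge P c ∧ e'.1 = some e.2 ∧ ExitEdge P c ∧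
      ∀ k, i ≤ k → k < c → FirstEdge P k → ¬ ExitEdge P k

theorem SingleEdge.firstEdge {P : List (Option σ × σ)} {k : ℕ} (h : SingleEdge P k) :
    FirstEdge P k := by
  obtain ⟨e, h1, h2⟩ := h
  exact ⟨e, h1, fun l hl => by rw [h2] at hl; exact (Set.mem_singleton_iff.1 hl).ge⟩

theorem ReturnEdge.firstEdge {P : List (Option σ × σ)} {i j : ℕ} (h : ReturnEdge P i j) :
    FirstEdge P i := by
  obtain ⟨hij, e, h1, h2⟩ := h
  refine ⟨e, h1, fun l hl => ?_⟩
  rw [h2] at hl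
  rcases hl with rfl | rfl
  · rfl
  · exact hij.le

variable [DecidableEq σ] {p : ℕ → σ} {n : ℕ}

theorem firstEdge_newEdges {i : ℕ} (hi : i ≤ n) (h : NewEdge p i) :
    FirstEdge (newEdges p (n + 1)) (newIndex p i) ↔ NewVertex p i := by
  constructor
  · rintro ⟨e, h1, h2⟩
    obtain ⟨i', h3, h4, h5, rfl⟩ := getElem?_newEdges.1 h1
    obtain rfl := newIndex_inj h4 h h5
    obtain ⟨b, hb, e, hn⟩ := exists_newVertex p i'
    have := h2 (newIndex p b) (mem_inEdges.2 ⟨b, by omega, hn.newEdge, rfl, e⟩)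
    rcases hb.eq_or_lt with rfl | hb
    · exact hn
    · exact absurd (newIndex_lt hn.newEdge hb) (by omega)
  · intro hn
    refine ⟨edgeAt p i, getElem?_newEdges.2 ⟨i, by omega, h, rfl, rfl⟩, fun l hl => ?_⟩
    obtain ⟨i', h3, h4, rfl, h5⟩ := mem_inEdges.1 hl
    exact newIndex_mono (hn.le h5)

/-- A new edge into a vertex either makes its first visit or is a back edge, and the back edge is
unique by `UniquePath.backEdge_unique`. -/
theorem UniquePath.inEdges_return (hU : UniquePath p n) {b d : ℕ} (hb : NewVertex p b)
    (hd : BackEdge p d) (hdn : d ≤ n) (e : p b = p d) :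
    inEdges (newEdges p (n + 1)) (p b) = {newIndex p b, newIndex p d} := by
  ext k
  rw [mem_inEdges, Set.mem_insert_iff, Set.mem_singleton_iff]
  constructor
  · rintro ⟨i, h1, h2, rfl, h3⟩
    by_cases hi : NewVertex p i
    · exact Or.inl (by rw [hi.unique hb h3])
    · exact Or.inr (by rw [hU.backEdge_unique ⟨h2, hi⟩ hd (by omega) hdn (h3.trans e)])
  · have := hb.le e.symm
    rintro (rfl | rfl)
    · exact ⟨b, by omega, hb.newEdge, rfl, rfl⟩
    · exact ⟨d, by omega, hd.1, rfl, e.symm⟩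

theorem returnEdge_newEdges (hU : UniquePath p n) {i j : ℕ} :
    ReturnEdge (newEdges p (n + 1)) i j ↔ ∃ b d, b < d ∧ d ≤ n ∧ newIndex p b = i ∧
      newIndex p d = j ∧ NewVertex p b ∧ BackEdge p d ∧ p b = p d := by
  constructor
  · rintro ⟨hij, e, h1, h2⟩
    obtain ⟨b, h3, h4, rfl, rfl⟩ := getElem?_newEdges.1 h1
    have hb : NewVertex p b := by
      rw [← firstEdge_newEdges (n := n) (by omega) h4]
      exact ReturnEdge.firstEdge ⟨hij, _, h1, h2⟩
    have : j ∈ inEdges (newEdges p (n + 1)) (edgeAt p b).2 := by simp [h2]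
    obtain ⟨d, h5, h6, rfl, h7⟩ := mem_inEdges.1 this
    have hbd := (newIndex_lt_iff h4).1 hij
    exact ⟨b, d, hbd, by omega, rfl, rfl, hb, ⟨h6, fun h => h b hbd h7.symm⟩, h7.symm⟩
  · rintro ⟨b, d, h1, h2, rfl, rfl, h3, h4, h5⟩
    exact ⟨newIndex_lt h3.newEdge h1, edgeAt p b,
      getElem?_newEdges.2 ⟨b, by omega, h3.newEdge, rfl, rfl⟩, hU.inEdges_return h3 h4 h2 h5⟩

/-- The edge after the first visit is always new. A new edge after a later visit is taken at the
last visit by `UniquePath.last_of_newEdge`, so there is at most one such edge. -/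
theorem UniquePath.outEdges_eq (hU : UniquePath p n) {i : ℕ} (hi : NewVertex p i) (hin : i < n) :
    outEdges (newEdges p (n + 1)) (p i) = {newIndex p i + 1} ∨
      ∃ g, i < g ∧ g < n ∧ NewEdge p (g + 1) ∧ p g = p i ∧
        outEdges (newEdges p (n + 1)) (p i) = {newIndex p i + 1, newIndex p (g + 1)} := by
  have h0 := newIndex_succ_of_newVertex hi
  by_cases hg : ∃ g, i < g ∧ g < n ∧ NewEdge p (g + 1) ∧ p g = p i
  · right
    obtain ⟨g, h1, h2, h3, h4⟩ := hg
    refine ⟨g, h1, h2, h3, h4, ?_⟩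
    ext k
    rw [mem_outEdges, Set.mem_insert_iff, Set.mem_singleton_iff]
    constructor
    · rintro ⟨g', h5, h6, rfl, h7⟩
      rcases (hi.le h7).eq_or_lt with rfl | h8
      · exact Or.inl h0
      · right
        rcases lt_trichotomy g g' with h9 | rfl | h9
        · exact absurd (h4.trans h7.symm) (hU.last_of_newEdge h3 h1 h9 (by omega) h4.symm)
        · rfl
        · exact absurd (h7.trans h4.symm) (hU.last_of_newEdge h6 h8 h9 (by omega) h7.symm)
    · rintro (rfl | rfl)
      · exact ⟨i, hin, newEdge_of_newVertex hi, h0, rfl⟩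
      · exact ⟨g, h2, h3, rfl, h4⟩
  · left
    ext k
    rw [mem_outEdges, Set.mem_singleton_iff]
    constructor
    · rintro ⟨g', h5, h6, rfl, h7⟩
      rcases (hi.le h7).eq_or_lt with rfl | h8
      · exact h0
      · exact absurd ⟨g', h8, h5, h6, h7⟩ hg
    · rintro rfl
      exact ⟨i, hin, newEdge_of_newVertex hi, h0, rfl⟩

/-- From here on the walk is forgotten: `IsNested` holds all that the bracket code needs to know
about it. -/
theorem UniquePath.isNested (hU : UniquePath p n) : IsNested (newEdges p (n + 1)) where
  pos := by
    have := newIndex_lt (p := p) (i := 0) (j := n + 1) (fun k hk => absurd hk (by omega)) (by omega)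
    rw [length_newEdges]; omega
  cases k hk := by
    obtain ⟨e, he⟩ : ∃ e, (newEdges p (n + 1))[k]? = some e := ⟨_, List.getElem?_eq_getElem hk⟩
    obtain ⟨i, h1, h2, rfl, rfl⟩ := getElem?_newEdges.1 he
    by_cases hi : NewVertex p i
    · by_cases hd : ∃ d ≤ n, BackEdge p d ∧ p i = p d
      · obtain ⟨d, h3, h4, h5⟩ := hd
        have hid : i < d := lt_of_le_of_ne (hi.le h5.symm) (by rintro rfl; exact h4.2 hi)
        exact Or.inr (Or.inl ⟨newIndex p d,
          (returnEdge_newEdges hU).2 ⟨i, d, hid, h3, rfl, rfl, hi, h4, h5⟩⟩)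
      · refine Or.inl ⟨_, he, ?_⟩
        ext k
        rw [mem_inEdges, Set.mem_singleton_iff]
        constructor
        · rintro ⟨i', h3, h4, rfl, h5⟩
          by_cases hi' : NewVertex p i'
          · rw [hi'.unique hi h5]
          · exact absurd ⟨i', by omega, ⟨h4, hi'⟩, h5.symm⟩ hd
        · rintro rfl
          exact ⟨i, h1, h2, rfl, rfl⟩
    · obtain ⟨b, h3, h4, h5⟩ := BackEdge.exists_newVertex ⟨h2, hi⟩
      exact Or.inr (Or.inr ⟨newIndex p b,
        (returnEdge_newEdges hU).2 ⟨b, i, h3, by omega, rfl, rfl, h5, ⟨h2, hi⟩, h4⟩⟩)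
  out_single k e he hin := by
    obtain ⟨i, h1, h2, rfl, rfl⟩ := getElem?_newEdges.1 he
    have hi : NewVertex p i := by
      rw [← firstEdge_newEdges (n := n) (by omega) h2]
      exact SingleEdge.firstEdge ⟨_, he, hin⟩
    rw [edgeAt_snd]
    -- A vertex first visited at position `n` ends the walk; this is the type without outgoing
    -- edges.
    rcases (Nat.lt_succ_iff.1 h1).eq_or_lt with rfl | h1
    · refine Or.inr (Or.inr ⟨by rw [length_newEdges, newIndex_succ_of_newEdge h2], ?_⟩)
      ext k
      rw [mem_outEdges]
      simp only [Set.mem_empty_iff_false, iff_false]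
      rintro ⟨g, h3, -, -, h4⟩
      exact hi g h3 h4
    · rcases hU.outEdges_eq hi h1 with h | ⟨g, h3, h4, h5, h6, h⟩
      · exact Or.inl h
      · refine Or.inr (Or.inl ⟨_, ?_, h⟩)
        rw [← newIndex_succ_of_newVertex hi]
        exact newIndex_lt (newEdge_of_newVertex hi) (by omega)
  out_return k j e he hkj hin := by
    obtain ⟨b, d, hbd, hdn, rfl, rfl, hb, hd, e'⟩ :=
      (returnEdge_newEdges hU).1 ⟨hkj, e, he, hin⟩
    obtain ⟨b', h1, h2, h3, rfl⟩ := getElem?_newEdges.1 he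
    obtain rfl := newIndex_inj h2 hb.newEdge h3
    rw [edgeAt_snd]
    rcases hU.outEdges_eq hb (by omega) with h | ⟨g, h3, h4, h5, h6, h⟩
    · exact Or.inl h
    · right
      -- The back edge makes the second visit, so the later visit `g` is not before `d`. No edge
      -- between `d` and `g` is new, hence the second exit has the index that follows the back edge.
      have hdg : d ≤ g := by
        by_contra hlt
        exact hU.backEdge_second hd hdn h3 (by omega) h6.symm (h6.trans e')
      have hold := hU.old_of_return e' hbd hdg h4.le (e'.symm.trans h6.symm)
      rw [h, newIndex_const (i := d + 1) (j := g + 1) (by omega)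
        (fun k h1 h2 => hold k (by omega) (by omega)), newIndex_succ_of_newEdge hd.1]
  laminar i j k l h1 h2 hik hkj := by
    obtain ⟨a, d, had, hdn, rfl, rfl, ha, hd, e1⟩ := (returnEdge_newEdges hU).1 h1
    obtain ⟨b, c, hbc, hcn, rfl, rfl, hb, hc, e2⟩ := (returnEdge_newEdges hU).1 h2
    have hab := (newIndex_lt_iff ha.newEdge).1 hik
    have hbd := (newIndex_lt_iff hb.newEdge).1 hkj
    apply newIndex_lt hc.1
    by_contra hle
    rcases (not_lt.1 hle).eq_or_lt with rfl | hlt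
    · exact absurd (ha.unique hb (e1.trans e2.symm)) (by omega)
    -- Otherwise the loop from `b` to `c` would contain the visit `d` of a vertex that was seen at
    -- `a`, before the loop.
    · exact hU.backEdge_laminar hc hcn e2 hab hbd.le hlt e1
  source_zero k e he := by
    obtain ⟨i, h1, h2, rfl, rfl⟩ := getElem?_newEdges.1 he
    cases i with
    | zero => simp [newIndex]
    | succ i =>
      have := newIndex_lt (p := p) (i := 0) (j := i + 1) (fun k hk => absurd hk (by omega))
        (by omega)
      simp only [edgeAt_succ, reduceCtorEq, false_iff]
      omega
  source_first k e e' he hk he' := by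
    obtain ⟨i, h1, h2, rfl, rfl⟩ := getElem?_newEdges.1 he
    obtain ⟨j, h3, h4, h5, rfl⟩ := getElem?_newEdges.1 he'
    have hi := (firstEdge_newEdges (by omega) h2).1 hk
    rw [← newIndex_succ_of_newVertex hi] at h5
    rw [newIndex_inj h4 (newEdge_of_newVertex hi) h5, edgeAt_succ, edgeAt_snd]
  source_return i j e' h he' := by
    obtain ⟨b, d, hbd, hdn, rfl, rfl, hb, hd, e⟩ := (returnEdge_newEdges hU).1 h
    obtain ⟨g, h3, h4, h5, rfl⟩ := getElem?_newEdges.1 he'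
    rw [← newIndex_succ_of_newEdge hd.1] at h5
    cases g with
    | zero =>
      have := newIndex_lt (p := p) (i := 0) (j := d + 1) (fun k hk => absurd hk (by omega))
        (by omega)
      omega
    | succ g =>
    have hdg : d < g + 1 := by
      rw [← newIndex_lt_iff hd.1, h5, newIndex_succ_of_newEdge hd.1]; omega
    obtain ⟨c, hbc, hcd, e1, hc, hk⟩ := hU.next_source (g := g) hd hb e (by omega) (by omega) h4 (by
      intro i hi hig hn
      have h6 := newIndex_lt hn (show i < g + 1 by omega)
      have h7 := newIndex_mono (p := p) (show d + 1 ≤ i by omega)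
      omega)
    refine ⟨newIndex p c, edgeAt p c, newIndex_mono hbc, newIndex_lt hc.newEdge hcd,
      getElem?_newEdges.2 ⟨c, by omega, hc.newEdge, rfl, rfl⟩,
      (firstEdge_newEdges (by omega) hc.newEdge).2 hc, by rw [edgeAt_succ, edgeAt_snd, e1],
      ⟨edgeAt p c, getElem?_newEdges.2 ⟨c, by omega, hc.newEdge, rfl, rfl⟩, newIndex p (g + 1),
        mem_outEdges.2 ⟨g, by omega, h4, rfl, e1.symm⟩, ?_⟩, ?_⟩
    · have h6 := newIndex_lt hc.newEdge hcd
      rw [h5, newIndex_succ_of_newEdge hd.1]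
      omega
    · rintro k hbk hkc hkf ⟨e, he, j, hj, hne⟩
      obtain ⟨k, h6, h7, rfl, rfl⟩ := getElem?_newEdges.1 he
      have hkn := (firstEdge_newEdges (by omega) h7).1 hkf
      obtain ⟨x, h8, h9, rfl, h10⟩ := mem_outEdges.1 hj
      rw [edgeAt_snd] at h10
      have hbk' : b ≤ k := by
        by_contra hlt
        exact absurd (newIndex_lt h7 (not_le.1 hlt)) (by omega)
      have h11 := hk k hbk' ((newIndex_lt_iff h7).1 hkc) hkn x (hkn.le h10) h8 h10
      rcases (hkn.le h10).eq_or_lt with rfl | hlt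
      · exact hne (newIndex_succ_of_newVertex hkn)
      · exact h9 (k + 1) (by omega) (by simp [h10, h11])

end Shape

end AutomaticComplexity

namespace AutomaticComplexity

/-! ## Bracket codes -/

section Code

variable {σ σ' : Type} {P : List (Option σ × σ)} {P' : List (Option σ' × σ')}

/-- The label of the `i`-th edge. -/
def indexLabel (i : ℕ) : List Symbol := if i = 0 then [] else [Symbol.zero]

/-- The symbol `+` or nothing. -/
def exitMark (b : Bool) : List Symbol := if b then [Symbol.plus] else []

/-- `CodeShape P i m c`: the string `c` is the bracket code of the edges `e_i, …, e_{m-1}`. -/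
inductive CodeShape (P : List (Option σ × σ)) : ℕ → ℕ → List Symbol → Prop
  | empty (i : ℕ) : CodeShape P i i []
  | single {i m : ℕ} {c : List Symbol} (b : Bool) : i < m → SingleEdge P i →
      (b = true ↔ ExitEdge P i) → CodeShape P (i + 1) m c →
      CodeShape P i m (indexLabel i ++ (exitMark b ++ c))
  | loop {i j m : ℕ} {c c' : List Symbol} (b : Bool) : ReturnEdge P i j → j < m →
      (b = true ↔ ExitEdge P i) → CodeShape P (i + 1) j c → CodeShape P (j + 1) m c' →
      CodeShape P i m (indexLabel i ++ Symbol.lbr :: (exitMark b ++ (c ++ Symbol.rbr :: c')))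

theorem length_indexLabel_le (i : ℕ) : (indexLabel i).length ≤ 1 := by
  unfold indexLabel; split_ifs <;> simp

theorem length_exitMark_le (b : Bool) : (exitMark b).length ≤ 1 := by
  unfold exitMark; split_ifs <;> simp

theorem SingleEdge.not_returnEdge_right {i j : ℕ} (h : SingleEdge P j) : ¬ ReturnEdge P i j := by
  rintro ⟨hij, e, h1, h2⟩
  obtain ⟨e', h3, h4⟩ := h
  have : j ∈ inEdges P e.2 := by simp [h2]
  obtain ⟨u, hu⟩ := this
  rw [h3, Option.some.injEq] at hu
  rw [hu] at h4
  have : i ∈ inEdges P e.2 := by simp [h2]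
  rw [h4, Set.mem_singleton_iff] at this
  omega

theorem SingleEdge.not_returnEdge_left {i j : ℕ} (h : SingleEdge P i) : ¬ ReturnEdge P i j := by
  rintro ⟨hij, e, h1, h2⟩
  obtain ⟨e', h3, h4⟩ := h
  rw [h1, Option.some.injEq] at h3
  subst h3
  have : j ∈ inEdges P e.2 := by simp [h2]
  rw [h4, Set.mem_singleton_iff] at this
  omega

theorem ReturnEdge.unique_right {i j k : ℕ} (h : ReturnEdge P i j) (h' : ReturnEdge P i k) :
    j = k := by
  obtain ⟨hij, e, h1, h2⟩ := h
  obtain ⟨hik, e', h3, h4⟩ := h'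
  rw [h1, Option.some.injEq] at h3
  subst h3
  have : j ∈ inEdges P e.2 := by simp [h2]
  rw [h4] at this
  simp only [Set.mem_insert_iff, Set.mem_singleton_iff] at this
  omega

theorem ReturnEdge.inEdges_right {i j : ℕ} (h : ReturnEdge P i j) :
    ∃ e, P[j]? = some e ∧ inEdges P e.2 = {i, j} := by
  obtain ⟨hij, e, h1, h2⟩ := h
  have : j ∈ inEdges P e.2 := by simp [h2]
  obtain ⟨u, hu⟩ := this
  exact ⟨_, hu, h2⟩

theorem ReturnEdge.not_left_right {i j k : ℕ} (h : ReturnEdge P i j) : ¬ ReturnEdge P j k := by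
  intro h'
  obtain ⟨e, h1, h2⟩ := h.inEdges_right
  obtain ⟨hjk, e', h3, h4⟩ := h'
  rw [h1, Option.some.injEq] at h3
  subst h3
  have : i ∈ inEdges P e.2 := by simp [h2]
  rw [h4, Set.mem_insert_iff, Set.mem_singleton_iff] at this
  have := h.1
  omega

theorem ReturnEdge.unique_left {i j k : ℕ} (h : ReturnEdge P i k) (h' : ReturnEdge P j k) :
    i = j := by
  obtain ⟨e, h1, h2⟩ := h.inEdges_right
  obtain ⟨e', h3, h4⟩ := h'.inEdges_right
  rw [h1, Option.some.injEq] at h3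
  subst h3
  have : i ∈ inEdges P e.2 := by simp [h2]
  rw [h4, Set.mem_insert_iff, Set.mem_singleton_iff] at this
  have := h.1
  omega

/-! ### Existence, length and uniqueness of the bracket code -/

/-- A range of edges that contains with each edge the other edge with the same target. -/
def ClosedRange (P : List (Option σ × σ)) (i m : ℕ) : Prop :=
  ∀ k l, ReturnEdge P k l → (i ≤ k ∧ k < m ↔ i ≤ l ∧ l < m)

theorem ClosedRange.succ {i m : ℕ} (h : ClosedRange P i m) (hi : SingleEdge P i) :
    ClosedRange P (i + 1) m := by
  intro k l hkl
  have := h k l hkl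
  have : k ≠ i := by rintro rfl; exact hi.not_returnEdge_left hkl
  have : l ≠ i := by rintro rfl; exact hi.not_returnEdge_right hkl
  omega

/-- Laminarity: a pair that starts strictly inside the loop also ends inside it. -/
theorem ClosedRange.inner (hP : IsNested P) {i j m : ℕ} (h : ClosedRange P i m)
    (hij : ReturnEdge P i j) (hj : j < m) : ClosedRange P (i + 1) j := by
  intro k l hkl
  have h1 := h k l hkl
  have h2 : k = i → l = j := by rintro rfl; exact hkl.unique_right hij
  have h3 : l ≠ i := by rintro rfl; exact hkl.not_left_right hij
  have h4 : k ≠ j := by rintro rfl; exact hij.not_left_right hkl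
  have h5 := hP.laminar i j k l hij hkl
  have h7 := hkl.1
  omega

theorem ClosedRange.outer (hP : IsNested P) {i j m : ℕ} (h : ClosedRange P i m)
    (hij : ReturnEdge P i j) : ClosedRange P (j + 1) m := by
  intro k l hkl
  have h1 := h k l hkl
  have h2 : l = j → k = i := by rintro rfl; exact hkl.unique_left hij
  have h2 : k = i → l = j := by rintro rfl; exact hkl.unique_right hij
  have h4 : k ≠ j := by rintro rfl; exact hij.not_left_right hkl
  have h5 := hP.laminar i j k l hij hkl
  have h7 := hkl.1
  have h8 := hij.1
  omega

/-- Strong induction on the number of edges. A single edge gives at most the two symbols `0` and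
`+`; a pair of edges with a common target gives at most the four symbols `0`, `[`, `+`, `]`. A
closed range cannot begin with a returning edge, since it would have to contain the earlier partner.
-/
theorem IsNested.exists_codeShape (hP : IsNested P) {i m : ℕ} (him : i ≤ m) (hm : m ≤ P.length)
    (hc : ClosedRange P i m) : ∃ c, CodeShape P i m c ∧ c.length ≤ 2 * (m - i) := by
  classical
  induction hN : m - i using Nat.strong_induction_on generalizing i m with
  | _ N ih =>
    subst hN
    rcases him.eq_or_lt with rfl | him
    · exact ⟨[], .empty _, by simp⟩
    have hl := length_indexLabel_le i
    have hx := length_exitMark_le (decide (ExitEdge P i))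
    rcases hP.cases i (by omega) with h | ⟨j, h⟩ | ⟨j, h⟩
    · obtain ⟨c, h1, h2⟩ := ih (m - (i + 1)) (by omega) him hm (hc.succ h) rfl
      refine ⟨_, .single _ him h (decide_eq_true_iff (p := ExitEdge P i)) h1, ?_⟩
      simp only [List.length_append]
      omega
    · have hij := h.1
      have hj := (hc i j h).1 ⟨le_rfl, him⟩
      obtain ⟨c, h1, h2⟩ := ih (j - (i + 1)) (by omega) hij (by omega) (hc.inner hP h hj.2) rfl
      obtain ⟨c', h3, h4⟩ := ih (m - (j + 1)) (by omega) hj.2 hm (hc.outer hP h) rfl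
      refine ⟨_, .loop _ h hj.2 (decide_eq_true_iff (p := ExitEdge P i)) h1 h3, ?_⟩
      simp only [List.length_append, List.length_cons]
      omega
    · have := (hc j i h).2 ⟨le_rfl, him⟩
      have := h.1
      omega

theorem IsNested.edgeLabel_eq (hP : IsNested P) {i : ℕ} {e : Option σ × σ} (h : P[i]? = some e) :
    edgeLabel e = indexLabel i := by
  have := hP.source_zero i e h
  obtain ⟨u, v⟩ := e
  cases u with
  | none => simp_all [edgeLabel, indexLabel]
  | some u => simp_all [edgeLabel, indexLabel]

/-- `CodeShape` works with half-open ranges `[i, m)`, `IsCode` with ranges that include `m - 1`. For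
`m = 0` truncated subtraction would turn the empty range into a nonempty one, hence `0 < m`. The
mark `b` selects between the types with and without a second exit. -/
theorem CodeShape.isCode (hP : IsNested P) {i m : ℕ} {c : List Symbol} (h : CodeShape P i m c)
    (hm : 0 < m) : IsCode P i (m - 1) c := by
  induction h with
  | empty i => exact .empty (by omega)
  | @single i m c b him h hb _ ih =>
    obtain ⟨e, h1, h2⟩ := h
    have h3 := hP.edgeLabel_eq h1
    rw [← h3]
    rcases hP.out_single i e h1 h2 with h4 | ⟨j, hj, h4⟩ | ⟨hi, h4⟩
    · have : b = false := by
        rw [← Bool.not_eq_true, hb]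
        rintro ⟨e', h5, j, h6, h7⟩
        rw [h1, Option.some.injEq] at h5
        subst h5
        rw [h4] at h6
        exact h7 h6
      subst this
      exact .type1 (by omega) h1 h2 h4 (ih hm)
    · have : b = true := by
        rw [hb]
        exact ⟨e, h1, j, by simp [h4], by omega⟩
      subst this
      have := IsCode.type3 (by omega) h1 hj h2 h4 (ih hm)
      simpa [exitMark] using this
    · have : b = false := by
        rw [← Bool.not_eq_true, hb]
        rintro ⟨e', h5, j, h6, h7⟩
        rw [h1, Option.some.injEq] at h5
        subst h5
        rw [h4] at h6
        exact h6
      subst this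
      exact .type5 (by omega) h1 hi h2 h4 (ih hm)
  | @loop i j m c c' b h hj hb _ _ ih ih' =>
    obtain ⟨hij, e, h1, h2⟩ := h
    have h3 := hP.edgeLabel_eq h1
    rw [← h3]
    rcases hP.out_return i j e h1 hij h2 with h4 | h4
    · have : b = false := by
        rw [← Bool.not_eq_true, hb]
        rintro ⟨e', h5, j, h6, h7⟩
        rw [h1, Option.some.injEq] at h5
        subst h5
        rw [h4] at h6
        exact h7 h6
      subst this
      have := IsCode.type2 (by omega) h1 hij h2 h4 (ih (by omega)) (ih' hm)
      simpa [exitMark] using this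
    · have : b = true := by
        rw [hb]
        exact ⟨e, h1, j + 1, by simp [h4], by omega⟩
      subst this
      have := IsCode.type4 (by omega) h1 hij h2 h4 (ih (by omega)) (ih' hm)
      simpa [exitMark] using this

/-- The sets of entering and leaving edges determine the type of a vertex, and also the index `j`
wherever the string depends on it. The auxiliary facts separate sets of no, one and two indices. -/
theorem IsCode.unique {i m : ℕ} {c c' : List Symbol} (h : IsCode P i m c) (h' : IsCode P i m c') :
    c' = c := by
  have two : ∀ {i j k : ℕ}, i < j → i < k → ({i, j} : Set ℕ) = {i, k} → j = k := by
    intro i j k h1 h2 h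
    have : j ∈ ({i, k} : Set ℕ) := by simp [← h]
    simp only [Set.mem_insert_iff, Set.mem_singleton_iff] at this
    omega
  have one : ∀ {i j k : ℕ}, i < j → ({i, j} : Set ℕ) ≠ {k} := by
    intro i j k h1 h
    have h2 : j ∈ ({k} : Set ℕ) := by simp [← h]
    have h3 : i ∈ ({k} : Set ℕ) := by simp [← h]
    simp only [Set.mem_singleton_iff] at h2 h3
    omega
  have zero : ∀ {i j : ℕ}, ({i, j} : Set ℕ) ≠ ∅ := by
    intro i j h
    have h3 : i ∈ (∅ : Set ℕ) := by simp [← h]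
    exact h3
  have zero' : ∀ {i : ℕ}, ({i} : Set ℕ) ≠ ∅ := by
    intro i h
    have h3 : i ∈ (∅ : Set ℕ) := by simp [← h]
    exact h3
  induction h generalizing c' with
  | empty h1 => cases h' <;> first | rfl | omega
  | type1 h1 h2 h3 h4 _ ih =>
    cases h' with
    | empty => omega
    | type1 g1 g2 g3 g4 g5 => obtain rfl := Option.some.inj (h2.symm.trans g2); rw [ih g5]
    | type2 g1 g2 g3 g4 g5 _ _ =>
      obtain rfl := Option.some.inj (h2.symm.trans g2)
      exact absurd (g4.symm.trans h3) (one g3)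
    | type3 g1 g2 g3 g4 g5 _ =>
      obtain rfl := Option.some.inj (h2.symm.trans g2)
      exact absurd (g5.symm.trans h4) (one g3)
    | type4 g1 g2 g3 g4 g5 _ _ =>
      obtain rfl := Option.some.inj (h2.symm.trans g2)
      exact absurd (g4.symm.trans h3) (one g3)
    | type5 g1 g2 g3 g4 g5 _ =>
      obtain rfl := Option.some.inj (h2.symm.trans g2)
      exact absurd (h4.symm.trans g5) zero'
  | type2 h1 h2 h3 h4 h5 _ _ ih ih' =>
    cases h' with
    | empty => omega
    | type1 g1 g2 g3 g4 g5 =>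
      obtain rfl := Option.some.inj (h2.symm.trans g2)
      exact absurd (h4.symm.trans g3) (one h3)
    | type2 g1 g2 g3 g4 g5 g6 g7 =>
      obtain rfl := Option.some.inj (h2.symm.trans g2)
      obtain rfl := two h3 g3 (h4.symm.trans g4)
      rw [ih g6, ih' g7]
    | type3 g1 g2 g3 g4 g5 _ =>
      obtain rfl := Option.some.inj (h2.symm.trans g2)
      exact absurd (h4.symm.trans g4) (one h3)
    | type4 g1 g2 g3 g4 g5 g6 g7 =>
      obtain rfl := Option.some.inj (h2.symm.trans g2)
      exact absurd (g5.symm.trans h5) (one (by omega))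
    | type5 g1 g2 g3 g4 g5 _ =>
      obtain rfl := Option.some.inj (h2.symm.trans g2)
      exact absurd (h4.symm.trans g4) (one h3)
  | type3 h1 h2 h3 h4 h5 _ ih =>
    cases h' with
    | empty => omega
    | type1 g1 g2 g3 g4 g5 =>
      obtain rfl := Option.some.inj (h2.symm.trans g2)
      exact absurd (h5.symm.trans g4) (one h3)
    | type2 g1 g2 g3 g4 g5 g6 g7 =>
      obtain rfl := Option.some.inj (h2.symm.trans g2)
      exact absurd (g4.symm.trans h4) (one g3)
    | type3 g1 g2 g3 g4 g5 g6 =>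
      obtain rfl := Option.some.inj (h2.symm.trans g2)
      rw [ih g6]
    | type4 g1 g2 g3 g4 g5 g6 g7 =>
      obtain rfl := Option.some.inj (h2.symm.trans g2)
      exact absurd (g4.symm.trans h4) (one g3)
    | type5 g1 g2 g3 g4 g5 _ =>
      obtain rfl := Option.some.inj (h2.symm.trans g2)
      exact absurd (h5.symm.trans g5) zero
  | type4 h1 h2 h3 h4 h5 _ _ ih ih' =>
    cases h' with
    | empty => omega
    | type1 g1 g2 g3 g4 g5 =>
      obtain rfl := Option.some.inj (h2.symm.trans g2)
      exact absurd (h4.symm.trans g3) (one h3)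
    | type2 g1 g2 g3 g4 g5 g6 g7 =>
      obtain rfl := Option.some.inj (h2.symm.trans g2)
      exact absurd (h5.symm.trans g5) (one (by omega))
    | type3 g1 g2 g3 g4 g5 _ =>
      obtain rfl := Option.some.inj (h2.symm.trans g2)
      exact absurd (h4.symm.trans g4) (one h3)
    | type4 g1 g2 g3 g4 g5 g6 g7 =>
      obtain rfl := Option.some.inj (h2.symm.trans g2)
      obtain rfl := two h3 g3 (h4.symm.trans g4)
      rw [ih g6, ih' g7]
    | type5 g1 g2 g3 g4 g5 _ =>
      obtain rfl := Option.some.inj (h2.symm.trans g2)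
      exact absurd (h4.symm.trans g4) (one h3)
  | type5 h1 h2 h3 h4 h5 _ ih =>
    cases h' with
    | empty => omega
    | type1 g1 g2 g3 g4 g5 =>
      obtain rfl := Option.some.inj (h2.symm.trans g2)
      exact absurd (g4.symm.trans h5) zero'
    | type2 g1 g2 g3 g4 g5 g6 g7 =>
      obtain rfl := Option.some.inj (h2.symm.trans g2)
      exact absurd (g4.symm.trans h4) (one g3)
    | type3 g1 g2 g3 g4 g5 g6 =>
      obtain rfl := Option.some.inj (h2.symm.trans g2)
      exact absurd (g5.symm.trans h5) zero
    | type4 g1 g2 g3 g4 g5 g6 g7 =>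
      obtain rfl := Option.some.inj (h2.symm.trans g2)
      exact absurd (g4.symm.trans h4) (one g3)
    | type5 g1 g2 g3 g4 g5 g6 =>
      obtain rfl := Option.some.inj (h2.symm.trans g2)
      rw [ih g6]

/-! ### Decoding the bracket code -/

/-- The `k`-th edges of two lists play the same role for the bracket code. -/
def SameRole (P : List (Option σ × σ)) (P' : List (Option σ' × σ')) (k : ℕ) : Prop :=
  (∃ l, ReturnEdge P l k ∧ ReturnEdge P' l k) ∨
    (FirstEdge P k ∧ FirstEdge P' k ∧ (ExitEdge P k ↔ ExitEdge P' k))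

/-- A string that can follow the code of a closed range of edges. -/
def IsStop (r : List Symbol) : Prop := ∀ s ∈ r.head?, s = Symbol.rbr

/-- Past the initial edge every edge writes its label `0` first. So the first symbol tells whether a
range is exhausted, because a continuation that is a stop never begins with `0`. -/
theorem CodeShape.head {i m : ℕ} {c r : List Symbol} (h : CodeShape P i m c) (hi : 0 < i) :
    (i = m ∧ c = []) ∨ (i < m ∧ (c ++ r).head? = some Symbol.zero) := by
  cases h with
  | empty => exact Or.inl ⟨rfl, rfl⟩
  | single b h1 => exact Or.inr ⟨h1, by simp [indexLabel, hi.ne']⟩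
  | loop b h1 h2 => exact Or.inr ⟨h1.1.trans h2, by simp [indexLabel, hi.ne']⟩

theorem IsStop.head_ne {r : List Symbol} (h : IsStop r) : r.head? ≠ some Symbol.zero := by
  intro h'
  have := h _ h'
  cases this

theorem exitMark_append_inj {b b' : Bool} {c c' : List Symbol} (hc : c.head? ≠ some Symbol.plus)
    (hc' : c'.head? ≠ some Symbol.plus) (h : exitMark b ++ c = exitMark b' ++ c') :
    b = b' ∧ c = c' := by
  cases b <;> cases b' <;> simp only [exitMark] at h
  · simpa using h
  · simp only [Bool.false_eq_true, if_false, if_true, List.nil_append] at h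
    simp [h] at hc
  · simp only [Bool.false_eq_true, if_false, if_true, List.nil_append] at h
    simp [← h] at hc'
  · simpa using h

theorem CodeShape.head_cases {i m : ℕ} {c r : List Symbol} (h : CodeShape P i m c) (hi : 0 < i)
    (hr : IsStop r) : (c ++ r).head? ≠ some Symbol.plus ∧ (c ++ r).head? ≠ some Symbol.lbr := by
  rcases h.head (r := r) hi with ⟨-, rfl⟩ | ⟨-, h⟩
  · constructor <;> (intro h'; cases hr _ h')
  · simp [h]

/-- Unambiguous parsing. The codes are compared together with what follows them, since the end of
the code inside a loop is visible only through the bracket `]` after it. A bracket `[` after the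
label distinguishes a loop from a single edge, a `+` at the next place marks a second exit, and
matching brackets give the same return index on both sides. -/
theorem CodeShape.sameRole {i m m' : ℕ} {c c' r r' : List Symbol}
    (h : CodeShape P i m c) (h' : CodeShape P' i m' c') (hm : 0 < m) (hm' : 0 < m')
    (hr : IsStop r) (hr' : IsStop r') (e : c ++ r = c' ++ r') :
    m = m' ∧ r = r' ∧ ∀ k, i ≤ k → k < m → SameRole P P' k := by
  induction h generalizing m' c' r r' with
  | empty i =>
    rcases h'.head (r := r') hm with ⟨rfl, rfl⟩ | ⟨-, h⟩
    · exact ⟨rfl, e, fun k h1 h2 => by omega⟩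
    · rw [← e] at h
      exact absurd h hr.head_ne
  | @single i m c b him hs hb h1 ih =>
    cases h' with
    | empty =>
      simp only [List.nil_append] at e
      have := hr'.head_ne
      simp [← e, indexLabel, hm'.ne'] at this
    | @single _ _ c' b' him' hs' hb' h1' =>
      simp only [List.append_assoc, List.append_cancel_left_eq] at e
      obtain ⟨rfl, e₂⟩ := exitMark_append_inj (h1.head_cases (Nat.succ_pos _) hr).1
        (h1'.head_cases (Nat.succ_pos _) hr').1 e
      obtain ⟨rfl, rfl, h2⟩ := ih h1' hm hm' hr hr' e₂
      refine ⟨rfl, rfl, fun k hk hkm => ?_⟩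
      rcases hk.eq_or_lt with rfl | hk
      · exact Or.inr ⟨hs.firstEdge, hs'.firstEdge, by rw [← hb, ← hb']⟩
      · exact h2 k hk hkm
    | @loop _ j _ d d' b' hs' hj hb' h1' h2' =>
      simp only [List.append_assoc, List.append_cancel_left_eq] at e
      have := (h1.head_cases (Nat.succ_pos _) hr).2
      cases b
      · simp only [exitMark, Bool.false_eq_true, if_false, List.nil_append] at e
        simp [e] at this
      · simp [exitMark] at e
  | @loop i j m c d b hs hj hb h1 h2 ih ih' =>
    have finish : ∀ x, IsStop (Symbol.rbr :: x) := fun x s hs => by simpa using hs.symm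
    cases h' with
    | empty =>
      simp only [List.nil_append] at e
      have := hr'.head_ne
      simp [← e, indexLabel, hm'.ne'] at this
    | @single _ _ c' b' him' hs' hb' h1' =>
      simp only [List.append_assoc, List.append_cancel_left_eq] at e
      have := (h1'.head_cases (Nat.succ_pos _) hr').2
      cases b'
      · simp only [exitMark, Bool.false_eq_true, if_false, List.nil_append] at e
        simp [← e] at this
      · simp [exitMark] at e
    | @loop _ j' _ c' d' b' hs' hj' hb' h1' h2' =>
      simp only [List.append_assoc, List.append_cancel_left_eq, List.cons_append,
        List.cons.injEq, true_and] at e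
      obtain ⟨rfl, e₂⟩ := exitMark_append_inj (h1.head_cases (Nat.succ_pos _) (finish _)).1
        (h1'.head_cases (Nat.succ_pos _) (finish _)).1 e
      have hij := hs.1
      have hij' := hs'.1
      obtain ⟨rfl, e₃, h3⟩ := ih h1' (by omega) (by omega) (finish _) (finish _) e₂
      obtain ⟨rfl, rfl, h4⟩ := ih' h2' hm hm' hr hr' (List.cons.inj e₃).2
      refine ⟨rfl, rfl, fun k hk hkm => ?_⟩
      rcases hk.eq_or_lt with rfl | hk
      · exact Or.inr ⟨hs.firstEdge, hs'.firstEdge, by rw [← hb, ← hb']⟩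
      rcases lt_trichotomy k j with hkj | rfl | hkj
      · exact h3 k hk hkj
      · exact Or.inl ⟨i, hs, hs'⟩
      · exact h4 k hkj hkm

theorem closedRange_length : ClosedRange P 0 P.length := by
  intro k l h
  obtain ⟨e, h1, -⟩ := h.inEdges_right
  have := (List.getElem?_eq_some_iff.1 h1).1
  have := h.1
  omega

theorem IsNested.exists_codeShape_length (hP : IsNested P) :
    ∃ c, CodeShape P 0 P.length c ∧ c.length ≤ 2 * P.length :=
  hP.exists_codeShape (Nat.zero_le _) le_rfl closedRange_length

/-- Two lists of new edges with the same bracket code differ only by a renaming of the vertices. -/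
theorem IsNested.exists_renaming [Nonempty σ'] (hP : IsNested P) (hP' : IsNested P')
    {c : List Symbol} (h : IsCode P 0 (P.length - 1) c) (h' : IsCode P' 0 (P'.length - 1) c) :
    ∃ r : σ → σ', Set.InjOn r {v | ∃ u, (u, v) ∈ P} ∧
      P' = P.map fun e => (e.1.map r, r e.2) := by
  obtain ⟨c₁, hc₁, -⟩ := hP.exists_codeShape_length
  obtain ⟨c₂, hc₂, -⟩ := hP'.exists_codeShape_length
  obtain rfl := h.unique (hc₁.isCode hP hP.pos)
  obtain rfl := h'.unique (hc₂.isCode hP' hP'.pos)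
  have nil : IsStop [] := fun s hs => by simp at hs
  obtain ⟨hlen, -, hrole⟩ := hc₁.sameRole hc₂ hP.pos hP'.pos nil nil rfl
  have hrole : ∀ k < P.length, SameRole P P' k := fun k hk => hrole k (Nat.zero_le _) hk
  -- the first edge into a vertex
  have hfirst : ∀ v, (∃ u, (u, v) ∈ P) → ∃ k, (∃ u, P[k]? = some (u, v)) ∧ FirstEdge P k := by
    classical
    rintro v ⟨u, hu⟩
    have hne : ∃ k, k ∈ inEdges P v := by
      obtain ⟨k, hk⟩ := List.mem_iff_getElem?.1 hu
      exact ⟨k, u, hk⟩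
    obtain ⟨u', hu'⟩ := Nat.find_spec hne
    exact ⟨Nat.find hne, ⟨u', hu'⟩, _, hu', fun l hl => Nat.find_min' hne hl⟩
  choose! ix hix using hfirst
  have hfirst' : ∀ v k u, P[k]? = some (u, v) → FirstEdge P k → ix v = k := by
    rintro v k u hk ⟨e, he, hmin⟩
    obtain ⟨⟨u', h1⟩, ⟨e', he', hmin'⟩⟩ := hix v ⟨u, List.mem_of_getElem? hk⟩
    obtain rfl := Option.some.inj (hk.symm.trans he)
    obtain rfl := Option.some.inj (h1.symm.trans he')
    exact le_antisymm (hmin' k ⟨u, hk⟩) (hmin _ ⟨u', h1⟩)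
  have hget : ∀ k < P.length, ∃ e e', P[k]? = some e ∧ P'[k]? = some e' := fun k hk =>
    ⟨_, _, List.getElem?_eq_getElem hk, List.getElem?_eq_getElem (hlen ▸ hk)⟩
  obtain ⟨v₀⟩ := ‹Nonempty σ'›
  -- A vertex is sent to the target of that edge of `P'` whose index is the index of the first edge
  -- into the vertex. The value `v₀` is a filler for vertices that do not occur.
  let r : σ → σ' := fun v => ((P'[ix v]?).map Prod.snd).getD v₀
  have hr_first : ∀ k e e', P[k]? = some e → P'[k]? = some e' → FirstEdge P k → r e.2 = e'.2 := by
    intro k e e' he he' hk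
    simp only [r]
    rw [hfirst' e.2 k e.1 he hk, he']
    rfl
  have hr : ∀ (k : ℕ) (e : Option σ × σ) (e' : Option σ' × σ'), P[k]? = some e → P'[k]? = some e' → r e.2 = e'.2 := by
    intro k e e' he he'
    -- A returning edge shares its target with the first edge `l`, and `l` is the same index in both
    -- lists.
    rcases hrole k (List.getElem?_eq_some_iff.1 he).1 with ⟨l, h1, h2⟩ | ⟨h1, -⟩
    · obtain ⟨e₁, he₁, hin⟩ := h1.2
      obtain ⟨e₂, he₂, hin'⟩ := h2.2
      have : k ∈ inEdges P e₁.2 := by simp [hin]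
      obtain ⟨u, hu⟩ := this
      obtain rfl := Option.some.inj (he.symm.trans hu)
      have : k ∈ inEdges P' e₂.2 := by simp [hin']
      obtain ⟨u', hu'⟩ := this
      obtain rfl := Option.some.inj (he'.symm.trans hu')
      exact hr_first l e₁ e₂ he₁ he₂ h1.firstEdge
    · exact hr_first k e e' he he' h1
  have hF : ∀ k < P.length, (FirstEdge P k ↔ FirstEdge P' k) := by
    have key : ∀ {τ : Type} {Q : List (Option τ × τ)} {l k : ℕ}, ReturnEdge Q l k →
        ¬ FirstEdge Q k := by
      rintro τ Q l k h ⟨e, he, hmin⟩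
      obtain ⟨e', he', hin⟩ := h.inEdges_right
      obtain rfl := Option.some.inj (he.symm.trans he')
      have := hmin l (by simp [hin])
      have := h.1
      omega
    intro k hk
    rcases hrole k hk with ⟨l, h1, h2⟩ | ⟨h1, h2, -⟩
    · exact iff_of_false (key h1) (key h2)
    · exact iff_of_true h1 h2
  have hX : ∀ k < P.length, FirstEdge P k → (ExitEdge P k ↔ ExitEdge P' k) := by
    intro k hk hf
    rcases hrole k hk with ⟨l, h1, h2⟩ | ⟨-, -, h3⟩
    · obtain ⟨e, he, hmin⟩ := hf
      obtain ⟨e', he', hin⟩ := h1.inEdges_right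
      obtain rfl := Option.some.inj (he.symm.trans he')
      have := hmin l (by simp [hin])
      have := h1.1
      omega
    · exact h3
  have hs : ∀ (k : ℕ) (e : Option σ × σ) (e' : Option σ' × σ'), P[k]? = some e → P'[k]? = some e' → e.1.map r = e'.1 := by
    intro k e e' he he'
    cases k with
    | zero => rw [(hP.source_zero 0 e he).2 rfl, (hP'.source_zero 0 e' he').2 rfl]; rfl
    | succ k =>
      have hk : k + 1 < P.length := (List.getElem?_eq_some_iff.1 he).1
      rcases hrole k (by omega) with ⟨l, h1, h2⟩ | ⟨h1, h2, -⟩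
      · obtain ⟨x, d, hlx, hxk, hd, hxf, hd1, hxe, hxm⟩ := hP.source_return l k e h1 he
        obtain ⟨x', d', hlx', hxk', hd', hxf', hd1', hxe', hxm'⟩ :=
          hP'.source_return l k e' h2 he'
        -- In each list the source after a return is the first vertex from `l` on with a second
        -- exit, and the two lists agree on which indices belong to such vertices.
        have hxx : x = x' := by
          rcases lt_trichotomy x x' with hlt | rfl | hlt
          · exact absurd ((hX x (by omega) hxf).1 hxe)
              (hxm' x hlx hlt ((hF x (by omega)).1 hxf))
          · rfl
          · have := (hF x' (by omega)).2 hxf'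
            exact absurd ((hX x' (by omega) this).2 hxe') (hxm x' hlx' hlt this)
        subst hxx
        rw [hd1, hd1', Option.map_some, hr x d d' hd hd']
      · obtain ⟨d, d', hd, hd'⟩ := hget k (by omega)
        rw [hP.source_first k d e hd h1 he, hP'.source_first k d' e' hd' h2 he', Option.map_some,
          hr k d d' hd hd']
  refine ⟨r, ?_, ?_⟩
  · intro v hv v' hv' e
    obtain ⟨⟨u, hu⟩, hf⟩ := hix v hv
    obtain ⟨⟨u', hu'⟩, hf'⟩ := hix v' hv'
    have hk := (List.getElem?_eq_some_iff.1 hu).1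
    have hk' := (List.getElem?_eq_some_iff.1 hu').1
    obtain ⟨_, d, -, hd⟩ := hget _ hk
    obtain ⟨_, d', -, hd'⟩ := hget _ hk'
    have e1 := hr _ _ _ hu hd
    have e2 := hr _ _ _ hu' hd'
    obtain ⟨a, ha, hmin⟩ := (hF _ hk).1 hf
    obtain ⟨a', ha', hmin'⟩ := (hF _ hk').1 hf'
    obtain rfl := Option.some.inj (hd.symm.trans ha)
    obtain rfl := Option.some.inj (hd'.symm.trans ha')
    -- `ix v` and `ix v'` are now both the least index of an edge of `P'` into the same vertex,
    -- hence equal.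
    have e3 : d.2 = d'.2 := by rw [← e1, ← e2]; exact e
    have h1 := hmin (ix v') ⟨d'.1, by rw [e3]; exact hd'⟩
    have h2 := hmin' (ix v) ⟨d.1, by rw [← e3]; exact hd⟩
    have h3 : ix v = ix v' := le_antisymm h1 h2
    rw [h3, hu'] at hu
    exact (congrArg Prod.snd (Option.some.inj hu)).symm
  · apply List.ext_getElem?
    intro k
    rw [List.getElem?_map]
    by_cases hk : k < P.length
    · obtain ⟨e, e', he, he'⟩ := hget k hk
      rw [he, he', Option.map_some, hs k e e' he he', hr k e e' he he']
    · rw [List.getElem?_eq_none (by omega), List.getElem?_eq_none (by omega)]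
      rfl

end Code

end AutomaticComplexity

namespace AutomaticComplexity

/-! ## Unique runs of automata -/

section Runs

variable {α σ : Type}

/-- The labelled walk `p 0, a 0, p 1, …, a (n-1), p n` is the only one of length `n` with the same
end points that uses only labelled edges of this walk. -/
def UniqueRun (p : ℕ → σ) (a : ℕ → α) (n : ℕ) : Prop :=
  ∀ (q : ℕ → σ) (b : ℕ → α), q 0 = p 0 → q n = p n →
    (∀ i < n, ∃ k < n, q i = p k ∧ b i = a k ∧ q (i + 1) = p (k + 1)) →
      (∀ i ≤ n, q i = p i) ∧ ∀ i < n, b i = a i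

/-- A competing walk becomes a competing run when each of its edges gets the letter of some position
where `p` traverses that edge. -/
theorem UniqueRun.uniquePath {p : ℕ → σ} {a : ℕ → α} {n : ℕ} (h : UniqueRun p a n) :
    UniquePath p n := by
  intro q h0 hn hq
  choose! k hk using hq
  exact (h q (fun i => a (k i)) h0 hn fun i hi => ⟨k i, (hk i hi).1, (hk i hi).2.1, rfl,
    (hk i hi).2.2⟩).1

/-- The sequence `p 0, …, p n`, continued by its last element. -/
def extend {n : ℕ} (p : Fin (n + 1) → σ) (i : ℕ) : σ := p ⟨min i n, by omega⟩

theorem extend_apply {n : ℕ} (p : Fin (n + 1) → σ) (i : Fin (n + 1)) : extend p i = p i := by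
  have := i.2
  simp only [extend]
  congr 1
  ext
  simp only
  omega

theorem extend_of_le {n : ℕ} (p : Fin (n + 1) → σ) {i : ℕ} (hi : i ≤ n) :
    extend p i = p ⟨i, by omega⟩ :=
  extend_apply p ⟨i, by omega⟩

theorem pathEdges_eq {n : ℕ} (p : Fin (n + 1) → σ) :
    pathEdges p = (List.range (n + 1)).map (edgeAt (extend p)) := by
  apply List.ext_getElem
  · simp [pathEdges]
  · intro i h1 h2
    simp only [List.length_map, List.length_range] at h2
    cases i with
    | zero => simp [pathEdges, extend]
    | succ i =>
      simp only [pathEdges, List.getElem_cons_succ, List.getElem_ofFn, List.getElem_map,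
        List.getElem_range, edgeAt_succ]
      rw [extend_of_le _ (by omega), extend_of_le _ (by omega)]
      rfl

theorem abbreviatedPath_eq [DecidableEq σ] {n : ℕ} (p : Fin (n + 1) → σ) :
    abbreviatedPath p = newEdges (extend p) (n + 1) := by
  rw [abbreviatedPath, pathEdges_eq, newEdges]

theorem exists_mem_abbreviatedPath [DecidableEq σ] {n : ℕ} (p : Fin (n + 1) → σ)
    (i : Fin (n + 1)) : ∃ u, (u, p i) ∈ abbreviatedPath p := by
  refine ⟨(edgeAt (extend p) i).1, ?_⟩
  rw [abbreviatedPath, pathEdges_eq, List.mem_eraseDups, List.mem_map]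
  exact ⟨i, List.mem_range.2 i.2, by rw [← extend_apply p i]; rfl⟩

/-- A run with the same end points that uses only transitions of the accepting run is itself
accepting. -/
theorem UniquelyAccepts.uniqueRun {M : NFA α σ} {w : List α} {p : Fin (w.length + 1) → σ}
    (h : UniquelyAccepts M w) (hp : IsAcceptingPath M p w.get) (a : ℕ → α)
    (ha : ∀ i : Fin w.length, a i = w.get i) : UniqueRun (extend p) a w.length := by
  intro q b h0 hn hq
  obtain ⟨-, p', -, hu⟩ := h
  obtain ⟨rfl, -⟩ := hu p _ hp
  have key := hu (fun i => q i) (fun i => b i) ⟨?_, ?_, ?_⟩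
  · constructor
    · intro i hi
      rw [extend_of_le p hi, ← key.1]
    · intro i hi
      have := congrFun key.2 ⟨i, hi⟩
      rw [← ha] at this
      exact this
  · have := hp.1
    simp only [Fin.val_zero, h0]
    rwa [extend_of_le p (Nat.zero_le _)]
  · have := hp.2.1
    simp only [Fin.val_last, hn]
    rwa [extend_of_le p le_rfl]
  · intro i
    obtain ⟨k, hk, h1, h2, h3⟩ := hq i i.2
    have := hp.2.2 ⟨k, hk⟩
    simp only [Fin.val_castSucc, Fin.val_succ, h1, h2, h3]
    rw [extend_of_le p hk.le, extend_of_le p hk]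
    have h4 := ha ⟨k, hk⟩
    simp only at h4
    rw [h4]
    exact this

theorem UniquelyAccepts.uniquePath {M : NFA α σ} {w : List α} {p : Fin (w.length + 1) → σ}
    (h : UniquelyAccepts M w) (hp : IsAcceptingPath M p w.get) :
    UniquePath (extend p) w.length := by
  -- The empty word is treated apart because its alphabet may be empty; otherwise the last letter
  -- serves as the default value beyond the end of the word.
  rcases w.eq_nil_or_concat with rfl | ⟨w', x, rfl⟩
  · intro q h0 hn hq i hi
    obtain rfl : i = 0 := by simpa using hi
    exact h0
  · exact (h.uniqueRun hp (fun i => (w'.concat x).getD i x) (fun i =>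
      List.getD_eq_getElem _ _ i.2)).uniquePath

theorem UniquelyAccepts.isNested [DecidableEq σ] {M : NFA α σ} {w : List α}
    {p : Fin (w.length + 1) → σ} (h : UniquelyAccepts M w) (hp : IsAcceptingPath M p w.get) :
    IsNested (abbreviatedPath p) := by
  rw [abbreviatedPath_eq]
  exact (h.uniquePath hp).isNested

theorem length_abbreviatedPath_le [DecidableEq σ] {n : ℕ} (p : Fin (n + 1) → σ) :
    (abbreviatedPath p).length ≤ n + 1 := by
  rw [abbreviatedPath_eq, length_newEdges, newIndex]
  classical exact Nat.count_le _

/-- The bracket code of a uniquely accepting automaton is well defined and short. -/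
theorem UniquelyAccepts.existsUnique_bracketCode [DecidableEq σ] {M : NFA α σ} {w : List α}
    {p : Fin (w.length + 1) → σ} (h : UniquelyAccepts M w) (hp : IsAcceptingPath M p w.get) :
    ∃ c, IsBracketCode p c ∧ (∀ c', IsBracketCode p c' → c' = c) ∧
      c.length ≤ 2 * (w.length + 1) := by
  have hP := h.isNested hp
  obtain ⟨c, h1, h2⟩ := hP.exists_codeShape_length
  have h3 := h1.isCode hP hP.pos
  have := length_abbreviatedPath_le p
  exact ⟨c, h3, fun c' hc' => h3.unique hc', by omega⟩

/-- The bracket code determines the abbreviated path up to the names of the states. -/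
theorem UniquelyAccepts.exists_renaming {α' σ' : Type} [DecidableEq σ] [DecidableEq σ']
    {M : NFA α σ} {M' : NFA α' σ'} {w : List α} {w' : List α'} {p : Fin (w.length + 1) → σ}
    {p' : Fin (w'.length + 1) → σ'} {c : List Symbol} (h : UniquelyAccepts M w)
    (hp : IsAcceptingPath M p w.get) (h' : UniquelyAccepts M' w')
    (hp' : IsAcceptingPath M' p' w'.get) (hc : IsBracketCode p c) (hc' : IsBracketCode p' c) :
    ∃ r : σ → σ', Set.InjOn r (Set.range p) ∧
      abbreviatedPath p' = (abbreviatedPath p).map (fun e => (e.1.map r, r e.2)) := by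
  have : Nonempty σ' := ⟨p' 0⟩
  obtain ⟨r, hr, e⟩ := (h.isNested hp).exists_renaming (h'.isNested hp') hc hc'
  refine ⟨r, hr.mono ?_, e⟩
  rintro _ ⟨i, rfl⟩
  exact exists_mem_abbreviatedPath p i

/-- An automaton with no transitions but those of the run, and with the last state as its only
accepting state, accepts uniquely. -/
theorem complexityN_le {w : List α} {q : ℕ} (p : ℕ → Fin q) (a : ℕ → α)
    (ha : ∀ i : Fin w.length, a i = w.get i) (h : UniqueRun p a w.length) :
    complexityN w ≤ q := by
  let M : NFA α (Fin q) :=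
    { start := {p 0}
      accept := {p w.length}
      step := fun s x => {s' | ∃ k < w.length, s = p k ∧ x = a k ∧ s' = p (k + 1)} }
  refine Nat.sInf_le ⟨M, ⟨p 0, rfl⟩, fun i => p i, ⟨rfl, rfl, fun i => ?_⟩, ?_⟩
  · exact ⟨i, i.2, rfl, (ha i).symm, rfl⟩
  · rintro p' x' ⟨h0, hn, hs⟩
    have key := h (extend p') (fun i => if hi : i < w.length then x' ⟨i, hi⟩ else a i)
      (by rw [extend_of_le _ (Nat.zero_le _)]; exact h0) (by rw [extend_of_le _ le_rfl]; exact hn)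
      (fun i hi => by
        obtain ⟨k, hk, h1, h2, h3⟩ := hs ⟨i, hi⟩
        refine ⟨k, hk, ?_, ?_, ?_⟩
        · rw [extend_of_le _ hi.le]; exact h1
        · rw [dif_pos hi]; exact h2
        · rw [extend_of_le _ hi]; exact h3)
    constructor
    · funext i
      rw [← extend_apply p' i]
      exact key.1 i (Nat.lt_succ_iff.1 i.2)
    · funext i
      have := key.2 i i.2
      rw [dif_pos i.2] at this
      rw [← ha]
      exact this

/-- The infimum is attained because the set is not empty: a simple path with one state for each
position accepts uniquely. -/
theorem complexityN_spec (w : List α) :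
    ∃ M : NFA α (Fin (complexityN w)), UniquelyAccepts M w := by
  have hne : {q : ℕ | ∃ M : NFA α (Fin q), UniquelyAccepts M w}.Nonempty := by
    refine ⟨w.length + 1, ⟨fun s x =>
      {s' | ∃ i : Fin w.length, s = i.castSucc ∧ x = w.get i ∧ s' = i.succ}, {0}, {Fin.last _}⟩, ⟨0, rfl⟩, id,
      ⟨rfl, rfl, fun i => ⟨i, rfl, rfl, rfl⟩⟩, ?_⟩
    rintro p' x' ⟨h0, -, hs⟩
    have hp : ∀ i, p' i = i := by
      intro i
      induction i using Fin.induction with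
      | zero => exact h0
      | succ i ih =>
        obtain ⟨k, h1, -, h3⟩ := hs i
        rw [ih] at h1
        rw [h3, Fin.castSucc_injective _ h1]
    refine ⟨funext hp, funext fun i => ?_⟩
    obtain ⟨k, h1, h2, -⟩ := hs i
    rw [hp] at h1
    rw [h2, Fin.castSucc_injective _ h1]
  exact Nat.sInf_mem hne

end Runs

end AutomaticComplexity

/-! ## Structured programs for multi-stack machines -/

namespace Complexity

open Turing

section Programs

variable (I : Type)

/-- The registers of a machine: an input symbol, two symbols from work stacks and a flag. -/
abbrev Reg : Type := Option I × Option Bool × Option Bool × Bool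

/-- The alphabets of the stacks: the input stack and five binary stacks. -/
abbrev StackAlphabet : Option (Fin 5) → Type
  | none => I
  | some _ => Bool

/-- The contents of the registers and of the stacks. -/
structure Store where
  reg : Reg I
  inp : List I
  stk : Fin 5 → List Bool

variable {I}

/-- The contents of all stacks. -/
def Store.stacks (s : Store I) : ∀ k, List (StackAlphabet I k)
  | none => s.inp
  | some k => s.stk k

/-- Elementary actions. -/
inductive Act (I : Type)
  | load (f : Reg I → Reg I)
  | push (k : Fin 5) (f : Reg I → Bool)
  | pop (k : Fin 5) (f : Reg I → Option Bool → Reg I)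
  | read (f : Reg I → Option I → Reg I)

/-- The effect of an elementary action. -/
def Act.run : Act I → Store I → Store I
  | .load f, s => ⟨f s.reg, s.inp, s.stk⟩
  | .push k f, s => ⟨s.reg, s.inp, Function.update s.stk k (f s.reg :: s.stk k)⟩
  | .pop k f, s => ⟨f s.reg (s.stk k).head?, s.inp, Function.update s.stk k (s.stk k).tail⟩
  | .read f, s => ⟨f s.reg s.inp.head?, s.inp.tail, s.stk⟩

/-- Structured programs. -/
inductive Prog (I : Type)
  | act (a : Act I)
  | seq (p q : Prog I)
  | ite (b : Reg I → Bool) (p q : Prog I)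
  | loop (b : Reg I → Bool) (p : Prog I)

/-- `Exec p s s' t`: the program `p` takes `s` to `s'` in time `t`, where the time is the number of
evaluations of loop conditions. -/
inductive Exec : Prog I → Store I → Store I → ℕ → Prop
  | act (a : Act I) (s : Store I) : Exec (.act a) s (a.run s) 0
  | seq {p q : Prog I} {s s' s'' : Store I} {t t' : ℕ} :
      Exec p s s' t → Exec q s' s'' t' → Exec (.seq p q) s s'' (t + t')
  | ite_true {b : Reg I → Bool} {p q : Prog I} {s s' : Store I} {t : ℕ} :
      b s.reg = true → Exec p s s' t → Exec (.ite b p q) s s' t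
  | ite_false {b : Reg I → Bool} {p q : Prog I} {s s' : Store I} {t : ℕ} :
      b s.reg = false → Exec q s s' t → Exec (.ite b p q) s s' t
  | loop_false {b : Reg I → Bool} {p : Prog I} {s : Store I} :
      b s.reg = false → Exec (.loop b p) s s 1
  | loop_true {b : Reg I → Bool} {p : Prog I} {s s' s'' : Store I} {t t' : ℕ} :
      b s.reg = true → Exec p s s' t → Exec (.loop b p) s' s'' t' →
        Exec (.loop b p) s s'' (t + t' + 1)

/-- The labels needed for a program: one for every loop. -/
def Prog.Label : Prog I → Type
  | .act _ => Empty
  | .seq p q => p.Label ⊕ q.Label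
  | .ite _ p q => p.Label ⊕ q.Label
  | .loop _ p => Option p.Label

noncomputable instance Prog.fintypeLabel : (p : Prog I) → Fintype p.Label
  | .act _ => inferInstanceAs (Fintype Empty)
  | .seq p q =>
    have := fintypeLabel p
    have := fintypeLabel q
    inferInstanceAs (Fintype (p.Label ⊕ q.Label))
  | .ite _ p q =>
    have := fintypeLabel p
    have := fintypeLabel q
    inferInstanceAs (Fintype (p.Label ⊕ q.Label))
  | .loop _ p =>
    have := fintypeLabel p
    inferInstanceAs (Fintype (Option p.Label))

variable {Λ : Type}

/-- The statement that performs an action and continues with a given statement. -/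
def Act.code (a : Act I) (k : TM2.Stmt (StackAlphabet I) Λ (Reg I)) :
    TM2.Stmt (StackAlphabet I) Λ (Reg I) :=
  match a with
  | .load f => .load f k
  | .push i f => .push (some i) f k
  | .pop i f => .pop (some i) f k
  | .read f => .pop none f k

/-- The statement that runs a program and continues with a given statement. -/
def Prog.code : (p : Prog I) → (p.Label → Λ) → TM2.Stmt (StackAlphabet I) Λ (Reg I) →
    TM2.Stmt (StackAlphabet I) Λ (Reg I)
  | .act a, _, k => a.code k
  | .seq p q, e, k => p.code (fun l => e (.inl l)) (q.code (fun l => e (.inr l)) k)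
  | .ite b p q, e, k => .branch b (p.code (fun l => e (.inl l)) k) (q.code (fun l => e (.inr l)) k)
  | .loop _ _, e, _ => .goto fun _ => e none

/-- The statements at the labels of a program. -/
def Prog.table : (p : Prog I) → (p.Label → Λ) → TM2.Stmt (StackAlphabet I) Λ (Reg I) →
    p.Label → TM2.Stmt (StackAlphabet I) Λ (Reg I)
  | .act _, _, _ => Empty.elim
  | .seq p q, e, k => Sum.elim
      (p.table (fun l => e (.inl l)) (q.code (fun l => e (.inr l)) k))
      (q.table (fun l => e (.inr l)) k)
  | .ite _ p q, e, k => Sum.elim (p.table (fun l => e (.inl l)) k)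
      (q.table (fun l => e (.inr l)) k)
  | .loop b p, e, k => fun o => Option.rec
      (.branch b (p.code (fun l => e (some l)) (.goto fun _ => e none)) k)
      (fun l => p.table (fun l => e (some l)) (.goto fun _ => e none) l) o

/-- `Steps m c c' t`: the machine with statements `m` goes from `c` to `c'` in `t` steps. -/
def Steps (m : Λ → TM2.Stmt (StackAlphabet I) Λ (Reg I))
    (c c' : TM2.Cfg (StackAlphabet I) Λ (Reg I)) (t : ℕ) : Prop :=
  (flip bind (TM2.step m))^[t] (some c) = some c'

theorem Steps.trans {m : Λ → TM2.Stmt (StackAlphabet I) Λ (Reg I)}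
    {c c' c'' : TM2.Cfg (StackAlphabet I) Λ (Reg I)} {t t' : ℕ} (h : Steps m c c' t)
    (h' : Steps m c' c'' t') : Steps m c c'' (t + t') := by
  unfold Steps at *
  rw [Nat.add_comm, Function.iterate_add_apply, h, h']

theorem Steps.one {m : Λ → TM2.Stmt (StackAlphabet I) Λ (Reg I)}
    {c c' : TM2.Cfg (StackAlphabet I) Λ (Reg I)} (h : TM2.step m c = some c') : Steps m c c' 1 := h

theorem Act.stepAux_code (a : Act I) (k : TM2.Stmt (StackAlphabet I) Λ (Reg I)) (s : Store I) :
    TM2.stepAux (a.code k) s.reg s.stacks = TM2.stepAux k (a.run s).reg (a.run s).stacks := by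
  have hsome : ∀ (s : Store I) (i : Fin 5) (l : List Bool),
      Function.update s.stacks (some i) l =
        (⟨s.reg, s.inp, Function.update s.stk i l⟩ : Store I).stacks := by
    intro s i l
    funext k
    cases k with
    | none => simp [Store.stacks]
    | some k =>
      by_cases h : k = i
      · subst h; simp [Store.stacks]
      · simp [Store.stacks, h]
  cases a with
  | load f => rfl
  | push i f =>
    simp only [Act.code, TM2.stepAux, Act.run]
    rw [hsome]; rfl
  | pop i f =>
    simp only [Act.code, TM2.stepAux, Act.run]
    rw [hsome]; rfl
  | read f =>
    simp only [Act.code, TM2.stepAux, Act.run]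
    congr 1
    funext k
    cases k <;> simp [Store.stacks]

/-- Correctness of the compilation. One machine step executes a statement up to the next jump, and
only loops jump; this is why `Exec` counts nothing but evaluations of loop conditions. -/
theorem Exec.steps {m : Λ → TM2.Stmt (StackAlphabet I) Λ (Reg I)} {p : Prog I} {s s' : Store I}
    {t : ℕ} (h : Exec p s s' t) {e : p.Label → Λ} {k : TM2.Stmt (StackAlphabet I) Λ (Reg I)}
    (hm : ∀ l, m (e l) = p.table e k l) :
    Steps m (TM2.stepAux (p.code e k) s.reg s.stacks) (TM2.stepAux k s'.reg s'.stacks) t := by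
  induction h generalizing k with
  | act a s =>
    rw [Prog.code, Act.stepAux_code]
    rfl
  | seq _ _ ih ih' =>
    exact (ih fun l => hm (.inl l)).trans (ih' fun l => hm (.inr l))
  | ite_true hb _ ih =>
    rw [Prog.code, TM2.stepAux, hb]
    exact ih fun l => hm (.inl l)
  | ite_false hb _ ih =>
    rw [Prog.code, TM2.stepAux, hb]
    exact ih fun l => hm (.inr l)
  | @loop_false b p s hb =>
    have h0 := hm none
    simp only [Prog.table] at h0
    apply Steps.one
    rw [Prog.code, TM2.stepAux, TM2.step, h0, TM2.stepAux, hb]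
    rfl
  | @loop_true b p s s' s'' t t' hb _ _ ih ih' =>
    have h0 := hm none
    simp only [Prog.table] at h0
    have h1 : Steps m (TM2.stepAux (Prog.code (.loop b p) e k) s.reg s.stacks)
        (TM2.stepAux (p.code (fun l => e (some l)) (.goto fun _ => e none)) s.reg s.stacks) 1 := by
      apply Steps.one
      rw [Prog.code, TM2.stepAux, TM2.step, h0, TM2.stepAux, hb]
      rfl
    have h2 := ih (k := .goto fun _ => e none) (e := fun l => e (some l)) fun l => hm (some l)
    have := (h1.trans h2).trans (ih' hm)
    rwa [Nat.add_comm 1 t, Nat.add_right_comm] at this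

/-- The machine that runs a program. -/
noncomputable def Prog.machine [Fintype I] (p : Prog I) : FinTM2 where
  K := Option (Fin 5)
  k₀ := none
  k₁ := some 4
  Γ := StackAlphabet I
  Λ := Option p.Label
  main := none
  σ := Reg I
  initialState := (none, none, none, false)
  Γk₀Fin := inferInstanceAs (Fintype I)
  m := fun l => Option.rec (p.code some .halt) (fun l => p.table some .halt l) l

/-- The store with empty registers and work stacks. -/
def Store.start (x : List I) : Store I := ⟨(none, none, none, false), x, fun _ => []⟩

/-- The store with output `b` and nothing else. -/
def Store.final (b : Bool) : Store I :=
  ⟨(none, none, none, false), [], Function.update (fun _ => []) 4 [b]⟩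

-- The machine needs one step more than the program, to enter the code from its main label; `hf`
-- absorbs this step into the asymptotic bound.
open Classical in
theorem mem_DTIME_of_exec [Fintype I] {L : Language I} {f : ℕ → ℕ} (p : Prog I) (T : ℕ → ℕ)
    (hp : ∀ x, ∃ t ≤ T x.length, Exec p (.start x) (.final (decide (x ∈ L))) t)
    (hT : (fun n : ℕ => (T n : ℝ)) =O[Filter.atTop] (fun n : ℕ => (f n : ℝ)))
    (hf : (fun _ : ℕ => (1 : ℝ)) =O[Filter.atTop] (fun n : ℕ => (f n : ℝ))) :
    L ∈ DTIME f := by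
  have key : ∀ x : List I, ∃ t ≤ T x.length + 1,
      (flip bind p.machine.step)^[t] (some (initList p.machine (x : List I))) =
        some (haltList p.machine ([decide (x ∈ L)] : List Bool)) := by
    intro x
    obtain ⟨t, ht, h⟩ := hp x
    refine ⟨t + 1, by omega, ?_⟩
    have h1 : initList p.machine (x : List I) =
        ⟨some none, (Store.start x).reg, (Store.start x).stacks⟩ := by
      simp only [initList, Store.start]
      congr 1
      funext k
      cases k <;> rfl
    have h2 : haltList p.machine ([decide (x ∈ L)] : List Bool) =
        TM2.stepAux (.halt : TM2.Stmt (StackAlphabet I) (Option p.Label) (Reg I))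
          (Store.final (I := I) (decide (x ∈ L))).reg
          (Store.final (I := I) (decide (x ∈ L))).stacks := by
      simp only [haltList, TM2.stepAux, Store.final]
      congr 1
      funext k
      rcases k with _ | k
      · rfl
      · fin_cases k <;> rfl
    have h3 := h.steps (m := p.machine.m) (e := some) (k := .halt) (fun l => rfl)
    rw [Function.iterate_succ_apply, h1, h2]
    exact h3
  choose t ht h using key
  refine ⟨⟨⟨p.machine, Equiv.refl I, Equiv.refl Bool⟩, fun n => T n + 1, fun x =>
    ⟨⟨t x, ?_⟩, ht x⟩⟩, ?_⟩
  -- The alphabets are identified by identity equivalences, so input and output appear as lists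
  -- mapped by the identity.
  · exact Eq.mpr (congrArg₂ (fun (a : List I) (b : List Bool) =>
      (flip bind p.machine.step)^[t x] (some (initList p.machine a)) =
        some (haltList p.machine b)) (List.map_id x) (List.map_id [decide (x ∈ L)])) (h x)
  · simp only [Nat.cast_add, Nat.cast_one]
    exact hT.add hf

end Programs

end Complexity

/-! ## Programs that operate on serialized binary trees -/

namespace Complexity

/-- Binary trees; all data are encoded as such trees. -/
inductive Dat
  | nil
  | cons (a b : Dat)

/-- Prefix notation of a binary tree. -/
def Dat.ser : Dat → List Bool
  | .nil => [false]
  | .cons a b => true :: (a.ser ++ b.ser)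

/-- The length of the prefix notation. -/
def Dat.size (x : Dat) : ℕ := x.ser.length

@[simp] theorem Dat.size_nil : Dat.nil.size = 1 := rfl

@[simp] theorem Dat.size_cons (a b : Dat) : (Dat.cons a b).size = a.size + b.size + 1 := by
  simp [Dat.size, Dat.ser]

theorem Dat.size_pos (x : Dat) : 0 < x.size := by cases x <;> simp

/-- Prefix notation is self-delimiting, so trees can be stored one after the other on a stack
without separators. -/
theorem Dat.ser_append_inj {x y : Dat} {l l' : List Bool} (h : x.ser ++ l = y.ser ++ l') :
    x = y ∧ l = l' := by
  induction x generalizing y l l' with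
  | nil => cases y <;> simp_all [Dat.ser]
  | cons a b iha ihb =>
    cases y with
    | nil => simp [Dat.ser] at h
    | cons c d =>
      simp only [Dat.ser, List.cons_append, List.cons.injEq, true_and, List.append_assoc] at h
      obtain ⟨rfl, h₁⟩ := iha h
      obtain ⟨rfl, h₂⟩ := ihb h₁
      exact ⟨rfl, h₂⟩

theorem Dat.ser_injective : Function.Injective Dat.ser := fun x y h =>
  (Dat.ser_append_inj (l := []) (l' := []) (by simpa using h)).1

/-- The encoding of a bit. -/
def Dat.ofBool : Bool → Dat
  | false => .nil
  | true => .cons .nil .nil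

section Runs

variable {I : Type}

/-- The program `p` takes `s` to `s'` in time at most `T`. -/
def Runs (p : Prog I) (s s' : Store I) (T : ℕ) : Prop := ∃ t ≤ T, Exec p s s' t

theorem Runs.mono {p : Prog I} {s s' : Store I} {T T' : ℕ} (h : Runs p s s' T) (hT : T ≤ T') :
    Runs p s s' T' := by
  obtain ⟨t, h1, h2⟩ := h
  exact ⟨t, h1.trans hT, h2⟩

theorem Runs.act {a : Act I} {s s' : Store I} (h : a.run s = s') (T : ℕ) :
    Runs (.act a) s s' T :=
  ⟨0, Nat.zero_le _, h ▸ .act a s⟩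

theorem Runs.seq {p q : Prog I} {s s' s'' : Store I} {T T' : ℕ} (h : Runs p s s' T)
    (h' : Runs q s' s'' T') : Runs (.seq p q) s s'' (T + T') := by
  obtain ⟨t, h1, h2⟩ := h
  obtain ⟨t', h3, h4⟩ := h'
  exact ⟨t + t', by omega, .seq h2 h4⟩

theorem Runs.ite_true {b : Reg I → Bool} {p q : Prog I} {s s' : Store I} {T : ℕ}
    (hb : b s.reg = true) (h : Runs p s s' T) : Runs (.ite b p q) s s' T := by
  obtain ⟨t, h1, h2⟩ := h
  exact ⟨t, h1, .ite_true hb h2⟩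

theorem Runs.ite_false {b : Reg I → Bool} {p q : Prog I} {s s' : Store I} {T : ℕ}
    (hb : b s.reg = false) (h : Runs q s s' T) : Runs (.ite b p q) s s' T := by
  obtain ⟨t, h1, h2⟩ := h
  exact ⟨t, h1, .ite_false hb h2⟩

theorem Runs.loop_false {b : Reg I → Bool} {p : Prog I} {s : Store I} (hb : b s.reg = false) :
    Runs (.loop b p) s s 1 :=
  ⟨1, le_rfl, .loop_false hb⟩

theorem Runs.loop_true {b : Reg I → Bool} {p : Prog I} {s s' s'' : Store I} {T T' : ℕ}
    (hb : b s.reg = true) (h : Runs p s s' T) (h' : Runs (.loop b p) s' s'' T') :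
    Runs (.loop b p) s s'' (T + T' + 1) := by
  obtain ⟨t, h1, h2⟩ := h
  obtain ⟨t', h3, h4⟩ := h'
  exact ⟨t + t' + 1, by omega, .loop_true hb h2 h4⟩

/-- The program `p` takes the work stacks from `S` to `S'` in time at most `T` and does not change
the input stack. -/
def Moves (p : Prog I) (S S' : Fin 5 → List Bool) (T : ℕ) : Prop :=
  ∀ r i, ∃ r', Runs p ⟨r, i, S⟩ ⟨r', i, S'⟩ T

theorem Moves.mono {p : Prog I} {S S' : Fin 5 → List Bool} {T T' : ℕ} (h : Moves p S S' T)
    (hT : T ≤ T') : Moves p S S' T' := fun r i => by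
  obtain ⟨r', h⟩ := h r i
  exact ⟨r', h.mono hT⟩

theorem Moves.seq {p q : Prog I} {S S' S'' : Fin 5 → List Bool} {T T' : ℕ} (h : Moves p S S' T)
    (h' : Moves q S' S'' T') : Moves (.seq p q) S S'' (T + T') := fun r i => by
  obtain ⟨r', h⟩ := h r i
  obtain ⟨r'', h'⟩ := h' r' i
  exact ⟨r'', h.seq h'⟩

section Update

variable {m a b c o x : List Bool}

theorem update_zero : Function.update ![m, a, b, c, o] 0 x = ![x, a, b, c, o] := by
  funext k; fin_cases k <;> rfl

theorem update_one : Function.update ![m, a, b, c, o] 1 x = ![m, x, b, c, o] := by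
  funext k; fin_cases k <;> rfl

theorem update_two : Function.update ![m, a, b, c, o] 2 x = ![m, a, x, c, o] := by
  funext k; fin_cases k <;> rfl

theorem update_three : Function.update ![m, a, b, c, o] 3 x = ![m, a, b, x, o] := by
  funext k; fin_cases k <;> rfl

end Update

/-- Pop a stack into the first register. -/
def pop1 (k : Fin 5) : Prog I := .act (.pop k fun r x => (r.1, x, r.2.2))

/-- Pop a stack into the second register. -/
def pop2 (k : Fin 5) : Prog I := .act (.pop k fun r x => (r.1, r.2.1, x, r.2.2.2))

/-- Push the first register. -/
def push1 (k : Fin 5) : Prog I := .act (.push k fun r => r.2.1.getD false)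

/-- Push the second register. -/
def push2 (k : Fin 5) : Prog I := .act (.push k fun r => r.2.2.1.getD false)

/-- Push a constant. -/
def pushConst (k : Fin 5) (b : Bool) : Prog I := .act (.push k fun _ => b)

/-- Do nothing. -/
def skip : Prog I := .act (.load id)

theorem moves_pushConst (k : Fin 5) (b : Bool) (S : Fin 5 → List Bool) :
    Moves (pushConst k b : Prog I) S (Function.update S k (b :: S k)) 0 :=
  fun r _ => ⟨r, .act rfl 0⟩

theorem moves_pop2 (k : Fin 5) (S : Fin 5 → List Bool) :
    Moves (pop2 k : Prog I) S (Function.update S k (S k).tail) 0 :=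
  fun _ _ => ⟨_, .act rfl 0⟩

/-- Move the contents of stack `i`, symbol by symbol, to stack `j`. -/
def drain (i j : Fin 5) : Prog I :=
  .seq (pop1 i) (.loop (fun r => r.2.1.isSome) (.seq (push1 j) (pop1 i)))

theorem moves_drain {i j : Fin 5} (hij : i ≠ j) (S : Fin 5 → List Bool) :
    Moves (drain i j : Prog I) S
      (Function.update (Function.update S i []) j ((S i).reverse ++ S j)) ((S i).length + 1) := by
  -- Loop invariant: the first register holds the head of the remaining list `l`, and stack `i`
  -- holds its tail.
  suffices h : ∀ (l : List Bool) (S : Fin 5 → List Bool) (r : Reg I) (inp : List I),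
      r.2.1 = l.head? → S i = l.tail →
      ∃ r', Runs (.loop (fun r => r.2.1.isSome) (.seq (push1 j) (pop1 i))) ⟨r, inp, S⟩
        ⟨r', inp, Function.update (Function.update S i []) j (l.reverse ++ S j)⟩
        (l.length + 1) by
    intro r inp
    obtain ⟨r', hr⟩ := h (S i) (Function.update S i (S i).tail) (r.1, (S i).head?, r.2.2) inp rfl
      (by simp)
    refine ⟨r', ?_⟩
    have := Runs.seq (p := pop1 i) (s := ⟨r, inp, S⟩) (.act rfl 0) hr
    rw [Function.update_idem, Function.update_of_ne hij.symm, Nat.zero_add] at this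
    exact this
  intro l
  induction l with
  | nil =>
    intro S r inp h1 h2
    refine ⟨r, ?_⟩
    have : Function.update (Function.update S i []) j ([].reverse ++ S j) = S := by
      have : Function.update S i [] = S := by
        rw [Function.update_eq_self_iff]; exact h2.symm
      simp [this]
    rw [this]
    exact .loop_false (by simp [h1])
  | cons x l ih =>
    intro S r inp h1 h2
    simp only [List.tail_cons] at h2
    obtain ⟨r', hr⟩ := ih
      (Function.update (Function.update S j (x :: S j)) i l.tail)
      (r.1, l.head?, r.2.2) inp rfl (by simp)
    refine ⟨r', ?_⟩
    have hb : Runs (.seq (push1 j) (pop1 i)) ⟨r, inp, S⟩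
        ⟨(r.1, l.head?, r.2.2), inp, Function.update (Function.update S j (x :: S j)) i l.tail⟩
        (0 + 0) := by
      refine .seq (.act rfl 0) (.act ?_ 0)
      simp [Act.run, h1, h2, Function.update_of_ne hij]
    have := Runs.loop_true (b := fun r => r.2.1.isSome) (by simp [h1]) hb hr
    have e : Function.update (Function.update (Function.update (Function.update S j (x :: S j)) i
        l.tail) i []) j (l.reverse ++ Function.update (Function.update S j (x :: S j)) i l.tail j) =
        Function.update (Function.update S i []) j ((x :: l).reverse ++ S j) := by
      rw [Function.update_idem, Function.update_comm hij.symm, Function.update_idem,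
        Function.update_of_ne hij.symm, Function.update_self]
      simp
    rw [e] at this
    exact this.mono (by simp)

/-- Move the contents of stack `2` to the stacks `1` and `3`. -/
def split : Prog I :=
  .seq (pop1 2) (.loop (fun r => r.2.1.isSome) (.seq (push1 1) (.seq (push1 3) (pop1 2))))

theorem moves_split (m a b c o : List Bool) :
    Moves (split : Prog I) ![m, a, b, c, o] ![m, b.reverse ++ a, [], b.reverse ++ c, o]
      (b.length + 1) := by
  suffices h : ∀ (b a c : List Bool) (r : Reg I) (inp : List I), r.2.1 = b.head? →
      ∃ r', Runs (.loop (fun r => r.2.1.isSome) (.seq (push1 1) (.seq (push1 3) (pop1 2))))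
        ⟨r, inp, ![m, a, b.tail, c, o]⟩ ⟨r', inp, ![m, b.reverse ++ a, [], b.reverse ++ c, o]⟩
        (b.length + 1) by
    intro r inp
    obtain ⟨r', hr⟩ := h b a c (r.1, b.head?, r.2.2) inp rfl
    refine ⟨r', (Runs.seq (T := 0) (.act ?_ 0) hr).mono (by omega)⟩
    simp [Act.run, update_two]
  intro b
  induction b with
  | nil => exact fun a c r inp h => ⟨r, .loop_false (by simp [h])⟩
  | cons x b ih =>
    intro a c r inp h
    obtain ⟨r', hr⟩ := ih (x :: a) (x :: c) (r.1, b.head?, r.2.2) inp rfl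
    refine ⟨r', ?_⟩
    have hb : Runs (.seq (push1 1) (.seq (push1 3) (pop1 2))) ⟨r, inp, ![m, a, b, c, o]⟩
        ⟨(r.1, b.head?, r.2.2), inp, ![m, x :: a, b.tail, x :: c, o]⟩ (0 + (0 + 0)) := by
      refine .seq (.act rfl 0) (.seq (.act rfl 0) (.act ?_ 0))
      simp [Act.run, h, update_one, update_two, update_three]
    have := Runs.loop_true (b := fun r => r.2.1.isSome) (by simp [h]) hb hr
    simp only [List.tail_cons, List.reverse_cons, List.append_assoc, List.singleton_append]
    exact this.mono (by simp)

/-- Discard the contents of stack `1`. -/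
def discard : Prog I := .seq (pop1 1) (.loop (fun r => r.2.1.isSome) (pop1 1))

theorem moves_discard (m a b c o : List Bool) :
    Moves (discard : Prog I) ![m, a, b, c, o] ![m, [], b, c, o] (a.length + 1) := by
  suffices h : ∀ (a : List Bool) (r : Reg I) (inp : List I), r.2.1 = a.head? →
      ∃ r', Runs (.loop (fun r => r.2.1.isSome) (pop1 1))
        ⟨r, inp, ![m, a.tail, b, c, o]⟩ ⟨r', inp, ![m, [], b, c, o]⟩ (a.length + 1) by
    intro r inp
    obtain ⟨r', hr⟩ := h a (r.1, a.head?, r.2.2) inp rfl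
    refine ⟨r', (Runs.seq (T := 0) (.act ?_ 0) hr).mono (by omega)⟩
    simp [Act.run, update_one]
  intro a
  induction a with
  | nil => exact fun r inp h => ⟨r, .loop_false (by simp [h])⟩
  | cons x a ih =>
    intro r inp h
    obtain ⟨r', hr⟩ := ih (r.1, a.head?, r.2.2) inp rfl
    refine ⟨r', ?_⟩
    have hb : Runs (pop1 1) ⟨r, inp, ![m, a, b, c, o]⟩
        ⟨(r.1, a.head?, r.2.2), inp, ![m, a.tail, b, c, o]⟩ 0 :=
      .act (by simp [Act.run, update_one]) 0
    exact (Runs.loop_true (b := fun r => r.2.1.isSome) (by simp [h]) hb hr).mono (by simp)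

/-- The loop that moves a tree from stack `0` to stack `1`, with a unary counter on stack `3` for
the number of trees that are still to be moved. -/
def moveLoop : Prog I :=
  .loop (fun r => r.2.1.isSome) (.seq (pop2 0) (.seq (push2 1)
    (.seq (.ite (fun r => r.2.2.1.getD false) (.seq (pushConst 3 true) (pushConst 3 true)) skip)
      (pop1 3))))

/-- Stated for an arbitrary continuation of the loop, so that the induction can treat the two
subtrees one after the other. The first register holds the token for the current tree; reading
`true` adds two tokens for its subtrees. Prefix notation always ends with `false`, which is
therefore left in the second register. -/
theorem runs_moveLoop (x : Dat) (i : Option I) (r₂ : Option Bool) (f : Bool) (inp : List I)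
    (m a b c o : List Bool) (s : Store I) (T : ℕ)
    (h : Runs moveLoop ⟨(i, c.head?, some false, f), inp, ![m, x.ser.reverse ++ a, b, c.tail, o]⟩
      s T) :
    Runs moveLoop ⟨(i, some true, r₂, f), inp, ![x.ser ++ m, a, b, c, o]⟩ s (T + x.size) := by
  induction x generalizing r₂ m a c T with
  | nil =>
    refine (Runs.loop_true (T := 0 + (0 + (0 + 0))) rfl (.seq (.act rfl 0) (.seq (.act rfl 0)
      (.seq (.ite_false ?_ (.act rfl 0)) (.act ?_ 0)))) h).mono (by simp)
    · simp [Act.run, Dat.ser]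
    · simp [Act.run, Dat.ser, update_zero, update_one, update_three]
  | cons x y ihx ihy =>
    have h1 := ihy (some false) m (x.ser.reverse ++ true :: a) c T (by
      simpa [Dat.ser] using h)
    have h2 := ihx (some true) (y.ser ++ m) (true :: a) (true :: c) (T + y.size) h1
    refine (Runs.loop_true (T := 0 + (0 + ((0 + 0) + 0))) rfl (.seq (.act rfl 0)
      (.seq (.act rfl 0) (.seq (.ite_true ?_ (.seq (.act rfl 0) (.act rfl 0)))
        (.act ?_ 0)))) h2).mono (by simp; omega)
    · simp [Act.run, Dat.ser]
    · simp [Act.run, Dat.ser, update_zero, update_one, update_three]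

/-- Move a tree from stack `0` to stack `1`. -/
def moveTree : Prog I := .seq (pushConst 3 true) (.seq (pop1 3) moveLoop)

theorem moves_moveTree (x : Dat) (m a b o : List Bool) :
    Moves (moveTree : Prog I) ![x.ser ++ m, a, b, [], o] ![m, x.ser.reverse ++ a, b, [], o]
      (x.size + 1) := by
  intro r inp
  refine ⟨(r.1, none, some false, r.2.2.2), ?_⟩
  refine (Runs.seq (T := 0) (.act rfl 0) (.seq (T := 0) (s' := ⟨(r.1, some true, r.2.2.1, r.2.2.2), inp,
    ![x.ser ++ m, a, b, [], o]⟩) (.act ?_ 0) (runs_moveLoop x _ _ _ _ _ _ _ [] _ _ 1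
      (.loop_false rfl)))).mono (by omega)
  simp [Act.run, update_three]

/-- The contents of the work stacks between operations on the stack of trees. -/
abbrev base (m o : List Bool) : Fin 5 → List Bool := ![m, [], [], [], o]

/-- Duplicate the top tree. -/
def dup : Prog I :=
  .seq moveTree (.seq (drain 1 2) (.seq split (.seq (drain 1 0) (drain 3 0))))

/-- Each transfer between stacks reverses a string, so every copy makes an even number of transfers;
the same holds for `swap`. -/
theorem moves_dup (x : Dat) (m o : List Bool) :
    Moves (dup : Prog I) (base (x.ser ++ m) o) (base (x.ser ++ (x.ser ++ m)) o)
      (5 * x.size + 5) := by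
  have h1 := moves_moveTree (I := I) x m [] [] o
  have h2 := moves_drain (I := I) (i := 1) (j := 2) (by decide)
    ![m, x.ser.reverse ++ [], [], [], o]
  have h3 := moves_split (I := I) m [] x.ser [] o
  have h4 := moves_drain (I := I) (i := 1) (j := 0) (by decide)
    ![m, x.ser.reverse, [], x.ser.reverse, o]
  have h5 := moves_drain (I := I) (i := 3) (j := 0) (by decide)
    ![x.ser ++ m, [], [], x.ser.reverse, o]
  simp [update_zero, update_one, update_two, update_three] at h1 h2 h3 h4 h5
  refine (h1.seq (h2.seq (h3.seq (h4.seq h5)))).mono ?_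
  simp [Dat.size]; omega

/-- Exchange the two top trees. -/
def swap : Prog I :=
  .seq moveTree (.seq (drain 1 2) (.seq moveTree (.seq (drain 2 3) (.seq (drain 3 0) (drain 1 0)))))

theorem moves_swap (x y : Dat) (m o : List Bool) :
    Moves (swap : Prog I) (base (x.ser ++ (y.ser ++ m)) o) (base (y.ser ++ (x.ser ++ m)) o)
      (4 * x.size + 2 * y.size + 6) := by
  have h1 := moves_moveTree (I := I) x (y.ser ++ m) [] [] o
  have h2 := moves_drain (I := I) (i := 1) (j := 2) (by decide)
    ![y.ser ++ m, x.ser.reverse ++ [], [], [], o]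
  have h3 := moves_moveTree (I := I) y m [] x.ser o
  have h4 := moves_drain (I := I) (i := 2) (j := 3) (by decide)
    ![m, y.ser.reverse, x.ser, [], o]
  have h5 := moves_drain (I := I) (i := 3) (j := 0) (by decide)
    ![m, y.ser.reverse, [], x.ser.reverse, o]
  have h6 := moves_drain (I := I) (i := 1) (j := 0) (by decide)
    ![x.ser ++ m, y.ser.reverse, [], [], o]
  simp [update_zero, update_one, update_two, update_three] at h1 h2 h3 h4 h5 h6
  refine (h1.seq (h2.seq (h3.seq (h4.seq (h5.seq h6))))).mono ?_
  simp [Dat.size]; omega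

/-- Remove the top tree. -/
def drop : Prog I := .seq moveTree discard

theorem moves_drop (x : Dat) (m o : List Bool) :
    Moves (drop : Prog I) (base (x.ser ++ m) o) (base m o) (2 * x.size + 2) := by
  refine ((moves_moveTree x m [] [] o).seq (moves_discard _ _ _ _ _)).mono ?_
  simp [Dat.size]; omega

/-- Push a constant tree. -/
def pushTree : Dat → Prog I
  | .nil => pushConst 0 false
  | .cons a b => .seq (pushTree b) (.seq (pushTree a) (pushConst 0 true))

theorem moves_pushTree (x : Dat) (m o : List Bool) :
    Moves (pushTree x : Prog I) (base m o) (base (x.ser ++ m) o) 0 := by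
  induction x generalizing m with
  | nil =>
    have := moves_pushConst (I := I) 0 false (base m o)
    rwa [update_zero] at this
  | cons a b iha ihb =>
    have := moves_pushConst (I := I) 0 true (base (a.ser ++ (b.ser ++ m)) o)
    rw [update_zero] at this
    have := (ihb m).seq ((iha (b.ser ++ m)).seq this)
    rw [Dat.ser, List.cons_append, List.append_assoc]
    exact this

/-- The loop that compares the stacks `2` and `3`. -/
def compareLoop : Prog I :=
  .loop (fun r => r.2.1.isSome || r.2.2.1.isSome)
    (.seq (.act (.load fun r => (r.1, r.2.1, r.2.2.1, r.2.2.2 && r.2.1 == r.2.2.1)))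
      (.seq (pop1 2) (pop2 3)))

/-- The registers are compared as options, so strings of different lengths are recognized as well:
`none` differs from every symbol. -/
theorem runs_compareLoop (l l' : List Bool) (i : Option I) (f : Bool) (inp : List I)
    (m a o : List Bool) :
    Runs compareLoop ⟨(i, l.head?, l'.head?, f), inp, ![m, a, l.tail, l'.tail, o]⟩
      ⟨(i, none, none, f && decide (l = l')), inp, ![m, a, [], [], o]⟩
        (l.length + l'.length + 1) := by
  suffices h : ∀ (n : ℕ) (l l' : List Bool) (f : Bool), l.length + l'.length ≤ n →
    Runs compareLoop ⟨(i, l.head?, l'.head?, f), inp, ![m, a, l.tail, l'.tail, o]⟩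
      ⟨(i, none, none, f && decide (l = l')), inp, ![m, a, [], [], o]⟩
        (l.length + l'.length + 1) from h _ l l' f le_rfl
  intro n
  induction n with
  | zero =>
    intro l l' f h
    obtain rfl : l = [] := List.eq_nil_of_length_eq_zero (by omega)
    obtain rfl : l' = [] := List.eq_nil_of_length_eq_zero (by omega)
    simpa [compareLoop] using Runs.loop_false (I := I) (p := _) rfl
  | succ n ih =>
    intro l l' f h
    by_cases hl : l = [] ∧ l' = []
    · obtain ⟨rfl, rfl⟩ := hl
      simpa [compareLoop] using Runs.loop_false (I := I) (p := _) rfl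
    · have h' : l.tail.length + l'.tail.length + 1 ≤ l.length + l'.length := by
        cases l <;> cases l' <;> simp_all; omega
      have := ih l.tail l'.tail (f && l.head? == l'.head?) (by omega)
      have e : (f && l.head? == l'.head? && decide (l.tail = l'.tail)) =
          (f && decide (l = l')) := by
        cases l <;> cases l' <;> (simp [Bool.and_assoc, beq_eq_decide]; try congr)
      rw [e] at this
      refine (Runs.loop_true (T := 0 + (0 + 0)) ?_ (.seq (.act rfl 0) (.seq (.act rfl 0)
        (.act ?_ 0))) this).mono (by omega)
      · cases l <;> cases l' <;> simp_all
      · simp [Act.run, update_two, update_three]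

/-- Replace the two top trees by the bit that tells whether they are equal. -/
def compare : Prog I :=
  .seq moveTree (.seq (drain 1 2) (.seq moveTree (.seq (drain 1 3)
    (.seq (.act (.load fun r => (r.1, none, none, true)))
      (.seq (pop1 2) (.seq (pop2 3) (.seq compareLoop
        (.ite (fun r => r.2.2.2) (pushTree (Dat.ofBool true)) (pushTree (Dat.ofBool false))))))))))

open Classical in
theorem moves_compare (x y : Dat) (m o : List Bool) :
    Moves (compare : Prog I) (base (x.ser ++ (y.ser ++ m)) o)
      (base ((Dat.ofBool (decide (x = y))).ser ++ m) o) (4 * x.size + 4 * y.size + 10) := by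
  have h1 := moves_moveTree (I := I) x (y.ser ++ m) [] [] o
  have h2 := moves_drain (I := I) (i := 1) (j := 2) (by decide)
    ![y.ser ++ m, x.ser.reverse ++ [], [], [], o]
  have h3 := moves_moveTree (I := I) y m [] x.ser o
  have h4 := moves_drain (I := I) (i := 1) (j := 3) (by decide)
    ![m, y.ser.reverse, x.ser, [], o]
  simp [update_one, update_two, update_three] at h1 h2 h3 h4
  have h5 : Moves (.seq (.act (.load fun r => (r.1, none, none, true)))
      (.seq (pop1 2) (.seq (pop2 3) (.seq compareLoop
        (.ite (fun r => r.2.2.2) (pushTree (Dat.ofBool true)) (pushTree (Dat.ofBool false)))))) :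
        Prog I) ![m, [], x.ser, y.ser, o] (base ((Dat.ofBool (decide (x = y))).ser ++ m) o)
      (0 + (0 + (0 + ((x.size + y.size + 1) + 0)))) := by
    intro r inp
    have hc := runs_compareLoop x.ser y.ser r.1 true inp m [] o
    have hfin : ∃ r', Runs (.ite (fun r => r.2.2.2) (pushTree (Dat.ofBool true))
        (pushTree (Dat.ofBool false)) : Prog I)
        ⟨(r.1, none, none, true && decide (x.ser = y.ser)), inp, ![m, [], [], [], o]⟩
        ⟨r', inp, base ((Dat.ofBool (decide (x = y))).ser ++ m) o⟩ 0 := by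
      by_cases h : x = y
      · obtain ⟨r', h'⟩ := moves_pushTree (I := I) (Dat.ofBool true) m o
          (r.1, none, none, true && decide (x.ser = y.ser)) inp
        refine ⟨r', .ite_true (by simp [h]) ?_⟩
        rwa [decide_eq_true h]
      · obtain ⟨r', h'⟩ := moves_pushTree (I := I) (Dat.ofBool false) m o
          (r.1, none, none, true && decide (x.ser = y.ser)) inp
        refine ⟨r', .ite_false (by simp [Dat.ser_injective.ne h]) ?_⟩
        rwa [decide_eq_false h]
    obtain ⟨r', hr'⟩ := hfin
    refine ⟨r', .seq (.act rfl 0) (.seq (.act rfl 0) (.seq (.act ?_ 0) (hc.seq hr')))⟩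
    simp [Act.run, update_two, update_three]
  refine (h1.seq (h2.seq (h3.seq (h4.seq h5)))).mono ?_
  simp [Dat.size]; omega

/-- Pop a bit from the stack of trees into the first register. -/
def popBit : Prog I :=
  .seq (pop1 0) (.ite (fun r => r.2.1.getD false) (.seq (pop2 0) (pop2 0)) skip)

theorem runs_popBit (b : Bool) (m o : List Bool) (r : Reg I) (inp : List I) :
    ∃ r', r'.2.1 = some b ∧
      Runs (popBit : Prog I) ⟨r, inp, base ((Dat.ofBool b).ser ++ m) o⟩ ⟨r', inp, base m o⟩ 0 := by
  cases b with
  | false =>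
    refine ⟨_, ?_, .seq (T := 0) (.act rfl 0) (.ite_false ?_ (.act (s' := ⟨(r.1, some false, r.2.2), inp, _⟩) ?_ 0))⟩
    · rfl
    · simp [Act.run, Dat.ofBool, Dat.ser]
    · simp [Act.run, Dat.ofBool, Dat.ser, update_zero]
  | true =>
    refine ⟨(r.1, some true, some false, r.2.2.2), rfl, .seq (T := 0) (.act rfl 0)
      (.ite_true ?_ (.seq (T := 0) (.act rfl 0) (.act ?_ 0)))⟩
    · simp [Act.run, Dat.ofBool, Dat.ser]
    · simp [Act.run, Dat.ofBool, Dat.ser, update_zero]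

/-- Pop a bit and branch. -/
def ifBit (p q : Prog I) : Prog I := .seq popBit (.ite (fun r => r.2.1.getD false) p q)

theorem moves_ifBit {p q : Prog I} {b : Bool} {m m' o : List Bool} {T : ℕ}
    (hp : b = true → Moves p (base m o) (base m' o) T)
    (hq : b = false → Moves q (base m o) (base m' o) T) :
    Moves (ifBit p q) (base ((Dat.ofBool b).ser ++ m) o) (base m' o) T := by
  intro r inp
  obtain ⟨r', h1, h2⟩ := runs_popBit b m o r inp
  cases b with
  | true =>
    obtain ⟨r'', h3⟩ := hp rfl r' inp
    exact ⟨r'', (h2.seq (.ite_true (by simp [h1]) h3)).mono (by omega)⟩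
  | false =>
    obtain ⟨r'', h3⟩ := hq rfl r' inp
    exact ⟨r'', (h2.seq (.ite_false (by simp [h1]) h3)).mono (by omega)⟩

/-- Repeat `p` as long as the bit computed by `c` is true. -/
def whileBit (c p : Prog I) : Prog I :=
  .seq c (.seq popBit (.loop (fun r => r.2.1.getD false) (.seq p (.seq c popBit))))

/-- `m i` is the tree stack after `i` rounds. The test is evaluated `N + 1` times, once more than
the body. -/
theorem moves_whileBit {c p : Prog I} {o : List Bool} (m : ℕ → List Bool) (N Tc Tp : ℕ)
    (hc : ∀ i ≤ N, Moves c (base (m i) o)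
      (base ((Dat.ofBool (decide (i < N))).ser ++ m i) o) Tc)
    (hp : ∀ i < N, Moves p (base (m i) o) (base (m (i + 1)) o) Tp) :
    Moves (whileBit c p) (base (m 0) o) (base (m N) o) ((N + 1) * (Tc + Tp + 1)) := by
  have hc' : ∀ i ≤ N, ∀ r inp, ∃ r' : Reg I, r'.2.1 = some (decide (i < N)) ∧
      Runs (.seq c popBit) ⟨r, inp, base (m i) o⟩ ⟨r', inp, base (m i) o⟩ (Tc + 0) := by
    intro i hi r inp
    obtain ⟨r', h1⟩ := hc i hi r inp
    obtain ⟨r'', h2, h3⟩ := runs_popBit (decide (i < N)) (m i) o r' inp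
    exact ⟨r'', h2, h1.seq h3⟩
  have hloop : ∀ j i, i + j = N → ∀ r inp, r.2.1 = some (decide (i < N)) → ∃ r' : Reg I,
      Runs (.loop (fun r => r.2.1.getD false) (.seq p (.seq c popBit)))
        ⟨r, inp, base (m i) o⟩ ⟨r', inp, base (m N) o⟩ (j * (Tc + Tp + 1) + 1) := by
    intro j
    induction j with
    | zero =>
      intro i hi r inp hr
      obtain rfl : i = N := by omega
      exact ⟨r, (Runs.loop_false (by simp [hr])).mono (by omega)⟩
    | succ j ih =>
      intro i hi r inp hr
      obtain ⟨r₁, h1⟩ := hp i (by omega) r inp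
      obtain ⟨r₂, h2, h3⟩ := hc' (i + 1) (by omega) r₁ inp
      obtain ⟨r₃, h4⟩ := ih (i + 1) (by omega) r₂ inp h2
      refine ⟨r₃, (Runs.loop_true (by simp [hr]; omega) (h1.seq h3) h4).mono ?_⟩
      rw [Nat.succ_mul]; omega
  intro r inp
  obtain ⟨r₁, h1⟩ := hc 0 (Nat.zero_le _) r inp
  obtain ⟨r₂, h2, h3⟩ := runs_popBit (decide (0 < N)) (m 0) o r₁ inp
  obtain ⟨r₃, h4⟩ := hloop N 0 (by omega) r₂ inp h2
  refine ⟨r₃, (h1.seq (h3.seq h4)).mono ?_⟩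
  rw [Nat.succ_mul]; omega

end Runs

end Complexity

/-! ## Polynomial-time functions on encoded data -/

namespace Complexity

open Polynomial

/-- An encoding of data by binary trees. -/
class Enc (α : Type) where
  enc : α → Dat
  inj : Function.Injective enc

open Enc (enc)

/-! ### Encodings of data types and their sizes -/

section Encodings

variable {α β : Type} [Enc α] [Enc β]

instance : Enc Bool where
  enc := Dat.ofBool
  inj a b h := by cases a <;> cases b <;> simp_all [Dat.ofBool]

instance : Enc (α × β) where
  enc x := .cons (enc x.1) (enc x.2)
  inj x y h := by
    simp only [Dat.cons.injEq] at h
    exact Prod.ext (Enc.inj h.1) (Enc.inj h.2)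

instance : Enc (α ⊕ β) where
  enc := Sum.elim (fun a => .cons .nil (enc a)) (fun b => .cons (.cons .nil .nil) (enc b))
  inj x y h := by
    cases x <;> cases y <;> simp only [Sum.elim_inl, Sum.elim_inr, Dat.cons.injEq, reduceCtorEq,
      false_and, true_and] at h
    · rw [Enc.inj h]
    · rw [Enc.inj h]

/-- The encoding of a list. -/
def encList : List α → Dat
  | [] => .nil
  | a :: l => .cons (enc a) (encList l)

instance : Enc (List α) where
  enc := encList
  inj l l' h := by
    induction l generalizing l' with
    | nil => cases l' <;> simp_all [encList]
    | cons a l ih =>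
      cases l' with
      | nil => simp [encList] at h
      | cons b l' =>
        simp only [encList, Dat.cons.injEq] at h
        rw [Enc.inj h.1, @ih l' h.2]

instance : Enc (Option α) where
  enc x := enc x.toList
  inj x y h := by
    have := Enc.inj h
    cases x <;> cases y <;> simp_all

/-- The encoding of a natural number in unary notation. -/
def encNat : ℕ → Dat
  | 0 => .nil
  | n + 1 => .cons .nil (encNat n)

instance : Enc ℕ where
  enc := encNat
  inj m n h := by
    induction m generalizing n with
    | zero => cases n <;> simp_all [encNat]
    | succ m ih =>
      cases n with
      | zero => simp [encNat] at h
      | succ n =>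
        simp only [encNat, Dat.cons.injEq, true_and] at h
        rw [@ih n h]

/-- The size of the encoding. -/
def esize (x : α) : ℕ := (enc x).size

@[simp] theorem esize_prod (x : α) (y : β) : esize (x, y) = esize x + esize y + 1 := by
  simp [esize, enc]

@[simp] theorem esize_nil : esize ([] : List α) = 1 := rfl

@[simp] theorem esize_cons (a : α) (l : List α) : esize (a :: l) = esize a + esize l + 1 := by
  simp [esize, enc, encList]

@[simp] theorem esize_nat (n : ℕ) : esize n = 2 * n + 1 := by
  induction n with
  | zero => rfl
  | succ n ih =>
    have : esize (n + 1) = 1 + esize n + 1 := by simp [esize, enc, encNat]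
    omega

theorem esize_bool_le (b : Bool) : esize b ≤ 3 := by
  cases b <;> simp [esize, enc, Dat.ofBool]

theorem esize_pos (a : α) : 0 < esize a := Dat.size_pos _

@[simp] theorem esize_append (l l' : List α) : esize (l ++ l') + 1 = esize l + esize l' := by
  induction l with
  | nil => simp; omega
  | cons a l ih => simp; omega

theorem esize_reverse (l : List α) : esize l.reverse = esize l := by
  induction l with
  | nil => rfl
  | cons a l ih =>
    have := esize_append l.reverse [a]
    rw [List.reverse_cons]
    simp only [esize_cons, esize_nil] at this ⊢
    omega

theorem length_lt_esize (l : List α) : l.length < esize l := by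
  induction l with
  | nil => simp
  | cons a l ih => simp; omega

theorem esize_mem_le {a : α} {l : List α} (h : a ∈ l) : esize a ≤ esize l := by
  induction l with
  | nil => simp at h
  | cons b l ih =>
    rcases List.mem_cons.1 h with rfl | h
    · simp; omega
    · have := ih h; simp; omega

theorem esize_sublist {l l' : List α} (h : l.Sublist l') : esize l ≤ esize l' := by
  induction h with
  | slnil => rfl
  | cons a _ ih => simp; omega
  | cons_cons a _ ih => simp; omega

theorem esize_le_of_forall_mem {l : List α} {B : ℕ} (h : ∀ a ∈ l, esize a ≤ B) :
    esize l ≤ l.length * (B + 1) + 1 := by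
  induction l with
  | nil => simp
  | cons a l ih =>
    have h1 := h a (by simp)
    have h2 := ih fun b hb => h b (by simp [hb])
    simp only [esize_cons, List.length_cons, Nat.succ_mul]
    omega

end Encodings

theorem eval_mono (P : ℕ[X]) {m n : ℕ} (h : m ≤ n) : P.eval m ≤ P.eval n := by
  rw [eval_eq_sum_range, eval_eq_sum_range]
  exact Finset.sum_le_sum fun i _ => Nat.mul_le_mul_left _ (Nat.pow_le_pow_left h i)

/-! ### Closure properties of polynomial-time functions -/

section PolyTime

variable (I : Type) {α β γ δ : Type} [Enc α] [Enc β] [Enc γ] [Enc δ]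

/-- The program `p` computes `f` on the stack of trees in time `T`. -/
def Computes (p : Prog I) (f : α → β) (T : α → ℕ) : Prop :=
  ∀ x m o, Moves p (base ((enc x).ser ++ m) o) (base ((enc (f x)).ser ++ m) o) (T x)

/-- The functions that are computed in polynomial time. -/
def PolyTime (f : α → β) : Prop :=
  ∃ (p : Prog I) (P : ℕ[X]), Computes I p f (fun x => P.eval (esize x)) ∧
    ∀ x, esize (f x) ≤ P.eval (esize x)

variable {I}

theorem Computes.mono {p : Prog I} {f : α → β} {T T' : α → ℕ} (h : Computes I p f T)
    (hT : ∀ x, T x ≤ T' x) : Computes I p f T' := fun x m o => (h x m o).mono (hT x)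

theorem Computes.seq {p q : Prog I} {f : α → β} {g : β → γ} {T : α → ℕ} {T' : β → ℕ}
    (h : Computes I p f T) (h' : Computes I q g T') :
    Computes I (.seq p q) (fun x => g (f x)) (fun x => T x + T' (f x)) :=
  fun x m o => (h x m o).seq (h' (f x) m o)

theorem Computes.polyTime {p : Prog I} {f : α → β} (P Q : ℕ[X])
    (h : Computes I p f (fun x => P.eval (esize x)))
    (hs : ∀ x, esize (f x) ≤ Q.eval (esize x)) : PolyTime I f :=
  ⟨p, P + Q, h.mono fun x => by simp, fun x => (hs x).trans (by simp)⟩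

/-- Encodings are chosen so that many constructors (list cells, `some`, successor, records) have the
encoding of the corresponding tuple and cost nothing. -/
theorem PolyTime.of_enc_eq {f : α → β} (h : ∀ x, enc (f x) = enc x) : PolyTime I f :=
  Computes.polyTime (p := skip) 0 X
    (fun x m o r _ => ⟨r, by rw [h]; exact .act rfl _⟩) fun x => by simp [esize, h]

theorem PolyTime.id : PolyTime I (fun x : α => x) := .of_enc_eq fun _ => rfl

theorem PolyTime.congr {f g : α → β} (h : PolyTime I f) (e : ∀ x, f x = g x) : PolyTime I g := by
  rwa [← funext e]

/-- The second program runs on `f x`; the bound on the size of the output in `PolyTime` keeps its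
time polynomial in the size of `x`. -/
theorem PolyTime.comp {g : β → γ} {f : α → β} (hg : PolyTime I g) (hf : PolyTime I f) :
    PolyTime I (fun x => g (f x)) := by
  obtain ⟨p, P, h1, h2⟩ := hf
  obtain ⟨q, Q, h3, h4⟩ := hg
  have h5 : ∀ x, Q.eval (esize (f x)) ≤ Q.eval (P.eval (esize x)) := fun x => eval_mono Q (h2 x)
  exact Computes.polyTime (P + Q.comp P) (Q.comp P)
    ((h1.seq h3).mono fun x => by have := h5 x; simp [eval_comp]; omega)
    fun x => by have := h5 x; have := h4 (f x); simp [eval_comp]; omega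

theorem PolyTime.const (b : β) : PolyTime I (fun _ : α => b) :=
  Computes.polyTime (p := .seq drop (pushTree (enc b))) (2 * X + 2) (C (esize b))
    (fun x m o => ((moves_drop _ _ _).seq (moves_pushTree _ _ _)).mono (by simp [esize]))
    fun x => by simp

theorem PolyTime.pair {f : α → β} {g : α → γ} (hf : PolyTime I f) (hg : PolyTime I g) :
    PolyTime I (fun x => (f x, g x)) := by
  obtain ⟨p, P, h1, h2⟩ := hf
  obtain ⟨q, Q, h3, h4⟩ := hg
  refine Computes.polyTime (p := .seq dup (.seq q (.seq swap (.seq p (pushConst 0 true)))))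
    (5 * X + 5 + Q + (4 * Q + 2 * X + 6) + P) (P + Q + 1) (fun x m o => ?_)
    fun x => by have := h2 x; have := h4 x; simp; omega
  have h5 := moves_pushConst (I := I) 0 true (base ((enc (f x)).ser ++ ((enc (g x)).ser ++ m)) o)
  rw [update_zero] at h5
  have h6 := (moves_dup (I := I) (enc x) m o).seq ((h3 x ((enc x).ser ++ m) o).seq
    ((moves_swap (enc (g x)) (enc x) m o).seq ((h1 x ((enc (g x)).ser ++ m) o).seq h5)))
  have e : (enc (f x, g x)).ser ++ m = true :: ((enc (f x)).ser ++ ((enc (g x)).ser ++ m)) := by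
    simp [enc, Dat.ser]
  rw [e]
  refine h6.mono ?_
  have := h4 x
  simp only [esize] at this ⊢
  simp
  omega

theorem PolyTime.fst : PolyTime I (fun x : α × β => x.1) := by
  refine Computes.polyTime (p := .seq (pop2 0) (.seq swap drop)) (10 * X + 10) X (fun x m o => ?_)
    fun x => by obtain ⟨a, b⟩ := x; simp; omega
  have e : (enc x).ser ++ m = true :: ((enc x.1).ser ++ ((enc x.2).ser ++ m)) := by
    simp [enc, Dat.ser]
  have h1 := moves_pop2 (I := I) 0 (base ((enc x).ser ++ m) o)
  rw [update_zero] at h1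
  simp only [e, Matrix.cons_val_zero, List.tail_cons] at h1 ⊢
  refine (h1.seq ((moves_swap _ _ _ _).seq (moves_drop _ _ _))).mono ?_
  have : esize x = (enc x.1).size + (enc x.2).size + 1 := by simp [esize, enc]
  rw [this]; simp; omega

theorem PolyTime.snd : PolyTime I (fun x : α × β => x.2) := by
  refine Computes.polyTime (p := .seq (pop2 0) drop) (10 * X + 10) X (fun x m o => ?_)
    fun x => by obtain ⟨a, b⟩ := x; simp; omega
  have e : (enc x).ser ++ m = true :: ((enc x.1).ser ++ ((enc x.2).ser ++ m)) := by
    simp [enc, Dat.ser]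
  have h1 := moves_pop2 (I := I) 0 (base ((enc x).ser ++ m) o)
  rw [update_zero] at h1
  simp only [e, Matrix.cons_val_zero, List.tail_cons] at h1 ⊢
  refine (h1.seq (moves_drop _ _ _)).mono ?_
  have : esize x = (enc x.1).size + (enc x.2).size + 1 := by simp [esize, enc]
  rw [this]; simp; omega

theorem PolyTime.ite {c : α → Bool} {f g : α → β} (hc : PolyTime I c) (hf : PolyTime I f)
    (hg : PolyTime I g) : PolyTime I (fun x => if c x then f x else g x) := by
  obtain ⟨p, P, h1, h2⟩ := hf
  obtain ⟨q, Q, h3, h4⟩ := hg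
  obtain ⟨r, R, h5, h6⟩ := hc
  refine Computes.polyTime (p := .seq dup (.seq r (ifBit p q))) (5 * X + 5 + R + (P + Q)) (P + Q)
    (fun x m o => ?_) fun x => by
      have := h2 x; have := h4 x
      split_ifs <;> simp <;> omega
  refine ((moves_dup (enc x) m o).seq ((h5 x ((enc x).ser ++ m) o).seq
    (moves_ifBit (T := (P + Q).eval (esize x)) (fun h => ?_) fun h => ?_))).mono ?_
  · rw [if_pos h]; exact (h1 x m o).mono (by simp)
  · rw [if_neg (by simp [h])]; exact (h3 x m o).mono (by simp)
  · simp [esize]; omega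

theorem PolyTime.eq [DecidableEq β] {f g : α → β} (hf : PolyTime I f) (hg : PolyTime I g) :
    PolyTime I (fun x => decide (f x = g x)) := by
  suffices h : PolyTime I (fun x : β × β => decide (x.1 = x.2)) from h.comp (hf.pair hg)
  refine Computes.polyTime (p := .seq (pop2 0) compare) (10 * X + 10) 3 (fun x m o => ?_)
    fun x => esize_bool_le _ |>.trans (by simp)
  have e : (enc x).ser ++ m = true :: ((enc x.1).ser ++ ((enc x.2).ser ++ m)) := by
    simp [enc, Dat.ser]
  have h1 := moves_pop2 (I := I) 0 (base ((enc x).ser ++ m) o)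
  rw [update_zero] at h1
  simp only [e, Matrix.cons_val_zero, List.tail_cons] at h1 ⊢
  have h2 := moves_compare (I := I) (enc x.1) (enc x.2) m o
  have h3 : enc (decide (x.1 = x.2)) = Dat.ofBool (@decide (enc x.1 = enc x.2)
      (Classical.propDecidable _)) := by
    change Dat.ofBool _ = _
    congr 1
    by_cases h : x.1 = x.2
    · simp [h]
    · simp [h, Enc.inj.ne h]
  rw [h3]
  refine (h1.seq h2).mono ?_
  have : esize x = (enc x.1).size + (enc x.2).size + 1 := by simp [esize, enc]
  rw [this]; simp; omega

theorem PolyTime.list_case {f : δ → List α} {g : δ → β} {h : δ → α → List α → β}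
    (hf : PolyTime I f) (hg : PolyTime I g)
    (hh : PolyTime I (fun x : δ × α × List α => h x.1 x.2.1 x.2.2)) :
    PolyTime I (fun x => match f x with
      | [] => g x
      | a :: l => h x a l) := by
  obtain ⟨p, P, h1, h2⟩ := hf
  obtain ⟨q, Q, h3, h4⟩ := hg
  obtain ⟨r, R, h5, h6⟩ := hh
  let T : ℕ[X] := Q + R.comp (X + P + 1)
  have hT : ∀ x a l, f x = a :: l → R.eval (esize (x, a, l)) ≤ T.eval (esize x) := by
    intro x a l e
    have h7 : esize (x, a, l) ≤ esize x + P.eval (esize x) + 1 := by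
      have := h2 x
      rw [e] at this
      simp at this ⊢
      omega
    refine (eval_mono R h7).trans ?_
    simp [T, eval_comp]
  refine Computes.polyTime (p := .seq dup (.seq p (.seq (pop1 0) (.ite (fun r => r.2.1.getD false)
    (.seq (pushConst 0 true) (.seq swap (.seq (pushConst 0 true) r))) q))))
    (5 * X + 5 + P + (4 * P + 2 * X + 6 + T)) T (fun x m o => ?_) fun x => ?_
  · have key : Moves (.seq (pop1 0) (.ite (fun r => r.2.1.getD false)
        (.seq (pushConst 0 true) (.seq swap (.seq (pushConst 0 true) r))) q))
        (base ((enc (f x)).ser ++ ((enc x).ser ++ m)) o)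
        (base ((enc (match f x with
          | [] => g x
          | a :: l => h x a l)).ser ++ m) o)
        (4 * P.eval (esize x) + 2 * esize x + 6 + T.eval (esize x)) := by
      intro reg inp
      rcases e : f x with _ | ⟨a, l⟩
      · obtain ⟨r', h8⟩ := h3 x m o (reg.1, some false, reg.2.2) inp
        refine ⟨r', (Runs.seq (T := 0) (s' := ⟨(reg.1, some false, reg.2.2), inp,
          base ((enc x).ser ++ m) o⟩) (.act ?_ 0) (.ite_false rfl h8)).mono ?_⟩
        · simp [Act.run, enc, encList, Dat.ser, update_zero]
        · simp [T]; omega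
      -- With the leading `true` of the list popped, head and tail lie separately on the stack.
      -- Pushing `true` joins them to a pair, and after the swap another `true` joins `x` to this
      -- pair.
      · have h8 := moves_pushConst (I := I) 0 true
          (base ((enc a).ser ++ ((enc l).ser ++ ((enc x).ser ++ m))) o)
        have h9 := moves_swap (I := I) (enc (a, l)) (enc x) m o
        have h10 := moves_pushConst (I := I) 0 true (base ((enc x).ser ++ ((enc (a, l)).ser ++ m)) o)
        have h11 := h5 (x, a, l) m o
        rw [update_zero] at h8 h10
        have e1 : (enc (a, l)).ser ++ ((enc x).ser ++ m) =
          true :: ((enc a).ser ++ ((enc l).ser ++ ((enc x).ser ++ m))) := by simp [enc, Dat.ser]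
        have e2 : (enc (x, a, l)).ser ++ m = true :: ((enc x).ser ++ ((enc (a, l)).ser ++ m)) := by
          simp [enc, Dat.ser]
        rw [e1] at h9
        rw [e2] at h11
        obtain ⟨r', h12⟩ := (h8.seq (h9.seq (h10.seq h11))) (reg.1, some true, reg.2.2) inp
        refine ⟨r', (Runs.seq (T := 0) (s' := ⟨(reg.1, some true, reg.2.2), inp,
          base ((enc a).ser ++ ((enc l).ser ++ ((enc x).ser ++ m))) o⟩) (.act ?_ 0)
          (.ite_true rfl h12)).mono ?_⟩
        · simp [Act.run, enc, encList, Dat.ser, update_zero]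
        · have h13 := hT x a l e
          have h14 := h2 x
          rw [e] at h14
          have h15 : (enc (a, l)).size = esize (a :: l) := rfl
          have h16 : (enc x).size = esize x := rfl
          simp only
          omega
    refine ((moves_dup (enc x) m o).seq ((h1 x ((enc x).ser ++ m) o).seq key)).mono ?_
    simp [esize]
    omega
  · rcases e : f x with _ | ⟨a, l⟩
    · have := h4 x
      simp [T]; omega
    · exact (h6 (x, a, l)).trans (hT x a l e)

end PolyTime

end Complexity

/-! ## Folds in polynomial time -/

namespace Complexity

open Polynomial

open Enc (enc)

section Fold

variable {I : Type} {α β γ δ : Type} [Enc α] [Enc β] [Enc γ] [Enc δ]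

/-- A program for a fold; its running time depends on the size of the intermediate results. -/
theorem exists_foldl_program {h : δ → β → α → β}
    (hh : PolyTime I (fun t : δ × β × α => h t.1 t.2.1 t.2.2)) :
    ∃ (p : Prog I) (Q : ℕ[X]), ∀ (x : δ) (b : β) (l : List α) (B : ℕ),
      (∀ k ≤ l.length, esize ((l.take k).foldl (h x) b) ≤ B) → ∀ m o,
        Moves p (base ((enc (x, b, l)).ser ++ m) o)
          (base ((enc (l.foldl (h x) b)).ser ++ m) o) (Q.eval (esize (x, b, l) + B)) := by
  have hl : PolyTime I (fun s : δ × β × List α => s.2.2) := PolyTime.snd.comp .snd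
  obtain ⟨cond, hcond, hcond_nil, hcond_cons⟩ : ∃ f : δ × β × List α → Bool, PolyTime I f ∧
      (∀ x b, f (x, b, []) = false) ∧ ∀ x b a l, f (x, b, a :: l) = true :=
    ⟨_, .list_case hl (.const false) (h := fun _ _ _ => true) (.const true),
      fun _ _ => rfl, fun _ _ _ _ => rfl⟩
  have hx : PolyTime I (fun t : (δ × β × List α) × α × List α => t.1.1) :=
    PolyTime.fst.comp .fst
  have hb : PolyTime I (fun t : (δ × β × List α) × α × List α => t.1.2.1) :=
    PolyTime.fst.comp (PolyTime.snd.comp .fst)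
  have ha : PolyTime I (fun t : (δ × β × List α) × α × List α => t.2.1) :=
    PolyTime.fst.comp .snd
  obtain ⟨step, hstep, hstep_cons⟩ : ∃ f : δ × β × List α → δ × β × List α, PolyTime I f ∧
      ∀ x b a l, f (x, b, a :: l) = (x, h x b a, l) :=
    ⟨_, .list_case hl .id (h := fun s a l => (s.1, h s.1 s.2.1 a, l))
      (hx.pair ((hh.comp (hx.pair (hb.pair ha))).pair (PolyTime.snd.comp .snd))),
      fun _ _ _ _ => rfl⟩
  have hfin : PolyTime I (fun s : δ × β × List α => s.2.1) := PolyTime.fst.comp .snd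
  obtain ⟨c, P₁, hc, -⟩ := hcond
  obtain ⟨p, P₂, hp, -⟩ := hstep
  obtain ⟨q, P₃, hq, -⟩ := hfin
  refine ⟨.seq (whileBit (.seq dup c) p) q, (X + 1) * (5 * X + 5 + P₁ + P₂ + 1) + P₃,
    fun x b l B hB m o => ?_⟩
  -- The state after `i` rounds consists of the parameter, the accumulator and the rest of the list.
  -- Its size is at most `esize (x, b, l) + B`, and this number bounds the number of rounds too.
  set s : ℕ → δ × β × List α := fun i => (x, (l.take i).foldl (h x) b, l.drop i) with s_def
  have hs : ∀ i, esize (s i) ≤ esize (x, b, l) + B := by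
    intro i
    have h1 : esize ((l.take i).foldl (h x) b) ≤ B := by
      rcases le_total i l.length with hi | hi
      · exact hB i hi
      · have := hB l.length le_rfl
        rwa [List.take_of_length_le hi, ← List.take_length (l := l)]
    have h2 : esize (l.drop i) ≤ esize l := esize_sublist (List.drop_sublist _ _)
    simp only [s_def, esize_prod]
    omega
  have hw := moves_whileBit (c := .seq dup c) (p := p) (o := o) (fun i => (enc (s i)).ser ++ m)
    l.length (5 * (esize (x, b, l) + B) + 5 + P₁.eval (esize (x, b, l) + B))
    (P₂.eval (esize (x, b, l) + B))
    (fun i hi => by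
      have h1 := hc (s i) ((enc (s i)).ser ++ m) o
      have h2 : cond (s i) = decide (i < l.length) := by
        rcases hi.lt_or_eq with hi | rfl
        · simp only [s_def, List.drop_eq_getElem_cons hi, hcond_cons, hi, decide_true]
        · simp only [s_def, List.drop_length, hcond_nil, lt_irrefl, decide_false]
      rw [h2] at h1
      refine ((moves_dup (enc (s i)) m o).seq h1).mono ?_
      have h3 := hs i
      have h4 := eval_mono P₁ h3
      simp only [esize] at h3 h4 ⊢
      omega)
    (fun i hi => by
      have h1 := (hp (s i) m o).mono (eval_mono P₂ (hs i))
      have h2 : step (s i) = s (i + 1) := by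
        simp only [s_def]
        rw [List.drop_eq_getElem_cons hi, hstep_cons, List.take_succ_eq_append_getElem hi,
          List.foldl_append]
        rfl
      rwa [h2] at h1)
  have e0 : s 0 = (x, b, l) := by simp [s_def]
  have e1 : (s l.length).2.1 = l.foldl (h x) b := by simp [s_def]
  have hf := (hq (s l.length) m o).mono (eval_mono P₃ (hs l.length))
  beta_reduce at hf
  rw [e1] at hf
  beta_reduce at hw
  rw [e0] at hw
  refine (hw.seq hf).mono ?_
  have : l.length ≤ esize (x, b, l) + B := by
    have := length_lt_esize l
    simp
    omega
  simp only [eval_add, eval_mul, eval_X, eval_one, eval_ofNat]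
  gcongr

/-- Iterating a polynomial-time step can make the accumulator grow exponentially, so a bound `hR` on
all intermediate results is required. -/
theorem PolyTime.foldl {l : δ → List α} {b : δ → β} {h : δ → β → α → β} (hl : PolyTime I l)
    (hb : PolyTime I b) (hh : PolyTime I (fun t : δ × β × α => h t.1 t.2.1 t.2.2)) (R : ℕ[X])
    (hR : ∀ x k, esize (((l x).take k).foldl (h x) (b x)) ≤ R.eval (esize x)) :
    PolyTime I (fun x => (l x).foldl (h x) (b x)) := by
  obtain ⟨p, Q, hp⟩ := exists_foldl_program (I := I) hh
  obtain ⟨q, P, hq, hP⟩ := PolyTime.id.pair (hb.pair hl)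
  refine Computes.polyTime (p := .seq q p) (P + Q.comp (P + R)) R (fun x m o => ?_) fun x => ?_
  · have h1 := hp x (b x) (l x) (R.eval (esize x)) (fun k _ => hR x k) m o
    refine ((hq x m o).seq h1).mono ?_
    have : Q.eval (esize (x, b x, l x) + R.eval (esize x)) ≤
        Q.eval (P.eval (esize x) + R.eval (esize x)) := eval_mono Q (Nat.add_le_add_right (hP x) _)
    simp only [eval_add, eval_comp]
    omega
  · have := hR x (l x).length
    rwa [List.take_length] at this

end Fold

end Complexity

/-! ## Basic polynomial-time functions -/

namespace Complexity

open Polynomial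

open Enc (enc)

instance : Enc Unit where
  enc _ := .nil
  inj _ _ _ := rfl

section Library

variable {I : Type} {α β γ δ : Type} [Enc α] [Enc β] [Enc γ] [Enc δ]

theorem PolyTime.not {c : α → Bool} (hc : PolyTime I c) : PolyTime I (fun x => !c x) :=
  (hc.ite (.const false) (.const true)).congr fun x => by cases c x <;> rfl

theorem PolyTime.and {c d : α → Bool} (hc : PolyTime I c) (hd : PolyTime I d) :
    PolyTime I (fun x => c x && d x) :=
  (hc.ite hd (.const false)).congr fun x => by cases c x <;> rfl

theorem PolyTime.or {c d : α → Bool} (hc : PolyTime I c) (hd : PolyTime I d) :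
    PolyTime I (fun x => c x || d x) :=
  (hc.ite (.const true) hd).congr fun x => by cases c x <;> rfl

theorem PolyTime.xor {c d : α → Bool} (hc : PolyTime I c) (hd : PolyTime I d) :
    PolyTime I (fun x => c x ^^ d x) :=
  (hc.ite hd.not hd).congr fun x => by cases c x <;> simp

theorem PolyTime.cons {f : α → β} {g : α → List β} (hf : PolyTime I f) (hg : PolyTime I g) :
    PolyTime I (fun x => f x :: g x) :=
  (PolyTime.of_enc_eq (f := fun t : β × List β => t.1 :: t.2) fun _ => rfl).comp (hf.pair hg)

theorem PolyTime.some {f : α → β} (hf : PolyTime I f) : PolyTime I (fun x => Option.some (f x)) :=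
  (PolyTime.of_enc_eq (f := fun t : β × Unit => Option.some t.1) fun _ => rfl).comp
    (hf.pair (.const ()))

theorem PolyTime.headD {f : α → List β} (hf : PolyTime I f) (b : β) :
    PolyTime I (fun x => (f x).headD b) :=
  (hf.list_case (.const b) (h := fun _ c _ => c) (PolyTime.fst.comp .snd)).congr
    fun x => by cases f x <;> rfl

theorem PolyTime.tail {f : α → List β} (hf : PolyTime I f) : PolyTime I (fun x => (f x).tail) :=
  (hf.list_case (.const []) (h := fun _ _ l => l) (PolyTime.snd.comp .snd)).congr
    fun x => by cases f x <;> rfl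

theorem PolyTime.succ {f : α → ℕ} (hf : PolyTime I f) : PolyTime I (fun x => f x + 1) :=
  (PolyTime.of_enc_eq (f := fun t : Unit × ℕ => t.2 + 1) fun _ => rfl).comp
    ((PolyTime.const ()).pair hf)

theorem esize_foldl_cons_le {α : Type} (c : α → Bool) (h : α → β) (l : List α)
    (b : List β) (B : ℕ)
    (hB : ∀ a ∈ l, esize (h a) ≤ B) :
    esize (l.foldl (fun acc a => if c a then h a :: acc else acc) b) ≤
      esize b + l.length * (B + 1) := by
  induction l generalizing b with
  | nil => simp
  | cons a l ih =>
    have h1 := hB a (by simp)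
    have h2 := ih (if c a then h a :: b else b) fun a' ha' => hB a' (by simp [ha'])
    have h3 : esize (if c a then h a :: b else b) ≤ esize b + (B + 1) := by
      split_ifs
      · simp; omega
      · omega
    rw [List.foldl_cons, List.length_cons, Nat.succ_mul]
    omega

/-- Lists that are built by a fold. -/
theorem PolyTime.foldl_cons {l : δ → List α} {b : δ → List β} {c : δ → α → Bool} {h : δ → α → β}
    (hl : PolyTime I l) (hb : PolyTime I b) (hc : PolyTime I (fun t : δ × α => c t.1 t.2))
    (hh : PolyTime I (fun t : δ × α => h t.1 t.2)) :
    PolyTime I (fun x => (l x).foldl (fun acc a => if c x a then h x a :: acc else acc) (b x)) := by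
  have hxa : PolyTime I (fun t : δ × List β × α => (t.1, t.2.2)) :=
    PolyTime.fst.pair (PolyTime.snd.comp .snd)
  have hacc : PolyTime I (fun t : δ × List β × α => t.2.1) := PolyTime.fst.comp .snd
  have ⟨_, P, _, hP⟩ := hl
  have ⟨_, Q, _, hQ⟩ := hb
  have ⟨_, R, _, hR⟩ := hh
  refine hl.foldl hb (h := fun x acc a => if c x a then h x a :: acc else acc)
    ((hc.comp hxa).ite ((hh.comp hxa).cons hacc) hacc)
    (Q + P * (R.comp (X + P + 1) + 1)) fun x k => ?_
  refine (esize_foldl_cons_le (c x) (h x) _ _ (R.eval (esize x + P.eval (esize x) + 1))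
    fun a ha => ?_).trans ?_
  · refine (hR (x, a)).trans (eval_mono R ?_)
    have := hP x
    have := esize_mem_le (List.mem_of_mem_take ha)
    simp only [esize_prod]
    omega
  · have h1 : ((l x).take k).length ≤ P.eval (esize x) :=
      (List.length_take_le' _ _).trans ((length_lt_esize _).le.trans (hP x))
    simp only [eval_add, eval_mul, eval_comp, eval_X, eval_one]
    gcongr
    exact hQ x

theorem PolyTime.reverse {f : α → List β} (hf : PolyTime I f) :
    PolyTime I (fun x => (f x).reverse) :=
  (hf.foldl_cons (.const []) (c := fun _ _ => true) (h := fun _ b => b) (.const true) .snd).congr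
    fun x => by simp

theorem PolyTime.any {l : δ → List α} {c : δ → α → Bool} (hl : PolyTime I l)
    (hc : PolyTime I (fun t : δ × α => c t.1 t.2)) : PolyTime I (fun x => (l x).any (c x)) := by
  refine (hl.foldl (.const false) (h := fun x r a => r || c x a) ((PolyTime.fst.comp .snd).or
    (hc.comp (PolyTime.fst.pair (PolyTime.snd.comp .snd)))) 3
    fun x k => (esize_bool_le _).trans (by simp)).congr fun x => ?_
  have : ∀ (l : List α) r, l.foldl (fun r a => r || c x a) r = (r || l.any (c x)) := by
    intro l
    induction l with
    | nil => simp
    | cons a l ih => intro r; simp [ih, Bool.or_assoc]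
  simp [this]

theorem PolyTime.contains [DecidableEq β] {f : α → β} {l : α → List β} (hf : PolyTime I f)
    (hl : PolyTime I l) : PolyTime I (fun x => decide (f x ∈ l x)) :=
  (hl.any (c := fun x b => decide (b = f x)) (PolyTime.snd.eq (hf.comp .fst))).congr
    fun x => by simp [List.any_eq]

theorem PolyTime.drop_length {f : α → List β} {g : α → List γ} (hf : PolyTime I f)
    (hg : PolyTime I g) : PolyTime I (fun x => (f x).drop (g x).length) := by
  have ⟨_, P, _, hP⟩ := hf
  have key : ∀ (l : List γ) (l' : List β), l.foldl (fun r _ => r.tail) l' = l'.drop l.length := by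
    intro l
    induction l with
    | nil => simp
    | cons a l ih => intro l'; simp [ih]
  refine (hg.foldl hf (h := fun _ r _ => r.tail) (PolyTime.fst.comp .snd).tail P
    fun x k => ?_).congr fun x => key _ _
  rw [key]
  exact (esize_sublist (List.drop_sublist _ _)).trans (hP x)

theorem PolyTime.map_filter {l : δ → List α} {c : δ → α → Bool} {h : δ → α → β}
    (hl : PolyTime I l) (hc : PolyTime I (fun t : δ × α => c t.1 t.2))
    (hh : PolyTime I (fun t : δ × α => h t.1 t.2)) :
    PolyTime I (fun x => ((l x).filter (c x)).map (h x)) := by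
  have key : ∀ (c : α → Bool) (h : α → β) (l : List α) b,
      l.foldl (fun acc a => if c a then h a :: acc else acc) b =
        ((l.filter c).map h).reverse ++ b := by
    intro c h l
    induction l with
    | nil => simp
    | cons a l ih => intro b; by_cases h : c a <;> simp [ih, h]
  exact (hl.foldl_cons (.const []) hc hh).reverse.congr fun x => by simp [key]

theorem PolyTime.map {l : δ → List α} {h : δ → α → β} (hl : PolyTime I l)
    (hh : PolyTime I (fun t : δ × α => h t.1 t.2)) : PolyTime I (fun x => (l x).map (h x)) :=
  (hl.map_filter (c := fun _ _ => true) (.const true) hh).congr fun x => by simp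

theorem PolyTime.append {f g : α → List β} (hf : PolyTime I f) (hg : PolyTime I g) :
    PolyTime I (fun x => f x ++ g x) :=
  (hf.reverse.foldl_cons hg (c := fun _ _ => true) (h := fun _ b => b) (.const true) .snd).congr
    fun x => by simp

/-- A finite table is a cascade of equality tests with constant results. -/
theorem PolyTime.of_finite [Fintype α] (f : α → β) : PolyTime I f := by
  classical
  suffices h : ∀ l : List α, ∃ g : α → β, PolyTime I g ∧ ∀ a ∈ l, g a = f a by
    obtain ⟨g, hg, h⟩ := h Finset.univ.toList
    exact hg.congr fun a => h a (by simp)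
  intro l
  induction l with
  | nil =>
    by_cases h : Nonempty α
    · exact ⟨fun _ => f h.some, .const _, by simp⟩
    · exact ⟨f, Computes.polyTime (p := skip) 0 0 (fun x => absurd ⟨x⟩ h)
        fun x => absurd ⟨x⟩ h, by simp⟩
  | cons a l ih =>
    obtain ⟨g, hg, h⟩ := ih
    refine ⟨_, (PolyTime.id.eq (.const a)).ite (.const (f a)) hg, fun b hb => ?_⟩
    by_cases hba : b = a
    · simp [hba]
    · simpa [hba] using h b ((List.mem_cons.1 hb).resolve_left hba)

end Library

end Complexity

/-! ## The verifier -/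

namespace AutomaticComplexity

open Complexity Polynomial

open Enc (enc)

/-- The addition of a carry bit to a number in binary notation. -/
def addCarry : List Bool → Bool → List Bool
  | [], c => if c then [true] else []
  | b :: l, c => (b ^^ c) :: addCarry l (b && c)

theorem length_addCarry_le (l : List Bool) (c : Bool) : (addCarry l c).length ≤ l.length + 1 := by
  induction l generalizing c with
  | nil => cases c <;> simp [addCarry]
  | cons b l ih => simpa [addCarry] using ih _

theorem addCarry_false (l : List Bool) : addCarry l false = l := by
  induction l with
  | nil => rfl
  | cons b l ih => simp [addCarry, ih]

theorem addCarry_bits (n : ℕ) : addCarry n.bits true = (n + 1).bits := by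
  induction n using Nat.binaryRec' with
  | zero => simp [addCarry]
  | bit b n h ih =>
    cases b
    · have : Nat.bit false n + 1 = Nat.bit true n := by simp [Nat.bit]
      rw [this, Nat.bits_append_bit _ _ h, Nat.bits_append_bit _ _ (by simp)]
      simp [addCarry, addCarry_false]
    · have : Nat.bit true n + 1 = Nat.bit false (n + 1) := by simp [Nat.bit]; ring
      rw [this, Nat.bits_append_bit _ _ h, Nat.bits_append_bit _ _ (by simp), ← ih]
      simp [addCarry]

/-- A partial run: the current state, the number of states, a stack of states, the transitions in
reverse order, the number `d` in binary, and twice the sum of `d` and the number of states in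
unary. -/
structure Partial where
  cur : ℕ
  cnt : ℕ
  stack : List ℕ
  trans : List (ℕ × Bool × ℕ)
  bits : List Bool
  cost : List Bool

namespace Partial

/-- A partial run as a tuple. -/
def toTuple (s : Partial) : ℕ × ℕ × List ℕ × List (ℕ × Bool × ℕ) × List Bool × List Bool :=
  (s.cur, s.cnt, s.stack, s.trans, s.bits, s.cost)

instance : Enc Partial where
  enc s := enc s.toTuple
  inj s t h := by
    have := Enc.inj h
    cases s
    cases t
    simp_all [toTuple]

/-- The empty run. -/
def init : Partial := ⟨0, 1, [], [], [], [true, true]⟩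

/-- The target of a transition from `s`. -/
def lookup (T : List (ℕ × Bool × ℕ)) (s : ℕ) : ℕ :=
  ((T.filter fun t => decide (t.1 = s)).map fun t => t.2.2).headD 0

/-- The target of the next transition. -/
def target (s : Partial) (a b : Bool) : ℕ :=
  if a then s.cnt else if b then s.stack.headD 0 else lookup s.trans s.cur

/-- The stack after the next transition. -/
def nextStack (s : Partial) (a b : Bool) : List ℕ :=
  if a then (if b then s.cnt :: s.stack else s.stack) else if b then s.stack.tail else s.stack

/-- Extend the run by a transition with letter `c`. If `a` holds it leads to a new state, which is
put on the stack if `b` holds. Otherwise it is a new transition to the top of the stack if `b`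
holds, and a transition that has been used before if `b` does not hold. If `d` holds, then the
deficiency increases by one. -/
def step (s : Partial) (a b c d : Bool) : Partial :=
  ⟨s.target a b, if a then s.cnt + 1 else s.cnt, s.nextStack a b,
    (s.cur, c, s.target a b) :: s.trans, if d then addCarry s.bits true else s.bits,
    if a then (if d then true :: true :: true :: true :: s.cost else true :: true :: s.cost)
    else if d then true :: true :: s.cost else s.cost⟩

/-- Read one bit. The bits are collected until there are four of them. -/
def readBit (s : List Bool × Partial) (d : Bool) : List Bool × Partial :=
  if decide (s.1.tail.tail = []) then (d :: s.1, s.2)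
  else ([], s.2.step (s.1.tail.tail.headD false) (s.1.tail.headD false) (s.1.headD false) d)

/-- The run that is described by a bit string. -/
def decode (y : List Bool) : Partial := (y.foldl readBit ([], init)).2

end Partial

/-- The sources of the transitions in `T` that lead to `B`, or lead to the same state as `t` but
are different from `t`. -/
def deviatingStep (T : List (ℕ × Bool × ℕ)) (B : List ℕ) (t : ℕ × Bool × ℕ) : List ℕ :=
  (T.filter fun t' => decide (t'.2.2 ∈ B) || (decide (t'.2.2 = t.2.2) && !decide (t' = t))).map
    fun t' => t'.1

/-- The states from which there is a run that differs from the run with the transitions `l`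
(in reverse order) and that ends at the same time in the same state, or that ends at the same time
in `B`. -/
def deviating (T : List (ℕ × Bool × ℕ)) (l : List (ℕ × Bool × ℕ)) (B : List ℕ) : List ℕ :=
  l.foldl (deviatingStep T) B

/-- Check that the certificate `y` witnesses that the instance `s` has a positive answer. -/
def verify (s : List (Option Bool)) (y : List Bool) : Bool :=
  decide (s = ((Partial.decode y).trans.map fun t => some t.2.1).reverse ++
      none :: (Partial.decode y).bits.map some) &&
    decide ((Partial.decode y).cost.drop (Partial.decode y).trans.length = []) &&
    !decide (0 ∈ deviating (Partial.decode y).trans (Partial.decode y).trans [])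

section PolyTime

variable {I δ : Type} [Enc δ]

theorem esize_le_of_length_le {α : Type} [Enc α] {l : List α} {B N : ℕ} (hl : l.length ≤ N)
    (h : ∀ a ∈ l, esize a ≤ B) : esize l ≤ N * (B + 1) + 1 :=
  (esize_le_of_forall_mem h).trans (by gcongr)

/-- The recursion becomes a fold whose accumulator holds the carry and the digits in reverse order.
-/
theorem polyTime_addCarry {f : δ → List Bool} (hf : PolyTime I f) :
    PolyTime I (fun x => addCarry (f x) true) := by
  have key : ∀ (l : List Bool) (r : Bool × List Bool),
      (l.foldl (fun r b => (b && r.1, (b ^^ r.1) :: r.2)) r).2.reverse ++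
          (if (l.foldl (fun r b => (b && r.1, (b ^^ r.1) :: r.2)) r).1 then [true] else []) =
        r.2.reverse ++ addCarry l r.1 := by
    intro l
    induction l with
    | nil => intro r; rcases r with ⟨_ | _, l⟩ <;> simp [addCarry]
    | cons b l ih => intro r; rw [List.foldl_cons, ih]; simp [addCarry]
  have len : ∀ (l : List Bool) (r : Bool × List Bool),
      (l.foldl (fun r b => (b && r.1, (b ^^ r.1) :: r.2)) r).2.length = l.length + r.2.length := by
    intro l
    induction l with
    | nil => intro r; simp
    | cons b l ih => intro r; simp [ih]; omega
  have ⟨_, P, _, hP⟩ := hf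
  have h1 : PolyTime I (fun x => (f x).foldl (fun r b => (b && r.1, (b ^^ r.1) :: r.2))
      ((true, []) : Bool × List Bool)) := by
    have hr : PolyTime I (fun t : δ × (Bool × List Bool) × Bool => t.2.1) := PolyTime.fst.comp .snd
    have hb : PolyTime I (fun t : δ × (Bool × List Bool) × Bool => t.2.2) := PolyTime.snd.comp .snd
    refine hf.foldl (.const _) (h := fun _ (r : Bool × List Bool) b => (b && r.1, (b ^^ r.1) :: r.2))
      ((hb.and (PolyTime.fst.comp hr)).pair
        ((hb.xor (PolyTime.fst.comp hr)).cons (PolyTime.snd.comp hr))) (4 * P + 5) fun x k => ?_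
    have h2 : ((f x).take k).length ≤ P.eval (esize x) :=
      (List.length_take_le' _ _).trans ((length_lt_esize _).le.trans (hP x))
    have h3 := len ((f x).take k) (true, [])
    generalize ((f x).take k).foldl _ _ = r at h3 ⊢
    obtain ⟨r, l⟩ := r
    have h4 := esize_le_of_length_le (l := l) (N := P.eval (esize x)) (B := 3)
      (by simp only [List.length_nil, add_zero] at h3; omega) fun b _ => esize_bool_le b
    have h5 := esize_bool_le r
    simp only [esize_prod, eval_add, eval_mul, eval_ofNat]
    omega
  exact ((PolyTime.snd.comp h1).reverse.append
    ((PolyTime.fst.comp h1).ite (.const [true]) (.const []))).congr fun x => by simp [key]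

open Partial

variable {f : δ → Partial} {a b c d : δ → Bool}

theorem polyTime_lookup {l : δ → List (ℕ × Bool × ℕ)} {g : δ → ℕ} (hl : PolyTime I l)
    (hg : PolyTime I g) : PolyTime I (fun x => lookup (l x) (g x)) :=
  have h : PolyTime I (fun x => ((l x).filter fun t => decide (t.1 = g x)).map fun t => t.2.2) :=
    hl.map_filter (c := fun x t => decide (t.1 = g x)) ((PolyTime.fst.comp .snd).eq (hg.comp .fst))
      (PolyTime.snd.comp (PolyTime.snd.comp .snd))
  h.headD 0

theorem polyTime_toTuple (hf : PolyTime I f) : PolyTime I (fun x => (f x).toTuple) :=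
  (PolyTime.of_enc_eq (f := toTuple) fun _ => rfl).comp hf

theorem polyTime_cur (hf : PolyTime I f) : PolyTime I (fun x => (f x).cur) :=
  PolyTime.fst.comp (polyTime_toTuple hf)

theorem polyTime_cnt (hf : PolyTime I f) : PolyTime I (fun x => (f x).cnt) :=
  PolyTime.fst.comp (PolyTime.snd.comp (polyTime_toTuple hf))

theorem polyTime_stack (hf : PolyTime I f) : PolyTime I (fun x => (f x).stack) :=
  PolyTime.fst.comp (PolyTime.snd.comp (PolyTime.snd.comp (polyTime_toTuple hf)))

theorem polyTime_trans (hf : PolyTime I f) : PolyTime I (fun x => (f x).trans) :=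
  PolyTime.fst.comp (PolyTime.snd.comp (PolyTime.snd.comp (PolyTime.snd.comp
    (polyTime_toTuple hf))))

theorem polyTime_bits (hf : PolyTime I f) : PolyTime I (fun x => (f x).bits) :=
  PolyTime.fst.comp (PolyTime.snd.comp (PolyTime.snd.comp (PolyTime.snd.comp (PolyTime.snd.comp
    (polyTime_toTuple hf)))))

theorem polyTime_cost (hf : PolyTime I f) : PolyTime I (fun x => (f x).cost) :=
  PolyTime.snd.comp (PolyTime.snd.comp (PolyTime.snd.comp (PolyTime.snd.comp (PolyTime.snd.comp
    (polyTime_toTuple hf)))))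

theorem polyTime_target (hf : PolyTime I f) (ha : PolyTime I a) (hb : PolyTime I b) :
    PolyTime I (fun x => (f x).target (a x) (b x)) :=
  ha.ite (polyTime_cnt hf) (hb.ite ((polyTime_stack hf).headD 0)
    (polyTime_lookup (polyTime_trans hf) (polyTime_cur hf)))

theorem polyTime_nextStack (hf : PolyTime I f) (ha : PolyTime I a) (hb : PolyTime I b) :
    PolyTime I (fun x => (f x).nextStack (a x) (b x)) :=
  have h := polyTime_stack hf
  ha.ite (hb.ite ((polyTime_cnt hf).cons h) h) (hb.ite h.tail h)

theorem polyTime_step (hf : PolyTime I f) (ha : PolyTime I a) (hb : PolyTime I b)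
    (hc : PolyTime I c) (hd : PolyTime I d) :
    PolyTime I (fun x => (f x).step (a x) (b x) (c x) (d x)) := by
  have ht : ∀ {g : δ → List Bool}, PolyTime I g → PolyTime I (fun x => true :: true :: g x) :=
    fun hg => (PolyTime.const true).cons ((PolyTime.const true).cons hg)
  have h1 := polyTime_target hf ha hb
  have h2 := polyTime_cnt hf
  have h3 := polyTime_bits hf
  have h4 := polyTime_cost hf
  exact (PolyTime.of_enc_eq (f := fun t : ℕ × ℕ × List ℕ × List (ℕ × Bool × ℕ) × List Bool ×
    List Bool => Partial.mk t.1 t.2.1 t.2.2.1 t.2.2.2.1 t.2.2.2.2.1 t.2.2.2.2.2) fun _ => rfl).comp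
    (h1.pair ((ha.ite h2.succ h2).pair ((polyTime_nextStack hf ha hb).pair
    ((((polyTime_cur hf).pair (hc.pair h1)).cons (polyTime_trans hf)).pair
    ((hd.ite (polyTime_addCarry h3) h3).pair
    (ha.ite (hd.ite (ht (ht h4)) (ht h4)) (hd.ite (ht h4) h4)))))))

theorem polyTime_readBit {g : δ → List Bool × Partial} (hg : PolyTime I g) (hd : PolyTime I d) :
    PolyTime I (fun x => readBit (g x) (d x)) := by
  have h1 := PolyTime.fst.comp hg
  have h2 := PolyTime.snd.comp hg
  exact (h1.tail.tail.eq (.const [])).ite ((hd.cons h1).pair h2) ((PolyTime.const []).pair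
    (polyTime_step h2 (h1.tail.tail.headD false) (h1.tail.headD false) (h1.headD false) hd))

theorem headD_eq_or_mem {α : Type} (l : List α) (a : α) : l.headD a = a ∨ l.headD a ∈ l := by
  cases l <;> simp

theorem lookup_eq_or_mem (l : List (ℕ × Bool × ℕ)) (s : ℕ) :
    lookup l s = 0 ∨ ∃ t ∈ l, t.2.2 = lookup l s := by
  refine (headD_eq_or_mem _ 0).imp_right fun h => ?_
  obtain ⟨t, ht, h⟩ := List.mem_map.1 h
  exact ⟨t, List.mem_of_mem_filter ht, h⟩

/-- The size of a partial run of length `k`. -/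
structure Small (k : ℕ) (s : Partial) : Prop where
  cur : s.cur < s.cnt
  cnt : s.cnt ≤ k + 1
  stack : ∀ x ∈ s.stack, x < s.cnt
  stack_length : s.stack.length ≤ k
  trans : ∀ t ∈ s.trans, t.1 < s.cnt ∧ t.2.2 < s.cnt
  trans_length : s.trans.length = k
  bits : s.bits.length ≤ k
  cost : s.cost.length ≤ 4 * k + 2

theorem Small.target_lt {k : ℕ} {s : Partial} (h : Small k s) (a b : Bool) :
    s.target a b < s.cnt + a.toNat := by
  have := h.cur
  unfold target
  cases a
  · cases b <;> simp only [Bool.false_eq_true, if_false, if_true, Bool.toNat_false, add_zero]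
    · rcases lookup_eq_or_mem s.trans s.cur with h1 | ⟨t, ht, h1⟩
      · rw [h1]; omega
      · have := (h.trans t ht).2
        omega
    · rcases headD_eq_or_mem s.stack 0 with h1 | h1
      · rw [h1]; omega
      · exact h.stack _ h1
  · simp

theorem Small.init : Small 0 init := by constructor <;> simp [Partial.init]

theorem Small.step {k : ℕ} {s : Partial} (h : Small k s) (a b c d : Bool) :
    Small (k + 1) (s.step a b c d) := by
  have h1 := h.target_lt a b
  have h2 := h.cnt
  have h3 : (s.step a b c d).cnt = s.cnt + a.toNat := by cases a <;> simp [Partial.step]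
  have h4 := h.cur
  have h5 := h.stack_length
  have h6 := h.trans_length
  have h7 := h.bits
  have h8 := h.cost
  have ha : a.toNat ≤ 1 := Bool.toNat_le a
  refine ⟨h3 ▸ h1, by omega, fun x hx => ?_, ?_, fun t ht => ?_, by simp [Partial.step, h6], ?_, ?_⟩
  · rw [h3]
    cases a <;> cases b <;> simp [Partial.step, nextStack] at hx ⊢
    · exact h.stack x hx
    · exact h.stack x (List.mem_of_mem_tail hx)
    · exact by have := h.stack x hx; omega
    · rcases hx with rfl | hx
      · omega
      · exact by have := h.stack x hx; omega
  · cases a <;> cases b <;> simp [Partial.step, nextStack] <;> omega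
  · rw [h3]
    rcases List.mem_cons.1 ht with rfl | ht
    · exact ⟨by simp only; omega, h1⟩
    · have := h.trans t ht
      omega
  · cases d
    · simp [Partial.step]; omega
    · have := length_addCarry_le s.bits true
      simp [Partial.step]; omega
  · cases a <;> cases d <;> simp [Partial.step] <;> omega

end PolyTime

end AutomaticComplexity

namespace AutomaticComplexity

open Complexity Polynomial Partial

/-! ## The verifier runs in polynomial time -/

section PolyTime

variable {I δ : Type} [Enc δ]

/-- State names are at most `k`, so their unary encodings are short. This bounds the intermediate
results of the fold in `polyTime_decode`. -/
theorem Small.esize_le {k : ℕ} {s : Partial} (h : Small k s) :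
    esize s ≤ 6 * k ^ 2 + 34 * k + 21 := by
  have h1 := h.cnt
  have h2 := h.cur
  have h3 := esize_le_of_length_le (B := 2 * k + 1) h.stack_length fun x hx => by
    have := h.stack x hx
    rw [esize_nat]
    omega
  have h4 := esize_le_of_length_le (B := 4 * k + 7) h.trans_length.le fun x hx => by
    obtain ⟨a, b, c⟩ := x
    have : a < s.cnt ∧ c < s.cnt := h.trans _ hx
    have := esize_bool_le b
    simp only [esize_prod, esize_nat]
    omega
  have h5 := esize_le_of_length_le h.bits fun x _ => esize_bool_le x
  have h6 := esize_le_of_length_le h.cost fun x _ => esize_bool_le x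
  have h7 : esize s = (2 * s.cur + 1) + ((2 * s.cnt + 1) + (esize s.stack + (esize s.trans +
      (esize s.bits + esize s.cost + 1) + 1) + 1) + 1) + 1 := by
    change esize s.toTuple = _
    simp [toTuple]
  nlinarith

theorem small_foldl_readBit (y : List Bool) :
    (y.foldl readBit ([], init)).1.length ≤ 3 ∧
      ∃ k ≤ y.length, Small k (y.foldl readBit ([], init)).2 := by
  induction y using List.reverseRecOn with
  | nil => exact ⟨by simp, 0, le_rfl, Small.init⟩
  | append_singleton y b ih =>
    obtain ⟨h1, k, h2, h3⟩ := ih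
    rw [List.foldl_append, List.foldl_cons, List.foldl_nil, List.length_append,
      List.length_singleton]
    generalize y.foldl readBit ([], init) = s at h1 h3
    unfold readBit
    split_ifs with h
    · refine ⟨?_, k, by omega, h3⟩
      rcases s with ⟨_ | ⟨_, _ | ⟨_, _ | ⟨_, _⟩⟩⟩, _⟩ <;> simp at h ⊢
    · exact ⟨by simp, k + 1, by omega, h3.step _ _ _ _⟩

theorem polyTime_decode {y : δ → List Bool} (hy : PolyTime I y) :
    PolyTime I (fun x => decode (y x)) := by
  have ⟨_, P, _, hP⟩ := hy
  have h1 : PolyTime I (fun x => (y x).foldl readBit ([], init)) := by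
    refine hy.foldl (.const _) (h := fun _ => readBit)
      (polyTime_readBit (PolyTime.fst.comp .snd) (PolyTime.snd.comp .snd))
      (6 * P ^ 2 + 34 * P + 35) fun x k => ?_
    obtain ⟨h2, m, h3, h4⟩ := small_foldl_readBit ((y x).take k)
    have h5 : m ≤ P.eval (esize x) :=
      h3.trans ((List.length_take_le' _ _).trans ((length_lt_esize _).le.trans (hP x)))
    have h6 := h4.esize_le
    have h7 := esize_le_of_length_le h2 fun x _ => esize_bool_le x
    generalize ((y x).take k).foldl readBit ([], init) = s at *
    obtain ⟨b, s⟩ := s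
    have h8 : 6 * m ^ 2 + 34 * m + 21 ≤
        6 * (P.eval (esize x)) ^ 2 + 34 * P.eval (esize x) + 21 := by gcongr
    simp only [esize_prod, eval_add, eval_mul, eval_pow, eval_ofNat]
    simp only at h6 h7
    omega
  exact PolyTime.snd.comp h1

theorem esize_map_fst_le {α β : Type} [Enc α] [Enc β] (l : List (α × β)) :
    esize (l.map fun t => t.1) ≤ esize l := by
  induction l with
  | nil => simp
  | cons a l ih => obtain ⟨a, b⟩ := a; simp; omega

theorem polyTime_deviatingStep {T : δ → List (ℕ × Bool × ℕ)} {B : δ → List ℕ}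
    {t : δ → ℕ × Bool × ℕ} (hT : PolyTime I T) (hB : PolyTime I B) (ht : PolyTime I t) :
    PolyTime I (fun x => deviatingStep (T x) (B x) (t x)) := by
  have ht' : PolyTime I (fun u : δ × ℕ × Bool × ℕ => u.2.2.2) :=
    PolyTime.snd.comp (PolyTime.snd.comp .snd)
  have ht₁ : PolyTime I (fun u : δ × ℕ × Bool × ℕ => t u.1) := ht.comp .fst
  have ht₂ : PolyTime I (fun u : δ × ℕ × Bool × ℕ => (t u.1).2.2) :=
    PolyTime.snd.comp (PolyTime.snd.comp ht₁)
  have h1 : PolyTime I (fun u : δ × ℕ × Bool × ℕ => decide (u.2.2.2 ∈ B u.1)) :=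
    ht'.contains (hB.comp .fst)
  have h2 : PolyTime I (fun u : δ × ℕ × Bool × ℕ => decide (u.2.2.2 = (t u.1).2.2)) :=
    ht'.eq ht₂
  have h3 : PolyTime I (fun u : δ × ℕ × Bool × ℕ => decide (u.2 = t u.1)) := PolyTime.snd.eq ht₁
  have h4 : PolyTime I (fun u : δ × ℕ × Bool × ℕ => u.2.1) := PolyTime.fst.comp .snd
  exact hT.map_filter (h1.or (h2.and h3.not)) h4

/-- Every intermediate result is either empty or the list of sources of a sublist of `T`, so the
accumulator cannot grow with the number of steps. -/
theorem polyTime_deviating {T l : δ → List (ℕ × Bool × ℕ)} (hT : PolyTime I T)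
    (hl : PolyTime I l) : PolyTime I (fun x => deviating (T x) (l x) []) := by
  have ⟨_, P, _, hP⟩ := hT
  refine hl.foldl (.const []) (h := fun x => deviatingStep (T x))
    (polyTime_deviatingStep (hT.comp .fst) (PolyTime.fst.comp .snd) (PolyTime.snd.comp .snd))
    (P + 1) fun x k => ?_
  generalize (l x).take k = l
  rcases List.eq_nil_or_concat' l with rfl | ⟨l, t, rfl⟩
  · simp
  · rw [List.foldl_append, List.foldl_cons, List.foldl_nil]
    refine (esize_map_fst_le _).trans ((esize_sublist List.filter_sublist).trans ?_)
    have := hP x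
    simp only [eval_add, eval_one]
    omega

theorem polyTime_verify {s : δ → List (Option Bool)} {y : δ → List Bool} (hs : PolyTime I s)
    (hy : PolyTime I y) : PolyTime I (fun x => verify (s x) (y x)) := by
  have h := polyTime_decode hy
  have h1 := polyTime_trans h
  have h2 : PolyTime I (fun x => (decode (y x)).trans.map fun t => some t.2.1) :=
    h1.map (PolyTime.fst.comp (PolyTime.snd.comp .snd)).some
  have h3 : PolyTime I (fun x => (decode (y x)).bits.map some) :=
    (polyTime_bits h).map PolyTime.snd.some
  exact ((hs.eq (h2.reverse.append ((PolyTime.const none).cons h3))).and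
    (((polyTime_cost h).drop_length h1).eq (.const []))).and
    ((PolyTime.const 0).contains (polyTime_deviating h1 h1)).not

end PolyTime

end AutomaticComplexity

/-! ## Machines for polynomial-time functions and for exhaustive search -/

namespace Complexity

open Polynomial Asymptotics Filter

open Enc (enc)

section Input

variable {I : Type} [Enc I]

/-- Push the encoding of the input symbol in the register, if it belongs to `l`. -/
noncomputable def pushSymbol : List I → Prog I
  | [] => skip
  | a :: l => .ite (fun r => @decide (r.1 = some a) (Classical.propDecidable _))
      (pushTree (enc a)) (pushSymbol l)

theorem runs_pushSymbol {l : List I} {a : I} (ha : a ∈ l) {r : Reg I} (hr : r.1 = some a)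
    (i : List I) (m o : List Bool) :
    ∃ r', Runs (pushSymbol l) ⟨r, i, base m o⟩ ⟨r', i, base ((enc a).ser ++ m) o⟩ 0 := by
  induction l with
  | nil => simp at ha
  | cons b l ih =>
    by_cases h : a = b
    · subst h
      obtain ⟨r', h⟩ := moves_pushTree (enc a) m o r i
      exact ⟨r', .ite_true (by simp [hr]) h⟩
    · obtain ⟨r', h'⟩ := ih (by simpa [h] using ha)
      exact ⟨r', .ite_false (by simp [hr, h]) h'⟩

variable [Fintype I]

/-- Read a symbol of the input into the register. -/
def readSymbol : Prog I := .act (.read fun r a => (a, r.2))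

/-- The loop that reads the input and pushes its encoding. -/
noncomputable def readLoop : Prog I :=
  .loop (fun r => r.1.isSome)
    (.seq (pushSymbol Finset.univ.toList) (.seq (pushConst 0 true) readSymbol))

/-- A list cell is `true` followed by head and tail, so a symbol is prepended to the list on the
stack without moving the latter. The input therefore arrives reversed. -/
theorem runs_readLoop (l z : List I) (r : Reg I) (hr : r.1 = l.head?) :
    ∃ r', Runs readLoop ⟨r, l.tail, base (enc z).ser []⟩
      ⟨r', [], base (enc (l.reverse ++ z)).ser []⟩ (l.length + 1) := by
  induction l generalizing z r with
  | nil => exact ⟨r, (Runs.loop_false (by simp [hr])).mono (by simp)⟩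
  | cons a l ih =>
    obtain ⟨r', h1⟩ := runs_pushSymbol (l := Finset.univ.toList) (a := a) (by simp) hr l
      (enc z).ser []
    obtain ⟨r'', h2⟩ := moves_pushConst 0 true (base ((enc a).ser ++ (enc z).ser) []) r' l
    rw [update_zero] at h2
    obtain ⟨r₃, h3⟩ := ih (a :: z) (l.head?, r''.2) rfl
    have h4 : Runs (readSymbol : Prog I) ⟨r'', l, base (enc (a :: z)).ser []⟩
        ⟨(l.head?, r''.2), l.tail, base (enc (a :: z)).ser []⟩ 0 := .act rfl 0
    have h5 : (enc (a :: z)).ser = true :: ((enc a).ser ++ (enc z).ser) := rfl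
    rw [List.reverse_cons, List.append_assoc]
    exact ⟨r₃, (Runs.loop_true (by simp [hr]) (h1.seq (h2.seq (h5 ▸ h4))) h3).mono
      (by simp)⟩

/-- A machine that reads the input, computes a bit, and writes it to the output stack. -/
theorem mem_DTIME_of_moves {L : Language I} {f : ℕ → ℕ} (p : Prog I) (T : ℕ → ℕ)
    (b : List I → Bool) (hb : ∀ x, x ∈ L ↔ b x = true)
    (hp : ∀ x, Moves p (base (enc x.reverse).ser []) (base (enc (b x)).ser []) (T x.length))
    (hT : (fun n : ℕ => ((T n + n + 1 : ℕ) : ℝ)) =O[atTop] (fun n : ℕ => (f n : ℝ)))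
    (hf : (fun _ : ℕ => (1 : ℝ)) =O[atTop] (fun n : ℕ => (f n : ℝ))) : L ∈ DTIME f := by
  refine mem_DTIME_of_exec (.seq (pushConst 0 false) (.seq readSymbol (.seq readLoop (.seq p
    (.seq popBit (.seq (push1 4) (.act (.load fun _ => (none, none, none, false)))))))))
    (fun n => T n + n + 1) (fun x => ?_) hT hf
  have h1 : Runs (pushConst 0 false : Prog I) (.start x)
      ⟨(none, none, none, false), x, base (enc ([] : List I)).ser []⟩ 0 := by
    refine .act ?_ 0
    simp only [Act.run, Store.start, Store.mk.injEq, true_and]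
    funext k
    fin_cases k <;> rfl
  have h2 : Runs (readSymbol : Prog I)
      ⟨(none, none, none, false), x, base (enc ([] : List I)).ser []⟩
      ⟨(x.head?, none, none, false), x.tail, base (enc ([] : List I)).ser []⟩ 0 := .act rfl 0
  obtain ⟨r, h3⟩ := runs_readLoop x [] (x.head?, none, none, false) rfl
  rw [List.append_nil] at h3
  obtain ⟨r', h4⟩ := hp x r []
  obtain ⟨r'', h5, h6⟩ := runs_popBit (b x) [] [] r' []
  rw [List.append_nil] at h6
  have h7 : Runs (push1 4 : Prog I) ⟨r'', [], base [] []⟩ ⟨r'', [], base [] [b x]⟩ 0 := by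
    refine .act ?_ 0
    simp only [Act.run, Store.mk.injEq, true_and, h5]
    funext k
    fin_cases k <;> rfl
  have h8 : Runs (.act (.load fun _ => (none, none, none, false)) : Prog I)
      ⟨r'', [], base [] [b x]⟩ (.final (b x)) 0 := by
    refine .act ?_ 0
    simp only [Act.run, Store.final, Store.mk.injEq, true_and]
    funext k
    fin_cases k <;> rfl
  have h9 : @decide (x ∈ L) (Classical.propDecidable _) = b x := by
    by_cases h : x ∈ L
    · simp [h, (hb x).1 h]
    · simp only [h, decide_false]
      exact (Bool.eq_false_iff.2 fun h' => h ((hb x).2 h')).symm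
  rw [h9]
  exact (h1.seq (h2.seq (h3.seq (h4.seq (h6.seq (h7.seq h8)))))).mono (by omega)

theorem exists_esize_le : ∃ C, ∀ x : List I, esize x ≤ C * x.length + 1 := by
  refine ⟨Finset.univ.sup (fun a : I => esize a) + 1, fun x => ?_⟩
  rw [mul_comm]
  exact esize_le_of_forall_mem fun a _ => Finset.le_sup (f := fun a : I => esize a)
    (Finset.mem_univ a)

end Input

theorem eval_le_pow (P : ℕ[X]) (n : ℕ) : P.eval n ≤ P.eval 1 * (n + 1) ^ P.natDegree := by
  rw [eval_eq_sum_range, eval_eq_sum_range, Finset.sum_mul]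
  refine Finset.sum_le_sum fun i hi => ?_
  rw [one_pow, mul_one]
  have : i ≤ P.natDegree := by simpa [Nat.lt_succ_iff] using hi
  exact Nat.mul_le_mul_left _ ((Nat.pow_le_pow_left n.le_succ i).trans
    (Nat.pow_le_pow_right n.succ_pos this))

theorem isBigO_of_le {T f : ℕ → ℕ} {A : ℕ} (h : ∀ n, 0 < n → T n ≤ A * f n) :
    (fun n : ℕ => (T n : ℝ)) =O[atTop] (fun n : ℕ => (f n : ℝ)) := by
  refine IsBigO.of_bound A ((eventually_gt_atTop 0).mono fun n hn => ?_)
  simp only [Real.norm_natCast]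
  exact_mod_cast h n hn

theorem isBigO_eval (P : ℕ[X]) :
    (fun n : ℕ => ((P.eval n : ℕ) : ℝ)) =O[atTop] (fun n : ℕ => ((n ^ P.natDegree : ℕ) : ℝ)) := by
  refine isBigO_of_le (A := P.eval 1 * 2 ^ P.natDegree) fun n hn => (eval_le_pow P n).trans ?_
  rw [mul_assoc, ← mul_pow]
  gcongr
  omega

/-- From the words of length at most `k` to the words of length at most `k + 1`. -/
def extendWords (l : List (List Bool)) : List (List Bool) :=
  [] :: (l.map (true :: ·) ++ l.map (false :: ·))

theorem mem_iterate_extendWords {k : ℕ} {y : List Bool} :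
    y ∈ extendWords^[k] [[]] ↔ y.length ≤ k := by
  induction k generalizing y with
  | zero => simp
  | succ k ih =>
    rw [Function.iterate_succ_apply', extendWords]
    rcases y with _ | ⟨_ | _, y⟩ <;> simp [ih]

theorem esize_map_cons_le (b : Bool) (l : List (List Bool)) :
    esize (l.map (b :: ·)) ≤ 5 * esize l := by
  induction l with
  | nil => simp
  | cons y l ih =>
    have := esize_bool_le b
    simp only [List.map_cons, esize_cons] at ih ⊢
    omega

/-- Prepending a bit to all words enlarges the list at most fivefold. The two copies and the empty
word together stay within a factor 12, and 3 is the size of `[[]]`. -/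
theorem esize_iterate_extendWords_le (k : ℕ) : esize (extendWords^[k] [[]]) ≤ 3 * 12 ^ k := by
  induction k with
  | zero => simp
  | succ k ih =>
    rw [Function.iterate_succ_apply', extendWords]
    generalize extendWords^[k] [[]] = l at ih ⊢
    have h1 := esize_map_cons_le true l
    have h2 := esize_map_cons_le false l
    have h3 := esize_append (l.map (true :: ·)) (l.map (false :: ·))
    have h4 := esize_pos l
    rw [esize_cons, esize_nil, pow_succ]
    omega

theorem PolyTime.extendWords {I δ : Type} [Enc δ] {f : δ → List (List Bool)} (hf : PolyTime I f) :
    PolyTime I (fun x => extendWords (f x)) :=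
  (PolyTime.const []).cons ((hf.map ((PolyTime.const true).cons .snd)).append
    (hf.map ((PolyTime.const false).cons .snd)))

/-- A list repeated `k` times. -/
def repeatList {α : Type} : ℕ → List α → List α
  | 0, _ => []
  | k + 1, l => l ++ repeatList k l

theorem length_repeatList {α : Type} (k : ℕ) (l : List α) :
    (repeatList k l).length = k * l.length := by
  induction k with
  | zero => simp [repeatList]
  | succ k ih => simp [repeatList, ih]; ring

/-- The repeated input serves as a loop counter of length `k * x.length` for the generation of all
certificates. -/
theorem PolyTime.repeatList {I : Type} [Enc I] (k : ℕ) : PolyTime I (fun x : List I => repeatList k x) := by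
  induction k with
  | zero => exact .const []
  | succ k ih => exact PolyTime.id.append ih

/-! ### Membership in P and in E -/

section Classes

variable {I : Type} [Enc I] [Fintype I] {L : Language I}

theorem mem_P_of_polyTime {f : List I → Bool} (hf : PolyTime I f) (h : ∀ x, x ∈ L ↔ f x = true) :
    L ∈ (P : Set (Language I)) := by
  obtain ⟨p, Q, hp, -⟩ := hf.comp (PolyTime.id (α := List I)).reverse
  obtain ⟨C, hC⟩ := exists_esize_le (I := I)
  refine Set.mem_iUnion.2 ⟨_, mem_DTIME_of_moves p (fun n => Q.eval (C * n + 1)) f h (fun x => ?_)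
    ((isBigO_of_le (T := _) (A := 1) fun n _ => ?_).trans
      (isBigO_eval (Q.comp (Polynomial.C C * X + 1) + X + 1))) ?_⟩
  · have := hp x.reverse [] []
    simp only [List.append_nil, List.reverse_reverse] at this
    refine this.mono (eval_mono Q ?_)
    rw [esize_reverse]
    exact hC x
  · simp [eval_comp]
  · refine (isBigO_of_le (T := fun _ => 1) (A := 1) fun n hn => ?_).congr_left (by simp)
    rw [one_mul]
    exact Nat.one_le_pow _ _ hn

/-- At most exponential growth. -/
def ExpBounded (T : ℕ → ℕ) : Prop := ∃ A c, ∀ n, T n ≤ A * 2 ^ (c * n)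

theorem ExpBounded.mono {T T' : ℕ → ℕ} (h : ExpBounded T') (hT : ∀ n, T n ≤ T' n) :
    ExpBounded T := by
  obtain ⟨A, c, h⟩ := h
  exact ⟨A, c, fun n => (hT n).trans (h n)⟩

theorem ExpBounded.eval {T : ℕ → ℕ} (h : ExpBounded T) (P : ℕ[X]) :
    ExpBounded (fun n => P.eval (T n)) := by
  obtain ⟨A, c, h⟩ := h
  refine ⟨P.eval 1 * (A + 1) ^ P.natDegree, c * P.natDegree, fun n => ?_⟩
  refine ((eval_mono P (h n)).trans (eval_le_pow P _)).trans ?_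
  rw [mul_assoc, show c * P.natDegree * n = c * n * P.natDegree by ring, pow_mul 2 (c * n),
    ← mul_pow]
  gcongr
  have := Nat.one_le_two_pow (n := c * n)
  nlinarith

theorem ExpBounded.add {T T' : ℕ → ℕ} (h : ExpBounded T) (h' : ExpBounded T') :
    ExpBounded (fun n => T n + T' n) := by
  obtain ⟨A, c, h⟩ := h
  obtain ⟨A', c', h'⟩ := h'
  refine ⟨A + A', c + c', fun n => (add_le_add (h n) (h' n)).trans ?_⟩
  rw [add_mul]
  gcongr <;> omega

theorem ExpBounded.id : ExpBounded (fun n => n) :=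
  ⟨1, 1, fun n => by simpa using Nat.lt_two_pow_self.le⟩

theorem ExpBounded.pow (a k : ℕ) : ExpBounded (fun n => a ^ (k * n)) := by
  refine ⟨1, a * k, fun n => ?_⟩
  rw [one_mul, mul_assoc, pow_mul 2]
  exact Nat.pow_le_pow_left Nat.lt_two_pow_self.le _

theorem ExpBounded.isBigO {T : ℕ → ℕ} (h : ExpBounded T) :
    ∃ c, (fun n : ℕ => (T n : ℝ)) =O[atTop] (fun n : ℕ => ((2 ^ (c * n) : ℕ) : ℝ)) := by
  obtain ⟨A, c, h⟩ := h
  exact ⟨c, isBigO_of_le fun n _ => h n⟩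

/-- Exhaustive search over certificates of linear length. -/
theorem mem_E_of_polyTime {f : List I → List Bool → Bool} (k : ℕ)
    (hf : PolyTime I (fun t : List I × List Bool => f t.1 t.2))
    (h : ∀ x, x ∈ L ↔ ∃ y, y.length ≤ k * x.length ∧ f x y = true) :
    L ∈ (E : Set (Language I)) := by
  have hid : PolyTime I (fun x : List I => x.reverse) := PolyTime.id.reverse
  -- Three stages: set up the input, the list `[[]]` and the counter; extend the list of words once
  -- for each element of the counter; test all words. The second stage uses `exists_foldl_program`,
  -- since its intermediate results are exponentially large.
  obtain ⟨p₁, P₁, hp₁, hs₁⟩ := (PolyTime.const ()).pair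
    ((hid.pair (.const ([[]] : List (List Bool)))).pair ((PolyTime.repeatList k).comp hid))
  obtain ⟨p₂, P₂, hp₂⟩ := exists_foldl_program (I := I) (δ := Unit) (α := I)
    (h := fun _ (s : List I × List (List Bool)) _ => (s.1, extendWords s.2))
    ((PolyTime.fst.comp (PolyTime.fst.comp .snd)).pair
      (PolyTime.snd.comp (PolyTime.fst.comp .snd)).extendWords)
  obtain ⟨p₃, P₃, hp₃, -⟩ : PolyTime I (fun s : List I × List (List Bool) => s.2.any (f s.1)) :=
    PolyTime.snd.any (hf.comp ((PolyTime.fst.comp .fst).pair .snd))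
  have key : ∀ (x : List I) (s : List I × List (List Bool)),
      x.foldl (fun s _ => (s.1, extendWords s.2)) s = (s.1, extendWords^[x.length] s.2) := by
    intro x
    induction x with
    | nil => simp
    | cons a x ih => intro s; simp [ih]
  obtain ⟨C, hC⟩ := exists_esize_le (I := I)
  -- `B` bounds the input together with the list of words in every round. Polynomials of an
  -- exponentially bounded function are exponentially bounded, so the total time is as well.
  set B : ℕ → ℕ := fun n => (C * n + 1) + 3 * 12 ^ (k * n) + 1 with hB
  have hB_exp : ExpBounded B := by
    have h1 := (ExpBounded.id.eval (Polynomial.C C * X + 1)).add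
      ((ExpBounded.pow 12 k).eval (3 * X + 1))
    exact h1.mono fun n => by simp [hB, add_assoc]
  have hA_exp : ExpBounded (fun n => P₁.eval (B n)) := hB_exp.eval P₁
  have hT_exp : ExpBounded (fun n => P₁.eval (B n) + P₂.eval (P₁.eval (B n) + B n) +
      P₃.eval (B n) + n + 1) :=
    (((hA_exp.add ((hA_exp.add hB_exp).eval P₂)).add (hB_exp.eval P₃)).add
      (ExpBounded.id.eval (X + 1))).mono fun n => by simp [add_assoc]
  obtain ⟨c, hc⟩ := hT_exp.isBigO
  have hsize : ∀ x : List I, esize x ≤ B x.length := fun x => by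
    have := hC x
    simp only [hB]
    omega
  have hsize' : ∀ (x : List I) j, j ≤ k * x.length →
      esize (x, extendWords^[j] [[]]) ≤ B x.length := fun x j hj => by
    have h1 := hC x
    have h2 := esize_iterate_extendWords_le j
    have h3 : 12 ^ j ≤ 12 ^ (k * x.length) := Nat.pow_le_pow_right (by norm_num) hj
    simp only [esize_prod, hB]
    omega
  refine Set.mem_iUnion.2 ⟨c, mem_DTIME_of_moves (.seq p₁ (.seq p₂ p₃))
    (fun n => P₁.eval (B n) + P₂.eval (P₁.eval (B n) + B n) + P₃.eval (B n))
    (fun x => (extendWords^[k * x.length] [[]]).any (f x)) (fun x => ?_) (fun x => ?_) hc ?_⟩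
  · rw [h, List.any_eq_true]
    simp [mem_iterate_extendWords]
  · have h1 := hp₁ x.reverse [] []
    have h2 := hp₂ () (x, [[]]) (repeatList k x) (B x.length) (fun j hj => by
      rw [key, List.length_take]
      exact hsize' x _ ((min_le_right _ _).trans (length_repeatList k x).le)) [] []
    have h3 := hp₃ (x, extendWords^[k * x.length] [[]]) [] []
    have h4 := hs₁ x.reverse
    simp only [List.append_nil, List.reverse_reverse, key, length_repeatList,
      esize_reverse] at h1 h2 h3 h4
    have h5 : P₁.eval (esize x) ≤ P₁.eval (B x.length) := eval_mono P₁ (hsize x)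
    refine (h1.seq (h2.seq h3)).mono ?_
    rw [add_assoc]
    exact add_le_add h5 (add_le_add (eval_mono P₂ (by omega))
      (eval_mono P₃ (hsize' x _ le_rfl)))
  · refine (isBigO_of_le (T := fun _ => 1) (A := 1) fun n hn => ?_).congr_left (by simp)
    rw [one_mul]
    exact Nat.one_le_two_pow

end Classes

end Complexity

namespace AutomaticComplexity

open Complexity Partial

/-! ## Unique runs and lists of transitions -/

section RunList

variable {α σ : Type}

/-- The transitions of a run in reverse order. -/
def runList (p : ℕ → σ) (a : ℕ → α) : ℕ → List (σ × α × σ)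
  | 0 => []
  | n + 1 => (p n, a n, p (n + 1)) :: runList p a n

theorem mem_runList {p : ℕ → σ} {a : ℕ → α} {n : ℕ} {t : σ × α × σ} :
    t ∈ runList p a n ↔ ∃ k < n, t = (p k, a k, p (k + 1)) := by
  induction n with
  | zero => simp [runList]
  | succ n ih => simp only [runList, List.mem_cons, ih, Nat.exists_lt_succ_right, or_comm]

theorem length_runList (p : ℕ → σ) (a : ℕ → α) (n : ℕ) : (runList p a n).length = n := by
  induction n with
  | zero => rfl
  | succ n ih => simp [runList, ih]

theorem runList_congr {p p' : ℕ → σ} {a a' : ℕ → α} {n : ℕ} (hp : ∀ i ≤ n, p i = p' i)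
    (ha : ∀ i < n, a i = a' i) : runList p a n = runList p' a' n := by
  induction n with
  | zero => rfl
  | succ n ih =>
    rw [runList, runList, ih (fun i hi => hp i (by omega)) fun i hi => ha i (by omega),
      hp n (by omega), hp (n + 1) le_rfl, ha n (by omega)]

theorem letters_runList {p : ℕ → σ} {a : ℕ → α} {n : ℕ} :
    ((runList p a n).map fun t => some t.2.1).reverse = ((List.range n).map a).map some := by
  induction n with
  | zero => rfl
  | succ n ih => simp [runList, ih, List.range_succ]

/-- Uniqueness depends only on which positions of the run carry equal states. For the backward
direction a competing run is pulled back along `f`, since each of its states is the image of a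
visited one. -/
theorem uniqueRun_comp_iff {τ : Type} {p : ℕ → σ} {a : ℕ → α} {n : ℕ} {f : σ → τ}
    (hf : ∀ i ≤ n, ∀ j ≤ n, f (p i) = f (p j) → p i = p j) :
    UniqueRun (fun i => f (p i)) a n ↔ UniqueRun p a n := by
  constructor
  · intro h q b h0 hn hq
    obtain ⟨h1, h2⟩ := h (fun i => f (q i)) b (by simp [h0]) (by simp [hn]) fun i hi => by
      obtain ⟨k, hk, e1, e2, e3⟩ := hq i hi
      exact ⟨k, hk, by simp [e1], e2, by simp [e3]⟩
    refine ⟨fun i hi => ?_, h2⟩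
    have hv : ∃ k ≤ n, q i = p k := by
      rcases hi.lt_or_eq with hi | rfl
      · obtain ⟨k, hk, e, -⟩ := hq i hi
        exact ⟨k, hk.le, e⟩
      · exact ⟨i, le_rfl, hn⟩
    obtain ⟨k, hk, e⟩ := hv
    rw [e]
    exact hf k hk i hi (by simpa [e] using h1 i hi)
  · intro h q b h0 hn hq
    have hv : ∀ i, ∃ x, i ≤ n → f x = q i ∧ ∃ k ≤ n, x = p k := by
      intro i
      by_cases hi : i ≤ n
      · rcases hi.lt_or_eq with hi | rfl
        · obtain ⟨k, hk, e, -⟩ := hq i hi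
          exact ⟨p k, fun _ => ⟨e.symm, k, hk.le, rfl⟩⟩
        · exact ⟨p i, fun _ => ⟨hn.symm, i, le_rfl, rfl⟩⟩
      · exact ⟨p 0, fun h => absurd h hi⟩
    choose x hx using hv
    have hx' : ∀ i ≤ n, ∀ k ≤ n, q i = f (p k) → x i = p k := by
      intro i hi k hk e
      obtain ⟨h1, j, hj, h2⟩ := hx i hi
      rw [h2]
      exact hf j hj k hk (by rw [← h2, h1, e])
    obtain ⟨h1, h2⟩ := h x b (hx' 0 (Nat.zero_le _) 0 (Nat.zero_le _) h0) (hx' n le_rfl n le_rfl hn)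
      fun i hi => by
        obtain ⟨k, hk, e1, e2, e3⟩ := hq i hi
        exact ⟨k, hk, hx' i hi.le k hk.le e1, e2, hx' (i + 1) hi (k + 1) hk e3⟩
    exact ⟨fun i hi => by rw [← (hx i hi).1, h1 i hi], h2⟩

theorem mem_deviatingStep {T : List (ℕ × Bool × ℕ)} {B : List ℕ} {t : ℕ × Bool × ℕ} {x : ℕ} :
    x ∈ deviatingStep T B t ↔
      ∃ c y, (x, c, y) ∈ T ∧ (y ∈ B ∨ (y = t.2.2 ∧ (x, c, y) ≠ t)) := by
  simp only [deviatingStep, List.mem_map, List.mem_filter, Bool.or_eq_true, Bool.and_eq_true,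
    decide_eq_true_eq, Bool.not_eq_true', decide_eq_false_iff_not]
  constructor
  · rintro ⟨⟨x, c, y⟩, h, rfl⟩
    exact ⟨c, y, h⟩
  · rintro ⟨c, y, h⟩
    exact ⟨(x, c, y), h, rfl⟩

/-- Induction on `n` with `B` arbitrary. As `runList` is in reverse order, the fold goes backwards
in time: it turns the condition on the end of a run into a condition one step earlier, where a
deviation in the last transition is recorded in the new `B`. -/
theorem mem_deviating {T : List (ℕ × Bool × ℕ)} {p : ℕ → ℕ} {a : ℕ → Bool} {n : ℕ}
    (hT : ∀ i < n, (p i, a i, p (i + 1)) ∈ T) {B : List ℕ} {x : ℕ} :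
    x ∈ deviating T (runList p a n) B ↔ ∃ (q : ℕ → ℕ) (b : ℕ → Bool), q 0 = x ∧
      (∀ i < n, (q i, b i, q (i + 1)) ∈ T) ∧ (q n ∈ B ∨ (q n = p n ∧
        ∃ i < n, (q i, b i, q (i + 1)) ≠ (p i, a i, p (i + 1)))) := by
  induction n generalizing B with
  | zero =>
    simp only [runList, deviating, List.foldl_nil, Nat.not_lt_zero, IsEmpty.forall_iff,
      implies_true, true_and, false_and, exists_false, and_false, or_false]
    exact ⟨fun h => ⟨fun _ => x, fun _ => false, rfl, h⟩, fun ⟨q, _, h, h'⟩ => h ▸ h'⟩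
  | succ n ih =>
    rw [runList, deviating, List.foldl_cons, ← deviating, ih fun i hi => hT i (by omega)]
    constructor
    · rintro ⟨q, b, h0, hq, h⟩
      have hext : ∃ c y, (q n, c, y) ∈ T ∧ (y ∈ B ∨ (y = p (n + 1) ∧
          ((q n, c, y) ≠ (p n, a n, p (n + 1)) ∨
            ∃ i < n, (q i, b i, q (i + 1)) ≠ (p i, a i, p (i + 1))))) := by
        rcases h with h | ⟨h1, h2⟩
        · obtain ⟨c, y, h1, h2⟩ := mem_deviatingStep.1 h
          exact ⟨c, y, h1, h2.imp_right fun h => ⟨h.1, .inl h.2⟩⟩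
        · exact ⟨a n, p (n + 1), h1 ▸ hT n (by omega), .inr ⟨rfl, .inr h2⟩⟩
      obtain ⟨c, y, h1, h2⟩ := hext
      have e1 : ∀ i ≤ n, Function.update q (n + 1) y i = q i := fun i hi =>
        Function.update_of_ne (by omega) _ _
      have e2 : ∀ i < n, Function.update b n c i = b i := fun i hi =>
        Function.update_of_ne (by omega) _ _
      refine ⟨Function.update q (n + 1) y, Function.update b n c, by rw [e1 0 (by omega), h0],
        fun i hi => ?_, ?_⟩
      · rcases (Nat.lt_succ_iff.1 hi).lt_or_eq with hi | rfl
        · rw [e1 i hi.le, e2 i hi, e1 (i + 1) hi]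
          exact hq i hi
        · simpa [e1 i le_rfl] using h1
      · rw [Function.update_self]
        refine h2.imp_right fun h => ⟨h.1, ?_⟩
        rcases h.2 with h | ⟨i, hi, h⟩
        · exact ⟨n, by omega, by simpa [e1 n le_rfl] using h⟩
        · exact ⟨i, by omega, by rwa [e1 i hi.le, e2 i hi, e1 (i + 1) hi]⟩
    · rintro ⟨q, b, h0, hq, h⟩
      refine ⟨q, b, h0, fun i hi => hq i (by omega), ?_⟩
      rw [mem_deviatingStep]
      rcases h with h | ⟨h1, i, hi, h2⟩
      · exact .inl ⟨b n, q (n + 1), hq n (by omega), .inl h⟩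
      · by_cases h3 : (q n, b n, q (n + 1)) = (p n, a n, p (n + 1))
        · rcases (Nat.lt_succ_iff.1 hi).lt_or_eq with hi | rfl
          · exact .inr ⟨congrArg Prod.fst h3, i, hi, h2⟩
          · exact absurd h3 h2
        · exact .inl ⟨b n, q (n + 1), hq n (by omega), .inr ⟨h1, h3⟩⟩

/-- With `B` empty and only the transitions of the run available, a deviating run from `p 0` is
exactly a competitor. -/
theorem uniqueRun_iff {p : ℕ → ℕ} {a : ℕ → Bool} {n : ℕ} :
    UniqueRun p a n ↔ p 0 ∉ deviating (runList p a n) (runList p a n) [] := by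
  rw [mem_deviating fun i hi => mem_runList.2 ⟨i, hi, rfl⟩]
  simp only [List.not_mem_nil, false_or, not_exists, not_and, mem_runList, Prod.mk.injEq, ne_eq]
  constructor
  · intro h q b h0 hq hn i hi
    obtain ⟨h1, h2⟩ := h q b h0 hn hq
    exact fun hne => hne (h1 i hi.le) (h2 i hi) (h1 (i + 1) hi)
  · intro h q b h0 hn hq
    have : ∀ i < n, q i = p i ∧ b i = a i ∧ q (i + 1) = p (i + 1) := fun i hi =>
      by_contra fun hne => h q b h0 hq hn i hi fun h1 h2 h3 => hne ⟨h1, h2, h3⟩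
    refine ⟨fun i hi => ?_, fun i hi => (this i hi).2.1⟩
    rcases hi.lt_or_eq with hi | rfl
    · exact (this i hi).1
    · exact hn

end RunList

/-! ## Soundness of the verifier -/

/-- Free of division and subtraction, this is the inequality that the verifier tests with the unary
counter `cost`. -/
theorem deficiency_gt_iff {α : Type} {w : List α} {d : ℕ} :
    deficiency w > (d : ℤ) ↔ 2 * (complexityN w + d) ≤ w.length := by
  unfold deficiency
  omega

/-- A partial run comes from a run of length `k`. -/
def IsRun (k : ℕ) (s : Partial) : Prop :=
  ∃ (p : ℕ → ℕ) (a : ℕ → Bool), p 0 = 0 ∧ p k = s.cur ∧ (∀ i, p i < s.cnt) ∧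
    s.trans = runList p a k ∧ ∃ d : ℕ, s.bits = d.bits ∧ s.cost.length = 2 * (s.cnt + d)

theorem isRun_init : IsRun 0 init :=
  ⟨fun _ => 0, fun _ => false, rfl, rfl, by simp [init], rfl, 0, by simp [init], by simp [init]⟩

theorem IsRun.step {k : ℕ} {s : Partial} (h : IsRun k s) (hs : Small k s) (a b c d : Bool) :
    IsRun (k + 1) (s.step a b c d) := by
  obtain ⟨p, l, h0, hk, hlt, ht, n, hn, hc⟩ := h
  have h1 := hs.target_lt a b
  have h3 : (s.step a b c d).cnt = s.cnt + a.toNat := by cases a <;> simp [Partial.step]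
  have e1 : ∀ i ≤ k, Function.update p (k + 1) (s.target a b) i = p i := fun i hi =>
    Function.update_of_ne (by omega) _ _
  have e2 : ∀ i < k, Function.update l k c i = l i := fun i hi =>
    Function.update_of_ne (by omega) _ _
  refine ⟨Function.update p (k + 1) (s.target a b), Function.update l k c,
    by rw [e1 0 (by omega), h0], by simp [Partial.step], fun i => ?_, ?_, n + d.toNat, ?_, ?_⟩
  · rw [h3]
    by_cases hi : i = k + 1
    · rw [hi, Function.update_self]
      exact h1
    · rw [Function.update_of_ne hi]
      have := hlt i
      omega
  · rw [runList, runList_congr e1 e2, e1 k le_rfl, hk]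
    simp [Partial.step, ht]
  · cases d <;> simp [Partial.step, hn, addCarry_bits]
  · cases a <;> cases d <;> simp [Partial.step, hc] <;> ring

theorem isRun_decode (y : List Bool) :
    ∃ k, Small k (decode y) ∧ IsRun k (decode y) := by
  induction y using List.reverseRecOn with
  | nil => exact ⟨0, Small.init, isRun_init⟩
  | append_singleton y b ih =>
    obtain ⟨k, h1, h2⟩ := ih
    unfold decode at h1 h2 ⊢
    rw [List.foldl_append, List.foldl_cons, List.foldl_nil]
    generalize y.foldl readBit ([], init) = s at h1 h2
    unfold readBit
    split_ifs with h
    · exact ⟨k, h1, h2⟩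
    · exact ⟨k + 1, h1.step _ _ _ _, h2.step h1 _ _ _ _⟩

/-- Any bit string decodes to some run on at most `cnt` states. If no run deviates from it, its
transitions form an automaton that accepts uniquely, so `cnt` bounds the complexity from above; the
certificate need not be optimal. -/
theorem mem_DEFICIENCY_of_verify {s : List (Option Bool)} {y : List Bool}
    (h : verify s y = true) : s ∈ DEFICIENCY := by
  obtain ⟨n, -, p, a, h0, -, hlt, ht, d, hd, hc⟩ := isRun_decode y
  simp only [verify, Bool.and_eq_true, decide_eq_true_eq, Bool.not_eq_true',
    decide_eq_false_iff_not, List.drop_eq_nil_iff] at h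
  obtain ⟨⟨hs, hn⟩, hdev⟩ := h
  rw [ht, letters_runList, hd] at hs
  rw [ht, length_runList, hc] at hn
  rw [ht, ← h0, ← uniqueRun_iff] at hdev
  refine ⟨_, d, hs, deficiency_gt_iff.2 ?_⟩
  have h1 : UniqueRun (fun i => (⟨p i, hlt i⟩ : Fin (decode y).cnt)) a n :=
    (uniqueRun_comp_iff (f := Fin.val) fun _ _ _ _ h => Fin.ext h).1 hdev
  have h2 : complexityN ((List.range n).map a) ≤ (decode y).cnt :=
    complexityN_le _ a (fun i => by simp) (by simpa using h1)
  rw [List.length_map, List.length_range]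
  omega

end AutomaticComplexity

namespace AutomaticComplexity

open Complexity Partial

/-! ## Completeness of the verifier -/

/-! ### Numbering the vertices in the order of their first visits -/

section Names

open Classical in
/-- The number of vertices that the walk visits before it visits `v`. -/
noncomputable def visitName {σ : Type} (p : ℕ → σ) (v : σ) : ℕ :=
  ((Finset.range (sInf {k | p k = v})).image p).card

variable {σ : Type} {p : ℕ → σ}

open Classical in
theorem visitName_of_newVertex {i : ℕ} (h : NewVertex p i) :
    visitName p (p i) = ((Finset.range i).image p).card := by
  have h1 : sInf {k | p k = p i} ≤ i := Nat.sInf_le rfl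
  have h2 : p (sInf {k | p k = p i}) = p i := Nat.sInf_mem (s := {k | p k = p i}) ⟨i, rfl⟩
  have h3 : sInf {k | p k = p i} = i := by
    by_contra h'
    exact h _ (by omega) h2
  rw [visitName, h3]

/-- The name of a vertex counts the distinct vertices seen before its first visit, so it is strictly
increasing in the position of the first visit. -/
theorem visitName_inj {i j : ℕ} (h : visitName p (p i) = visitName p (p j)) : p i = p j := by
  classical
  obtain ⟨i', -, hi, hi'⟩ := exists_newVertex p i
  obtain ⟨j', -, hj, hj'⟩ := exists_newVertex p j
  rw [← hi, ← hj, visitName_of_newVertex hi', visitName_of_newVertex hj'] at h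
  have main : ∀ i j, NewVertex p i → i < j →
      ((Finset.range i).image p).card < ((Finset.range j).image p).card := by
    intro i j hi hij
    refine Finset.card_lt_card (Finset.ssubset_iff_of_subset
      (Finset.image_subset_image (by simpa using hij.le)) |>.2 ⟨p i, ?_, ?_⟩)
    · exact Finset.mem_image_of_mem _ (by simpa using hij)
    · simp only [Finset.mem_image, Finset.mem_range, not_exists, not_and]
      exact hi
  rw [← hi, ← hj]
  rcases lt_trichotomy i' j' with hlt | rfl | hlt
  · exact absurd h (main _ _ hi' hlt).ne
  · rfl
  · exact absurd h (main _ _ hj' hlt).ne'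

end Names

/-! ### The stack discipline and the certificate of a unique run -/

section Certificate

variable {σ : Type}

/-- The vertex at position `i` is entered by a back edge at a later position. -/
def IsOpen (p : ℕ → σ) (n i k : ℕ) : Prop :=
  1 ≤ k ∧ k ≤ i ∧ NewVertex p k ∧ ∃ d, i < d ∧ d ≤ n ∧ BackEdge p d ∧ p d = p k

/-- The stack consists of the open vertices. -/
def IsStack (p : ℕ → σ) (n i : ℕ) (s : List ℕ) : Prop :=
  ∃ l : List ℕ, l.Pairwise (· > ·) ∧ (∀ k, k ∈ l ↔ IsOpen p n i k) ∧
    s = l.map fun k => visitName p (p k)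

/-- A vertex that is entered by a back edge is on the top of the stack, unless it is the first
one. -/
theorem UniquePath.isStack_cases {p : ℕ → σ} {n : ℕ} (hU : UniquePath p n) {i : ℕ} {s : List ℕ}
    (hi : i < n) (h : BackEdge p (i + 1)) (hs : IsStack p n i s) :
    visitName p (p (i + 1)) = s.headD 0 ∧ IsStack p n (i + 1) s.tail := by
  obtain ⟨l, hl, hmem, rfl⟩ := hs
  obtain ⟨b, hb, e, hnew⟩ := h.exists_newVertex
  have hlast : ∀ d, BackEdge p d → d ≤ n → p d = p b → d = i + 1 := fun d hd hd' e' =>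
    hU.backEdge_unique hd h hd' hi (e'.trans e)
  have hopen : ∀ k, IsOpen p n (i + 1) k ↔ IsOpen p n i k ∧ k ≠ b := by
    intro k
    constructor
    · rintro ⟨h1, h2, h3, d, h4, h5, h6, h7⟩
      have hk : k ≠ b := by
        rintro rfl
        have := hlast d h6 h5 h7
        omega
      refine ⟨⟨h1, ?_, h3, d, by omega, h5, h6, h7⟩, hk⟩
      have : k ≠ i + 1 := by
        rintro rfl
        exact h.2 h3
      omega
    · rintro ⟨⟨h1, h2, h3, d, h4, h5, h6, h7⟩, hk⟩
      refine ⟨h1, by omega, h3, d, ?_, h5, h6, h7⟩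
      have : d ≠ i + 1 := by
        rintro rfl
        exact hk (h3.unique hnew (h7.symm.trans e.symm))
      omega
  -- The loop of an open vertex first visited after `b` would contain the visit `i + 1` of the
  -- vertex at `b`, against laminarity.
  have htop : ∀ k, IsOpen p n i k → k ≤ b := by
    rintro k ⟨h1, h2, h3, d, h4, h5, h6, h7⟩
    by_contra hk
    have : d ≠ i + 1 := by
      rintro rfl
      exact hk (h3.unique hnew (h7.symm.trans e.symm)).le
    exact hU.backEdge_laminar h6 h5 h7.symm (a := b) (b := k) (c := i + 1) (by omega) (by omega)
      (by omega) e
  -- The initial vertex is never on the stack, which is the purpose of `1 ≤ k` in `IsOpen`. When the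
  -- walk returns to it, no other vertex is open, and the default value `0` of `headD` is its name.
  rcases Nat.eq_zero_or_pos b with rfl | hb0
  · have : l = [] := by
      rw [List.eq_nil_iff_forall_not_mem]
      intro k hk
      have h1 := (hmem k).1 hk
      have := htop k h1
      have := h1.1
      omega
    subst this
    refine ⟨?_, [], .nil, fun k => ?_, rfl⟩
    · rw [← e, visitName_of_newVertex hnew]
      rfl
    · rw [hopen, ← hmem]
      simp
  · have hbl : b ∈ l := (hmem b).2 ⟨hb0, by omega, hnew, i + 1, by omega, hi, h, e.symm⟩
    rcases l with _ | ⟨c, l⟩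
    · simp at hbl
    have hc : c = b := by
      rcases List.mem_cons.1 hbl with hc | hc
      · exact hc.symm
      · have h1 := List.rel_of_pairwise_cons hl hc
        have h2 := htop c ((hmem c).1 (by simp))
        omega
    subst hc
    refine ⟨by simp [e], l, hl.of_cons, fun k => ?_, rfl⟩
    rw [hopen, ← hmem]
    constructor
    · intro hk
      exact ⟨List.mem_cons_of_mem _ hk, (List.rel_of_pairwise_cons hl hk).ne⟩
    · rintro ⟨hk, hne⟩
      exact (List.mem_cons.1 hk).resolve_left hne

theorem isStack_nil (p : ℕ → σ) (n : ℕ) : IsStack p n 0 [] :=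
  ⟨[], .nil, fun k => by simp [IsOpen]; omega, rfl⟩

theorem isOpen_succ_iff {p : ℕ → σ} {n i k : ℕ} (h : ¬ BackEdge p (i + 1)) (hk : k ≤ i) :
    IsOpen p n (i + 1) k ↔ IsOpen p n i k := by
  refine ⟨fun ⟨h1, _, h3, d, h4, h5⟩ => ⟨h1, hk, h3, d, by omega, h5⟩,
    fun ⟨h1, _, h3, d, h4, h5, h6, h7⟩ => ⟨h1, by omega, h3, d, ?_, h5, h6, h7⟩⟩
  have : d ≠ i + 1 := by
    rintro rfl
    exact h h6
  omega

theorem IsStack.succ_of_not_isOpen {p : ℕ → σ} {n i : ℕ} {s : List ℕ} (hs : IsStack p n i s)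
    (h : ¬ BackEdge p (i + 1)) (ho : ¬ IsOpen p n (i + 1) (i + 1)) : IsStack p n (i + 1) s := by
  obtain ⟨l, hl, hmem, rfl⟩ := hs
  refine ⟨l, hl, fun k => ?_, rfl⟩
  rw [hmem]
  by_cases hk : k ≤ i
  · exact (isOpen_succ_iff h hk).symm
  · refine ⟨fun h' => absurd h'.2.1 hk, fun h' => ?_⟩
    obtain rfl : k = i + 1 := by have := h'.2.1; omega
    exact absurd h' ho

theorem IsStack.succ_of_isOpen {p : ℕ → σ} {n i : ℕ} {s : List ℕ} (hs : IsStack p n i s)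
    (ho : IsOpen p n (i + 1) (i + 1)) :
    IsStack p n (i + 1) (visitName p (p (i + 1)) :: s) := by
  obtain ⟨l, hl, hmem, rfl⟩ := hs
  have h : ¬ BackEdge p (i + 1) := fun h => h.2 ho.2.2.1
  refine ⟨(i + 1) :: l, List.pairwise_cons.2 ⟨fun k hk => ?_, hl⟩, fun k => ?_, rfl⟩
  · have := ((hmem k).1 hk).2.1
    omega
  · rw [List.mem_cons, hmem]
    by_cases hk : k ≤ i
    · rw [isOpen_succ_iff h hk, or_iff_right (by omega)]
    · refine ⟨?_, fun h' => .inl (by have := h'.2.1; omega)⟩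
      rintro (rfl | h')
      · exact ho
      · exact absurd h'.2.1 hk

theorem lookup_eq {T : List (ℕ × Bool × ℕ)} {s v : ℕ} (h : ∃ t ∈ T, t.1 = s)
    (h' : ∀ t ∈ T, t.1 = s → t.2.2 = v) : lookup T s = v := by
  obtain ⟨t, ht, hs⟩ := h
  have h1 : t.2.2 ∈ (T.filter fun t => decide (t.1 = s)).map fun t => t.2.2 :=
    List.mem_map.2 ⟨t, List.mem_filter.2 ⟨ht, by simpa using hs⟩, rfl⟩
  have h2 : ∀ x ∈ (T.filter fun t => decide (t.1 = s)).map fun t => t.2.2, x = v := by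
    intro x hx
    obtain ⟨t, ht, rfl⟩ := List.mem_map.1 hx
    rw [List.mem_filter] at ht
    exact h' t ht.1 (by simpa using ht.2)
  unfold lookup
  generalize (T.filter fun t => decide (t.1 = s)).map (fun t => t.2.2) = l at h1 h2
  cases l with
  | nil => simp at h1
  | cons x l => exact h2 x (by simp)

open Classical in
/-- The partial run `s` describes the first `i` steps of a run. -/
structure Describes (p : ℕ → σ) (a : ℕ → Bool) (n d i : ℕ) (s : Partial) : Prop where
  cur : s.cur = visitName p (p i)
  cnt : s.cnt = ((Finset.range (i + 1)).image p).card
  stack : IsStack p n i s.stack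
  trans : s.trans = runList (fun k => visitName p (p k)) a i
  bits : s.bits = (min i d).bits
  cost : s.cost.length = 2 * (s.cnt + min i d)

theorem describes_init (p : ℕ → σ) (a : ℕ → Bool) (n d : ℕ) : Describes p a n d 0 init := by
  refine ⟨?_, by simp [init], isStack_nil p n, rfl, by simp [init], by simp [init]⟩
  rw [visitName_of_newVertex fun k hk => absurd hk (Nat.not_lt_zero k)]
  rfl

open Classical in
/-- The certificate for the next step. -/
theorem Describes.step {p : ℕ → σ} {a : ℕ → Bool} {n d i : ℕ} {s : Partial}
    (hU : UniquePath p n) (h : Describes p a n d i s) (hi : i < n) :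
    Describes p a n d (i + 1) (s.step (decide (NewVertex p (i + 1)))
      (decide (IsOpen p n (i + 1) (i + 1) ∨ BackEdge p (i + 1))) (a i) (decide (i < d))) := by
  have key : s.target (decide (NewVertex p (i + 1)))
        (decide (IsOpen p n (i + 1) (i + 1) ∨ BackEdge p (i + 1))) = visitName p (p (i + 1)) ∧
      IsStack p n (i + 1) (s.nextStack (decide (NewVertex p (i + 1)))
        (decide (IsOpen p n (i + 1) (i + 1) ∨ BackEdge p (i + 1)))) ∧
      s.cnt + (decide (NewVertex p (i + 1))).toNat =
        ((Finset.range (i + 1 + 1)).image p).card := by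
    rw [h.cnt, Finset.range_add_one (n := i + 1), Finset.image_insert]
    by_cases hnew : NewVertex p (i + 1)
    · have hB : ¬ BackEdge p (i + 1) := fun hB => hB.2 hnew
      refine ⟨?_, ?_, ?_⟩
      · simp [target, hnew, h.cnt, visitName_of_newVertex hnew]
      · by_cases ho : IsOpen p n (i + 1) (i + 1)
        · have := h.stack.succ_of_isOpen ho
          simpa [nextStack, hnew, ho, h.cnt, visitName_of_newVertex hnew] using this
        · simpa [nextStack, hnew, ho, hB] using h.stack.succ_of_not_isOpen hB ho
      · rw [Finset.card_insert_of_notMem]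
        · simp [hnew]
        · simp only [Finset.mem_image, Finset.mem_range, not_exists, not_and]
          exact hnew
    · have ho : ¬ IsOpen p n (i + 1) (i + 1) := fun ho => hnew ho.2.2.1
      have hcard : ((Finset.range (i + 1)).image p).card + (decide (NewVertex p (i + 1))).toNat =
          (insert (p (i + 1)) ((Finset.range (i + 1)).image p)).card := by
        rw [Finset.insert_eq_of_mem]
        · simp [hnew]
        · simp only [NewVertex, not_forall, not_not] at hnew
          obtain ⟨k, hk, e⟩ := hnew
          exact Finset.mem_image.2 ⟨k, by simpa using hk, e⟩
      by_cases hB : BackEdge p (i + 1)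
      · obtain ⟨h1, h2⟩ := hU.isStack_cases hi hB h.stack
        refine ⟨?_, ?_, hcard⟩
        · simp only [target, hnew, hB, ho, h1, decide_true, decide_false, or_true, if_true,
            Bool.false_eq_true, if_false]
        · simpa only [nextStack, hnew, hB, ho, decide_true, decide_false, or_true, if_true,
            Bool.false_eq_true, if_false] using h2
      · refine ⟨?_, ?_, hcard⟩
        · have hold : ¬ NewEdge p (i + 1) := fun hE => hB ⟨hE, hnew⟩
          simp only [target, hnew, hB, ho, decide_false, or_false, Bool.false_eq_true, if_false]
          rw [h.trans, h.cur]
          -- An old edge: the current vertex was left before, and every earlier departure had the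
          -- target that is needed now, so it does not matter which transition is found.
          refine lookup_eq ?_ ?_
          · have h1 := hold
            simp only [NewEdge, not_forall, not_not] at h1
            obtain ⟨k, hk, e⟩ := h1
            cases k with
            | zero => simp at e
            | succ k =>
              simp only [edgeAt_succ, Prod.mk.injEq, Option.some.injEq] at e
              exact ⟨_, mem_runList.2 ⟨k, by omega, rfl⟩, by simp [e.1]⟩
          · intro t ht e
            obtain ⟨k, hk, rfl⟩ := mem_runList.1 ht
            simp only at e ⊢
            rw [hU.succ_of_not_newEdge hold hi hk (visitName_inj e)]
        · simpa [nextStack, hnew, ho, hB] using h.stack.succ_of_not_isOpen hB ho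
  obtain ⟨h1, h2, h3⟩ := key
  generalize decide (NewVertex p (i + 1)) = A at *
  generalize decide (IsOpen p n (i + 1) (i + 1) ∨ BackEdge p (i + 1)) = B at *
  -- The counter for `d` is increased in each of the first `d` steps and then stays constant.
  have h4 : min (i + 1) d = min i d + (decide (i < d)).toNat := by
    by_cases hd : i < d
    · simp [hd]; omega
    · simp [hd]; omega
  have h5 : i < d → min i d = i := by omega
  refine ⟨h1, ?_, h2, ?_, ?_, ?_⟩
  · rw [← h3]
    cases A <;> simp [Partial.step]
  · simp [Partial.step, runList, h.cur, h.trans, h1]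
  · rw [h4]
    cases decide (i < d) <;> simp [Partial.step, h.bits, addCarry_bits]
  · rw [h4]
    have := h.cost
    cases A <;> cases decide (i < d) <;> simp [Partial.step, this] <;> ring

end Certificate

theorem exists_verify_of_mem_DEFICIENCY {s : List (Option Bool)} (h : s ∈ DEFICIENCY) :
    ∃ y : List Bool, y.length ≤ 4 * s.length ∧ verify s y = true := by
  classical
  obtain ⟨w, d, rfl, hd⟩ := h
  rw [deficiency_gt_iff] at hd
  obtain ⟨M, hM⟩ := complexityN_spec w
  obtain ⟨-, p', hp', -⟩ := id hM
  set a : ℕ → Bool := fun i => w.getD i false with ha_def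
  have ha : ∀ i : Fin w.length, a i = w.get i := fun i => by simp [ha_def]
  have hU := hM.uniqueRun hp' a ha
  generalize extend p' = p at hU
  have key : ∀ m ≤ w.length, ∃ y : List Bool, y.length = 4 * m ∧ ∃ t,
      y.foldl readBit ([], init) = ([], t) ∧ Describes p a w.length d m t := by
    intro m hm
    induction m with
    | zero => exact ⟨[], rfl, init, rfl, describes_init p a _ d⟩
    | succ m ih =>
      obtain ⟨y, hy, t, ht, h⟩ := ih (by omega)
      obtain ⟨A, B, C, D, h'⟩ : ∃ A B C D, Describes p a w.length d (m + 1) (t.step A B C D) :=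
        ⟨_, _, _, _, h.step hU.uniquePath hm⟩
      -- `readBit` stores three bits in reverse order, and the fourth triggers the step with the
      -- bits in their original order.
      refine ⟨y ++ [A, B, C, D], by simp [hy]; ring, _, ?_, h'⟩
      rw [List.foldl_append, ht]
      rfl
  obtain ⟨y, hy, t, ht, h⟩ := key w.length le_rfl
  have hdec : decode y = t := by rw [decode, ht]
  refine ⟨y, by rw [hy]; simp [encodeInstance], ?_⟩
  have hcnt : t.cnt ≤ complexityN w := by
    rw [h.cnt]
    exact (Finset.card_le_univ _).trans (by simp)
  -- A positive answer forces `d ≤ w.length`. So although `d` is given in binary, the run is long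
  -- enough to count up to it.
  have hmin : min w.length d = d := by omega
  have hw : (List.range w.length).map a = w := by
    refine List.ext_getElem (by simp) fun i h1 h2 => ?_
    simp [ha_def, h2]
  simp only [verify, hdec, Bool.and_eq_true, decide_eq_true_eq, Bool.not_eq_true',
    decide_eq_false_iff_not, List.drop_eq_nil_iff]
  refine ⟨⟨?_, ?_⟩, ?_⟩
  · rw [h.trans, letters_runList, h.bits, hmin, hw]
    rfl
  · rw [h.trans, length_runList, h.cost, hmin]
    omega
  · rw [h.trans]
    have h0 : visitName p (p 0) = 0 := by
      rw [visitName_of_newVertex fun k hk => absurd hk (Nat.not_lt_zero k)]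
      rfl
    have h1 := uniqueRun_iff.1 ((uniqueRun_comp_iff (f := visitName p)
      fun i _ j _ e => visitName_inj e).2 hU)
    rwa [h0] at h1

theorem mem_DEFICIENCY_iff {s : List (Option Bool)} :
    s ∈ DEFICIENCY ↔ ∃ y : List Bool, y.length ≤ 4 * s.length ∧ verify s y = true :=
  ⟨exists_verify_of_mem_DEFICIENCY, fun ⟨_, _, h⟩ => mem_DEFICIENCY_of_verify h⟩

end AutomaticComplexity

namespace AutomaticComplexity

open Complexity

/-! ## Membership in NP and E -/

section Classes

/-- The symbols of the first component of a pair. -/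
def isLeftSymbol : Option (Option Bool ⊕ Bool) → Bool
  | some (.inl _) => true
  | _ => false

/-- The symbol of the first component of a pair. -/
def leftSymbol : Option (Option Bool ⊕ Bool) → Option Bool
  | some (.inl a) => a
  | _ => none

/-- The symbols of the second component of a pair. -/
def isRightSymbol : Option (Option Bool ⊕ Bool) → Bool
  | some (.inr _) => true
  | _ => false

/-- The symbol of the second component of a pair. -/
def rightSymbol : Option (Option Bool ⊕ Bool) → Bool
  | some (.inr b) => b
  | _ => false

/-- The symbols of the two components carry different tags, so filtering undoes the pairing. -/
theorem left_pairWord (x : List (Option Bool)) (y : List Bool) :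
    ((pairWord x y).filter isLeftSymbol).map leftSymbol = x := by
  have h1 : (x.map fun a => (some (.inl a) : Option (Option Bool ⊕ Bool))).filter isLeftSymbol =
      x.map fun a => some (.inl a) := List.filter_eq_self.2 fun a ha => by
      obtain ⟨b, -, rfl⟩ := List.mem_map.1 ha
      simp [isLeftSymbol]
  have h2 : (y.map fun b => (some (.inr b) : Option (Option Bool ⊕ Bool))).filter isLeftSymbol =
      [] := List.filter_eq_nil_iff.2 fun a ha => by
      obtain ⟨b, -, rfl⟩ := List.mem_map.1 ha
      simp [isLeftSymbol]
  rw [pairWord, List.filter_append, List.filter_cons, h1, h2]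
  simp [isLeftSymbol, leftSymbol, Function.comp_def]

theorem right_pairWord (x : List (Option Bool)) (y : List Bool) :
    ((pairWord x y).filter isRightSymbol).map rightSymbol = y := by
  have h1 : (x.map fun a => (some (.inl a) : Option (Option Bool ⊕ Bool))).filter isRightSymbol =
      [] := List.filter_eq_nil_iff.2 fun a ha => by
      obtain ⟨b, -, rfl⟩ := List.mem_map.1 ha
      simp [isRightSymbol]
  have h2 : (y.map fun b => (some (.inr b) : Option (Option Bool ⊕ Bool))).filter isRightSymbol =
      y.map fun b => some (.inr b) := List.filter_eq_self.2 fun a ha => by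
      obtain ⟨b, -, rfl⟩ := List.mem_map.1 ha
      simp [isRightSymbol]
  rw [pairWord, List.filter_append, List.filter_cons, h1, h2]
  simp [isRightSymbol, rightSymbol, Function.comp_def]

theorem DEFICIENCY_mem_NP : DEFICIENCY ∈ (Complexity.NP : Set (Language (Option Bool))) := by
  refine ⟨{z | verify ((z.filter isLeftSymbol).map leftSymbol)
    ((z.filter isRightSymbol).map rightSymbol) = true}, ?_, 4 * Polynomial.X, fun x => ?_⟩
  · exact mem_P_of_polyTime (polyTime_verify
      (PolyTime.id.map_filter ((PolyTime.of_finite isLeftSymbol).comp .snd)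
        ((PolyTime.of_finite leftSymbol).comp .snd))
      (PolyTime.id.map_filter ((PolyTime.of_finite isRightSymbol).comp .snd)
        ((PolyTime.of_finite rightSymbol).comp .snd))) fun _ => Iff.rfl
  · rw [mem_DEFICIENCY_iff]
    refine exists_congr fun y => and_congr (by simp) ?_
    change _ ↔ verify _ _ = true
    rw [left_pairWord, right_pairWord]

/-- The certificate length is linear in the input, so exhaustive search stays within `2^{O(n)}`. -/
theorem DEFICIENCY_mem_E : DEFICIENCY ∈ (Complexity.E : Set (Language (Option Bool))) :=
  mem_E_of_polyTime 4 (polyTime_verify .fst .snd) fun _ => mem_DEFICIENCY_iff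

end Classes

end AutomaticComplexity

theorem mainTheorem8 :
    -- the decision problem is in NP and in E
    AutomaticComplexity.DEFICIENCY ∈ (Complexity.NP : Set (Language (Option Bool))) ∧
    AutomaticComplexity.DEFICIENCY ∈ (Complexity.E : Set (Language (Option Bool))) ∧
    -- the code of a uniquely accepting automaton is well defined and has length at most 2(n+1)
    (∀ (α : Type) (q : ℕ) (M : NFA α (Fin q)) (w : List α) (p : Fin (w.length + 1) → Fin q),
      AutomaticComplexity.UniquelyAccepts M w →
      AutomaticComplexity.IsAcceptingPath M p w.get →
      ∃ c : List AutomaticComplexity.Symbol,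
        AutomaticComplexity.IsBracketCode p c ∧
        (∀ c', AutomaticComplexity.IsBracketCode p c' → c' = c) ∧
        c.length ≤ 2 * (w.length + 1)) ∧
    -- the code determines the abbreviated accepting path up to the names of the states
    (∀ (α α' : Type) (q q' : ℕ) (M : NFA α (Fin q)) (M' : NFA α' (Fin q'))
      (w : List α) (w' : List α')
      (p : Fin (w.length + 1) → Fin q) (p' : Fin (w'.length + 1) → Fin q')
      (c : List AutomaticComplexity.Symbol),
      AutomaticComplexity.UniquelyAccepts M w →
      AutomaticComplexity.IsAcceptingPath M p w.get →
      AutomaticComplexity.UniquelyAccepts M' w' →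
      AutomaticComplexity.IsAcceptingPath M' p' w'.get →
      AutomaticComplexity.IsBracketCode p c →
      AutomaticComplexity.IsBracketCode p' c →
      ∃ r : Fin q → Fin q', Set.InjOn r (Set.range p) ∧
        AutomaticComplexity.abbreviatedPath p' =
          (AutomaticComplexity.abbreviatedPath p).map
            (fun e => (e.1.map r, r e.2))) := by
  refine ⟨AutomaticComplexity.DEFICIENCY_mem_NP, AutomaticComplexity.DEFICIENCY_mem_E, ?_, ?_⟩
  · intro α q M w p h hp
    exact h.existsUnique_bracketCode hp
  · intro α α' q q' M M' w w' p p' c h hp h' hp' hc hc'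
    exact h.exists_renaming hp h' hp' hc hc'
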